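/- **Notation.** Let $N\ge 1$ and let $\tau=(\tau_1\ge\tau_2\ge\dots)$ be a partition of $N$ with $l=\ell(\tau)$ nonzero parts; put $h_\tau=\tau_1+l-1$. A reverse standard Young tableau (RSYT) of shape $\tau$ is a filling of the Ferrers diagram with $1,\dots,N$, entries decreasing along rows and columns; $c(i,S)=\mathrm{col}(i,S)-\mathrm{row}(i,S)$ is the content of the entry $i$, and $S^{(i)}$ is $S$ with $i,i+1$ exchanged. Let $S_0$ (resp. $S_1$) be the RSYT with $N,N-1,\dots,1$ entered column by column (resp. row by row). For a field $F$ of characteristic $0$ and parameters $q,t\in F$, let $V_\tau$ be the $F$-space with basis the RSYT of shape $\tau$ and $\mathcal P_\tau=F[x_1,\dots,x_N]\otimes V_\tau$. Operators act on the right and products are applied from left to right. For $1\le i<N$ and $b=c(i,S)-c(i+1,S)$ set $S\tau(T_i)=tS$ if $i,i+1$ are in the same row, $S\tau(T_i)=-S$ if they are in the same column, and otherwise $$S\tau(T_i)=S^{(i)}+\tfrac{t-1}{1-t^{-b}}S\ \ (b\ge 2),\qquad S\tau(T_i)=\tfrac{t(t^{b+1}-1)(t^{b-1}-1)}{(t^b-1)^2}S^{(i)}+\tfrac{t^b(t-1)}{t^b-1}S\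 \ (b\le -2).$$ With $s_i$ exchanging the entries $i,i+1$ of a tuple and $\omega=T_1\cdots T_{N-1}$, define on $\mathcal P_\tau$ $$(p\otimes S)\boldsymbol T_i=(1-t)x_{i+1}\tfrac{p(x)-p(x.s_i)}{x_i-x_{i+1}}\otimes S+p(x.s_i)\otimes S\tau(T_i),\qquad (p\otimes S)\boldsymbol w=p(qx_N,x_1,\dots,x_{N-1})\otimes S\tau(\omega),$$ $$\boldsymbol\xi_i=t^{i-N}\boldsymbol T_{i-1}^{-1}\cdots\boldsymbol T_1^{-1}\boldsymbol w\boldsymbol T_{N-1}\cdots\boldsymbol T_i,\qquad \mathcal D_N=(1-\boldsymbol\xi_N)/x_N,\qquad \mathcal D_i=\tfrac1t\boldsymbol T_i\mathcal D_{i+1}\boldsymbol T_i\ (1\le i<N).$$ For $\alpha\in\mathbb N_0^N$ let $r_\alpha(i)=\#\{j:\alpha_j>\alpha_i\}+\#\{j\le i:\alpha_j=\alpha_i\}$ and $\zeta_{\alpha,S}(i)=q^{\alpha_i}t^{c(r_\alpha(i),S)}$. The nonsymmetric Macdonald polynomials $M_{\alpha,S}\in\mathcal P_\tau$ over $F=\mathbb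 Q(q,t)$ are those produced by the Yang–Baxter graph: $M_{\mathbf 0,S_0}=1\otimes S_0$; the polynomial $$M_{\alpha,S}\boldsymbol T_i+\frac{t-1}{\zeta_{\alpha,S}(i+1)/\zeta_{\alpha,S}(i)-1}M_{\alpha,S}$$ is $M_{\alpha.s_i,S}$ if $\alpha_i<\alpha_{i+1}$, and is $M_{\alpha,S^{(j)}}$ if $\alpha_i=\alpha_{i+1}$, $j=r_\alpha(i)$ and $c(j,S)-c(j+1,S)\ge2$; and $M_{\alpha\Phi,S}=x_N(M_{\alpha,S}\boldsymbol w)$ with $\alpha\Phi=(\alpha_2,\dots,\alpha_N,\alpha_1+1)$. With $u(z)=\frac{(t-z)(1-tz)}{(1-z)^2}$ and $\boldsymbol w^*=\boldsymbol T_{N-1}^{-1}\cdots\boldsymbol T_1^{-1}\boldsymbol w\boldsymbol T_{N-1}\cdots\boldsymbol T_1$, call a symmetric bilinear form on $\mathcal P_\tau$ a *Macdonald form* for $(q,t)$ if, for all $f,g\in\mathcal P_\tau$, all RSYT $S,S'$ and $1\le i<N$: $\langle 1\otimes S,1\otimes S'\rangle=\delta_{S,S'}\prod_{i<j,\;c(j,S)-c(i,S)\ge2}u\big(t^{c(i,S)-c(j,S)}\big)$,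 $\langle f\boldsymbol T_i,g\rangle=\langle f,g\boldsymbol T_i\rangle$, $\langle f\boldsymbol\xi_N,g\rangle=\langle f,g\boldsymbol\xi_N\rangle$, and $\langle f\mathcal D_N,g\rangle=(1-q)\langle f,x_N(g\boldsymbol w^*\boldsymbol w)\rangle$. **Proposition** ($M_{\alpha,S_1}$ is singular for $q=t^{h_\tau}$). Suppose $l=\ell(\tau)\ge2$, and let $\alpha=(1^{\tau_l},0^{N-\tau_l})$. The graph reaches $(\alpha,S_1)$. Let $M_{\alpha,S_1}$ be the polynomial over $\mathbb Q(q,t)$ produced along any path to that node. Let $F$ be any field of characteristic $0$ and let $t_0\in F$ be nonzero and not a root of unity. Then the coefficients of $M_{\alpha,S_1}$ have no pole at $(q,t)=(t_0^{h_\tau},t_0)$, the specialized polynomial $f$ is nonzero, and $f\mathcal D_i=0$ for all $1\le i\le N$, where $\mathcal D_i$ is taken at $(q,t)=(t_0^{h_\tau},t_0)$. Moreover $\langle f,g\rangle=0$ for every $g\in\mathcal P_\tau$ and every Macdonald form for $(t_0^{h_\tau},t_0)$; in particular, for real $t_0>0$, $t_0\ne1$, no such form is positive-definite, so the region of positivity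 is sharp on the boundary $q=t^{h_\tau}$. -/

import Mathlib

open MvPolynomial

noncomputable section

namespace VVMacdonald

/-! Throughout `N = n + 1`, the number `k ∈ {1, …, N}` is represented by `k - 1 : Fin (n + 1)`, and
the generator `T_i`, `1 ≤ i < N`, by `i - 1 : Fin n`.  All operators act on the right; a product of
operators is applied from left to right. -/

section Tableaux

/-- Reverse standard Young tableaux of shape `μ`, where `μ` has `n + 1` boxes: `e k` is the box that
holds the entry `k`, and entries decrease along each row and each column. -/
def RSYT (n : ℕ) (μ : YoungDiagram) : Type :=
  {e : Fin (n + 1) ≃ μ.cells //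
    (∀ a b, (e a).1.1 = (e b).1.1 → (e a).1.2 < (e b).1.2 → b < a) ∧
    (∀ a b, (e a).1.2 = (e b).1.2 → (e a).1.1 < (e b).1.1 → b < a)}

instance (n : ℕ) (μ : YoungDiagram) : DecidableEq (RSYT n μ) := Classical.decEq _

instance (n : ℕ) (μ : YoungDiagram) : Fintype (RSYT n μ) := by
  classical
  unfold RSYT
  infer_instance

variable {n : ℕ} {μ : YoungDiagram}

/-- Row (counted from `0`) of the entry `k`. -/
def RSYT.row (S : RSYT n μ) (k : Fin (n + 1)) : ℕ := (S.1 k).1.1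

/-- Column (counted from `0`) of the entry `k`. -/
def RSYT.col (S : RSYT n μ) (k : Fin (n + 1)) : ℕ := (S.1 k).1.2

/-- The content `c(k, S) = col - row`. -/
def RSYT.content (S : RSYT n μ) (k : Fin (n + 1)) : ℤ := (S.col k : ℤ) - (S.row k : ℤ)

/-- `S' = S^{(i)}`: the tableau `S'` is `S` with the entries `i` and `i + 1` exchanged. -/
def IsExchange (i : Fin n) (S S' : RSYT n μ) : Prop :=
  S'.1 = (Equiv.swap i.castSucc i.succ).trans S.1

/-- The bijection `c ↦ key c` from the boxes to their keys. -/
def keyEquiv (key : ℕ × ℕ ↪ ℕ ×ₗ ℕ) (s : Finset (ℕ × ℕ)) : s ≃ s.map key :=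
  Equiv.ofBijective (fun c => ⟨key c.1, Finset.mem_map_of_mem key c.2⟩)
    ⟨fun a b hab => Subtype.ext (key.injective (congrArg Subtype.val hab)), fun ⟨y, hy⟩ => by
      obtain ⟨c, hc, rfl⟩ := Finset.mem_map.1 hy
      exact ⟨⟨c, hc⟩, rfl⟩⟩

/-- The bijection that enters `N, N - 1, …, 1` into the boxes in the lexicographic order of
`key`. -/
def fillEquiv (h : μ.card = n + 1) (key : ℕ × ℕ ↪ ℕ ×ₗ ℕ) : Fin (n + 1) ≃ μ.cells :=
  (Fin.revPerm.trans
    ((μ.cells.map key).orderIsoOfFin ((Finset.card_map key).trans h)).toEquiv).trans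
    (keyEquiv key μ.cells).symm

theorem fillEquiv_lt (h : μ.card = n + 1) (key : ℕ × ℕ ↪ ℕ ×ₗ ℕ) (a b : Fin (n + 1))
    (hab : key (fillEquiv h key a).1 < key (fillEquiv h key b).1) : b < a := by
  have e : ∀ k, key (fillEquiv h key k).1 =
      (((μ.cells.map key).orderIsoOfFin ((Finset.card_map key).trans h)) (Fin.rev k)).1 := by
    intro k
    have := (keyEquiv key μ.cells).apply_symm_apply
      (((μ.cells.map key).orderIsoOfFin ((Finset.card_map key).trans h)) (Fin.rev k))
    exact congrArg Subtype.val this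
  rw [e a, e b] at hab
  have := ((μ.cells.map key).orderIsoOfFin ((Finset.card_map key).trans h)).lt_iff_lt.1
    (Subtype.coe_lt_coe.1 hab)
  exact Fin.rev_lt_rev.1 this

/-- Row-by-row order of the boxes. -/
def rowKey : ℕ × ℕ ↪ ℕ ×ₗ ℕ := ⟨fun c => toLex (c.1, c.2), fun a b h => by simpa using h⟩

/-- Column-by-column order of the boxes. -/
def colKey : ℕ × ℕ ↪ ℕ ×ₗ ℕ :=
  ⟨fun c => toLex (c.2, c.1), fun a b h => by
    have := Prod.mk.inj (toLex.injective h)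
    exact Prod.ext this.2 this.1⟩

/-- The tableau `S₁`: the numbers `N, N - 1, …, 1` entered row by row. -/
def rowFilled (h : μ.card = n + 1) : RSYT n μ :=
  ⟨fillEquiv h rowKey,
    fun a b h1 h2 => fillEquiv_lt h rowKey a b (Prod.Lex.lt_iff.2 (Or.inr ⟨h1, h2⟩)),
    fun a b _ h2 => fillEquiv_lt h rowKey a b (Prod.Lex.lt_iff.2 (Or.inl h2))⟩

/-- The tableau `S₀`: the numbers `N, N - 1, …, 1` entered column by column. -/
def colFilled (h : μ.card = n + 1) : RSYT n μ :=
  ⟨fillEquiv h colKey,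
    fun a b _ h2 => fillEquiv_lt h colKey a b (Prod.Lex.lt_iff.2 (Or.inl h2)),
    fun a b h1 h2 => fillEquiv_lt h colKey a b (Prod.Lex.lt_iff.2 (Or.inr ⟨h1, h2⟩))⟩

/-- The maximal hook length `h_τ = τ₁ + ℓ(τ) - 1` (of a nonempty diagram). -/
def maxHook (μ : YoungDiagram) : ℕ := μ.rowLen 0 + μ.colLen 0 - 1

/-- The composition `(1^m, 0^{N-m})`, where `m = τ_l` is the length of the last row. -/
def lastRowComp (n : ℕ) (μ : YoungDiagram) : Fin (n + 1) → ℕ :=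
  fun i => if (i : ℕ) < μ.rowLen (μ.colLen 0 - 1) then 1 else 0

end Tableaux

section Operators

variable {n : ℕ} {μ : YoungDiagram} {F : Type*} [Field F]

/-- The matrix of `τ(T_i)` in the basis of tableaux, acting on row vectors:
`S τ(T_i) = ∑ S', tauT t i S S' • S'`. -/
def tauT (t : F) (i : Fin n) : Matrix (RSYT n μ) (RSYT n μ) F := fun S S' =>
  open Classical in
  let b : ℤ := S.content i.castSucc - S.content i.succ
  let diag : F := if S' = S then 1 else 0
  let exch : F := if IsExchange i S S' then 1 else 0
  if S.row i.castSucc = S.row i.succ then t * diag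
  else if S.col i.castSucc = S.col i.succ then -diag
  else if S.row i.castSucc < S.row i.succ then
    exch + (t - 1) / (1 - t ^ (-b)) * diag
  else
    t * (t ^ (b + 1) - 1) * (t ^ (b - 1) - 1) / (t ^ b - 1) ^ 2 * exch +
      t ^ b * (t - 1) / (t ^ b - 1) * diag

/-- The matrix of `τ(ω)`, `ω = T_1 T_2 ⋯ T_{N-1}`. -/
def tauOmega (t : F) : Matrix (RSYT n μ) (RSYT n μ) F :=
  ((List.finRange n).map (fun i => (tauT t i : Matrix (RSYT n μ) (RSYT n μ) F))).prod

/-- `P_τ = P ⊗ V_τ`, as the free `P`-module on the tableaux: `f` stands for `∑ S, f S ⊗ S`. -/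
abbrev VPoly (n : ℕ) (μ : YoungDiagram) (F : Type*) [Field F] : Type _ :=
  RSYT n μ → MvPolynomial (Fin (n + 1)) F

/-- The operator `1 ⊗ A` on `P ⊗ V_τ`, with `A` acting on row vectors. -/
def actV (A : Matrix (RSYT n μ) (RSYT n μ) F) (f : VPoly n μ F) : VPoly n μ F :=
  fun S' => ∑ S, A S S' • f S

/-- `p(x) ↦ p(x.s)`, where `s` exchanges the variables with indices `i` and `j`. -/
def swapVars {σ : Type*} [DecidableEq σ] (i j : σ) (p : MvPolynomial σ F) : MvPolynomial σ F :=
  rename (Equiv.swap i j) p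

theorem X_sub_X_dvd {σ : Type*} [DecidableEq σ] (i j : σ) (p : MvPolynomial σ F) :
    (X i - X j) ∣ p - swapVars i j p := by
  induction p using MvPolynomial.induction_on with
  | C a => simp [swapVars]
  | add p r hp hr =>
    have : p + r - swapVars i j (p + r) = (p - swapVars i j p) + (r - swapVars i j r) := by
      simp only [swapVars, map_add]; ring
    rw [this]; exact dvd_add hp hr
  | mul_X p k hp =>
    have : p * X k - swapVars i j (p * X k) =
        (p - swapVars i j p) * X k + swapVars i j p * (X k - X (Equiv.swap i j k)) := by
      simp only [swapVars, map_mul, rename_X]; ring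
    rw [this]
    refine dvd_add (hp.mul_right _) (Dvd.dvd.mul_left ?_ _)
    by_cases h1 : k = i
    · subst h1; simp
    · by_cases h2 : k = j
      · subst h2; rw [Equiv.swap_apply_right]; exact ⟨-1, by ring⟩
      · rw [Equiv.swap_apply_of_ne_of_ne h1 h2]; simp

/-- The divided difference `(p(x) - p(x.s)) / (x_i - x_j)`. -/
def divDiff {σ : Type*} [DecidableEq σ] (i j : σ) (p : MvPolynomial σ F) : MvPolynomial σ F :=
  Classical.choose (X_sub_X_dvd i j p)

theorem divDiff_spec {σ : Type*} [DecidableEq σ] (i j : σ) (p : MvPolynomial σ F) :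
    p - swapVars i j p = (X i - X j) * divDiff i j p :=
  Classical.choose_spec (X_sub_X_dvd i j p)

/-- The operator `T_i` on `P_τ`. -/
def opT (t : F) (i : Fin n) (f : VPoly n μ F) : VPoly n μ F :=
  (fun S => C (1 - t) * X i.succ * divDiff i.castSucc i.succ (f S)) +
    actV (tauT t i) (fun S => swapVars i.castSucc i.succ (f S))

/-- The operator `T_i⁻¹ = t⁻¹ (T_i + 1 - t)` on `P_τ`. -/
def opTinv (t : F) (i : Fin n) (f : VPoly n μ F) : VPoly n μ F :=
  t⁻¹ • (opT t i f + (1 - t) • f)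

/-- `p(x) ↦ p(q x_N, x_1, …, x_{N-1})`. -/
def shiftVars (q : F) (p : MvPolynomial (Fin (n + 1)) F) : MvPolynomial (Fin (n + 1)) F :=
  aeval (Fin.cases (C q * X (Fin.last n)) (fun k : Fin n => X k.castSucc) :
    Fin (n + 1) → MvPolynomial (Fin (n + 1)) F) p

/-- The operator `w` on `P_τ`. -/
def opW (q t : F) (f : VPoly n μ F) : VPoly n μ F :=
  actV (tauOmega t) (fun S => shiftVars q (f S))

/-- `f T_{k}⁻¹ T_{k-1}⁻¹ ⋯ T_1⁻¹` (generators counted from `1`). -/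
def opTinvDown (t : F) (k : ℕ) (f : VPoly n μ F) : VPoly n μ F :=
  ((List.finRange n).reverse.filter (fun j : Fin n => (j : ℕ) < k)).foldl (fun g j => opTinv t j g) f

/-- `f T_{N-1} T_{N-2} ⋯ T_{k+1}` (generators counted from `1`). -/
def opTDown (t : F) (k : ℕ) (f : VPoly n μ F) : VPoly n μ F :=
  ((List.finRange n).reverse.filter (fun j : Fin n => k ≤ (j : ℕ))).foldl (fun g j => opT t j g) f

/-- The Cherednik operator
`ξ_i = t^{i-N} T_{i-1}⁻¹ ⋯ T_1⁻¹ w T_{N-1} ⋯ T_i` on `P_τ`. -/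
def opXi (q t : F) (i : Fin (n + 1)) (f : VPoly n μ F) : VPoly n μ F :=
  t ^ ((i : ℤ) - (n : ℤ)) • opTDown t i (opW q t (opTinvDown t i f))

/-- The Dunkl operators `D_N = (1 - ξ_N) / x_N` and `D_i = t⁻¹ T_i D_{i+1} T_i` on `P_τ`.  The
division by `x_N` is exact: modulo `x_N`, the polynomial `f ξ_N` is
`f τ(T_{N-1}⁻¹ ⋯ T_1⁻¹) τ(ω) = f`. -/
def opD (q t : F) (i : Fin (n + 1)) : VPoly n μ F → VPoly n μ F :=
  Fin.reverseInduction (motive := fun _ => VPoly n μ F → VPoly n μ F)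
    (fun f S => (f S - opXi q t (Fin.last n) f S).divMonomial (Finsupp.single (Fin.last n) 1))
    (fun i D f => t⁻¹ • opT t i (D (opT t i f))) i

end Operators

section Macdonald

variable {n : ℕ} {μ : YoungDiagram} {F : Type*} [Field F]

/-- The rank function: `rank α i + 1 = #{j : α_j > α_i} + #{j ≤ i : α_j = α_i}`, so that `rank α i`
represents the number `r_α(i)`. -/
def rank (α : Fin (n + 1) → ℕ) (i : Fin (n + 1)) : Fin (n + 1) :=
  ⟨(Finset.univ.filter (fun j => α i < α j ∨ (α j = α i ∧ j < i))).card, by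
    have : (Finset.univ.filter (fun j => α i < α j ∨ (α j = α i ∧ j < i))).card <
        (Finset.univ : Finset (Fin (n + 1))).card :=
      Finset.card_lt_card (Finset.ssubset_univ_iff.2 fun h => by
        have := Finset.mem_univ i
        rw [← h] at this
        simp at this)
    simpa using this⟩

/-- The spectral vector `ζ_{α,S}(i) = q^{α_i} t^{c(r_α(i), S)}`. -/
def spectral (q t : F) (α : Fin (n + 1) → ℕ) (S : RSYT n μ) (i : Fin (n + 1)) : F :=
  q ^ α i * t ^ S.content (rank α i)

/-- `f T_i + (t - 1) / (ζ_{α,S}(i+1) / ζ_{α,S}(i) - 1) f`. -/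
def ybStep (q t : F) (α : Fin (n + 1) → ℕ) (S : RSYT n μ) (i : Fin n) (f : VPoly n μ F) :
    VPoly n μ F :=
  opT t i f + ((t - 1) / (spectral q t α S i.succ / spectral q t α S i.castSucc - 1)) • f

/-- `IsMacdonald h q t α S M`: the polynomial `M` is the vector-valued nonsymmetric Macdonald
polynomial `M_{α,S}`, produced by the steps of the Yang–Baxter graph from its root
`M_{0,S₀} = 1 ⊗ S₀`. -/
inductive IsMacdonald (h : μ.card = n + 1) (q t : F) :
    (Fin (n + 1) → ℕ) → RSYT n μ → VPoly n μ F → Prop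
  | root : IsMacdonald h q t 0 (colFilled h) (Pi.single (colFilled h) 1)
  | step (α : Fin (n + 1) → ℕ) (S : RSYT n μ) (M : VPoly n μ F) (i : Fin n) :
      IsMacdonald h q t α S M → α i.castSucc < α i.succ →
      IsMacdonald h q t (α ∘ Equiv.swap i.castSucc i.succ) S (ybStep q t α S i M)
  | tableau (α : Fin (n + 1) → ℕ) (S S' : RSYT n μ) (M : VPoly n μ F) (i j : Fin n) :
      IsMacdonald h q t α S M → α i.castSucc = α i.succ → j.castSucc = rank α i.castSucc →
      2 ≤ S.content j.castSucc - S.content j.succ → IsExchange j S S' →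
      IsMacdonald h q t α S' (ybStep q t α S i M)
  | affine (α : Fin (n + 1) → ℕ) (S : RSYT n μ) (M : VPoly n μ F) :
      IsMacdonald h q t α S M →
      IsMacdonald h q t (Fin.snoc (Fin.tail α) (α 0 + 1)) S
        (fun S' => X (Fin.last n) * opW q t M S')

/-- The field `ℚ(q, t)`. -/
abbrev ParamField : Type := FractionRing (MvPolynomial (Fin 2) ℚ)

/-- The indeterminate `q` of `ℚ(q, t)`. -/
def qGen : ParamField := algebraMap (MvPolynomial (Fin 2) ℚ) ParamField (X 0)

/-- The indeterminate `t` of `ℚ(q, t)`. -/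
def tGen : ParamField := algebraMap (MvPolynomial (Fin 2) ℚ) ParamField (X 1)

/-- The rational function `c(q, t)` has no pole at `(q, t) = (q₀, t₀)`, and its value there is
`y`. -/
def SpecializesTo [CharZero F] (q₀ t₀ : F) (c : ParamField) (y : F) : Prop :=
  ∃ a b : MvPolynomial (Fin 2) ℚ, aeval ![q₀, t₀] b ≠ 0 ∧
    c * algebraMap _ ParamField b = algebraMap _ ParamField a ∧
    y * aeval ![q₀, t₀] b = aeval ![q₀, t₀] a

/-- No coefficient of `M` has a pole at `(q, t) = (q₀, t₀)`, and `f` is the value of `M` there. -/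
def IsSpecialization [CharZero F] (q₀ t₀ : F) (M : VPoly n μ ParamField) (f : VPoly n μ F) : Prop :=
  ∀ (S : RSYT n μ) (β : Fin (n + 1) →₀ ℕ), SpecializesTo q₀ t₀ (coeff β (M S)) (coeff β (f S))

end Macdonald

section Form

variable {n : ℕ} {μ : YoungDiagram} {F : Type*} [Field F]

/-- `u(z) = (t - z)(1 - t z) / (1 - z)²`. -/
def uFun (t z : F) : F := (t - z) * (1 - t * z) / (1 - z) ^ 2

/-- `⟨S, S⟩₀`, the product of `u(t^{c(i,S) - c(j,S)})` over `i < j` with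
`c(j,S) - c(i,S) ≥ 2`. -/
def normZero (t : F) (S : RSYT n μ) : F :=
  ∏ p : Fin (n + 1) × Fin (n + 1) with p.1 < p.2 ∧ 2 ≤ S.content p.2 - S.content p.1,
    uFun t (t ^ (S.content p.1 - S.content p.2))

/-- `w* = T_{N-1}⁻¹ ⋯ T_1⁻¹ w T_{N-1} ⋯ T_1`. -/
def opWStar (q t : F) (f : VPoly n μ F) : VPoly n μ F :=
  opTDown t 0 (opW q t (opTinvDown t n f))

/-- The postulates on a symmetric bilinear form `⟨·,·⟩` on `P_τ`. -/
structure IsMacdonaldForm (q t : F) (B : LinearMap.BilinForm F (VPoly n μ F)) : Prop where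
  symm : ∀ f g, B f g = B g f
  const : ∀ S S' : RSYT n μ,
    B (Pi.single S 1) (Pi.single S' 1) = if S = S' then normZero t S else 0
  hecke : ∀ (i : Fin n) (f g : VPoly n μ F), B (opT t i f) g = B f (opT t i g)
  cherednik : ∀ f g : VPoly n μ F, B (opXi q t (Fin.last n) f) g = B f (opXi q t (Fin.last n) g)
  dunkl : ∀ f g : VPoly n μ F, B (opD q t (Fin.last n) f) g =
    (1 - q) * B f (fun S => X (Fin.last n) * opW q t (opWStar q t g) S)

end Form

end VVMacdonald

end

noncomputable section

namespace VVMacdonald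

/-! ### Positions and contents of the entries of a tableau -/

section TableauCombinatorics

variable {n : ℕ} {μ : YoungDiagram}

/-! At `q = t ^ h_τ` every spectral value of a 0/1 composition is a power `t ^ z` with `z = h_τ α_i
+ c(r_α(i), S)` (`zexp`). Contents lie between `1 - l` and `τ₁ - 1`, so `z ≥ τ₁` exactly where `α_i
= 1` (`rowLen_le_zexp_iff`), and the exponents determine `(α, S)` (`eq_of_zexp_eq`). Hence no
denominator vanishes on the part of the Yang–Baxter graph with 0/1 labels, and the polynomials
specialize there without losing their leading term (`IsMacdonald.exists_isSpecialization`). A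
dimension count shows moreover that the Cherednik operators have simple joint spectrum on the span
of the `x^d ⊗ v` with `d` a 0/1 composition (`exists_isLeading_smul`).

Singularity comes from a Hecke-invariant subspace on which `ξ_N = 1`: there `D_N` vanishes, and so
do the other `D_i` by their recursion (`opD_eq_zero`). The subspace, `chainSpan`, is spanned by the
eigenvectors with chained exponents: every `z_a ≥ τ₁` is followed, somewhere to the right, by `z_a -
1`. The last position cannot start a chain, so `α_N = 0`, and since the entry `N` has content zero,
`ξ_N = 1` (`opXi_last_of_mem_chainSpan`).

For invariance (`IsChained.comp_swap`, `opT_mem_chainSpan`), `T_i` differs by a scalar from an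
intertwiner that swaps the exponents at `i` and `i + 1`. The swap breaks a chain only if `z_{i+1} =
z_i - 1` and `z_i ≥ τ₁`, and then the intertwiner kills the eigenvector. If `α_i = α_{i+1}`, its
image would belong to a tableau with two adjacent entries exchanged, and there is none. If `(α_i,
α_{i+1}) = (1, 0)`, its image would be an eigenvector of `T_i` for `-1`, although `T_i` moves its
leading term to a monomial it does not contain.

The exponents of `(α, S₁)` on the last row are `τ₁ + τ_l - 1, …, τ₁`, and the end of the first row
supplies `τ₁ - 1` (`isChained_lastRowComp`), so the specialized polynomial lies in `chainSpan`. For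
a Macdonald form, the Dunkl postulate and the surjectivity of `w` and `w*` make the subspace
orthogonal to `x_N P_τ`, and self-adjointness of `T_i` extends this to every `x_j P_τ`. Constants
belong to the subspace as well, and `f` has positive degree, so `f` is also orthogonal to the
constants. -/

theorem RSYT.eq_of_row_col (S : RSYT n μ) {a b : Fin (n + 1)} (hr : S.row a = S.row b)
    (hc : S.col a = S.col b) : a = b :=
  S.1.injective (Subtype.ext (Prod.ext hr hc))

theorem RSYT.mem_cells (S : RSYT n μ) (a : Fin (n + 1)) : (S.row a, S.col a) ∈ μ :=
  (S.1 a).2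

/-- The entry of the box `(r, c)`. -/
theorem RSYT.exists_entry (S : RSYT n μ) {r c : ℕ} (h : (r, c) ∈ μ) :
    ∃ k, S.row k = r ∧ S.col k = c :=
  ⟨S.1.symm ⟨(r, c), h⟩, by simp [RSYT.row], by simp [RSYT.col]⟩

theorem RSYT.lt_of_row_eq (S : RSYT n μ) {a b : Fin (n + 1)} (hr : S.row a = S.row b)
    (hc : S.col a < S.col b) : b < a := S.2.1 a b hr hc

theorem RSYT.lt_of_col_eq (S : RSYT n μ) {a b : Fin (n + 1)} (hc : S.col a = S.col b)
    (hr : S.row a < S.row b) : b < a := S.2.2 a b hc hr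

/-- Both entries are compared with the entry in the row of `a` and the column of `b`. -/
theorem RSYT.le_of_le (S : RSYT n μ) {a b : Fin (n + 1)} (hr : S.row a ≤ S.row b)
    (hc : S.col a ≤ S.col b) : b ≤ a := by
  obtain ⟨k, hk1, hk2⟩ := S.exists_entry (μ.up_left_mem hr le_rfl (S.mem_cells b))
  have h1 : k ≤ a := by
    rcases hc.lt_or_eq with h | h
    · exact (S.lt_of_row_eq hk1.symm (hk2 ▸ h)).le
    · exact (S.eq_of_row_col hk1 (hk2.trans h.symm)).le
  have h2 : b ≤ k := by
    rcases hr.lt_or_eq with h | h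
    · exact (S.lt_of_col_eq hk2 (hk1 ▸ h)).le
    · exact (S.eq_of_row_col (h.symm.trans hk1.symm) hk2.symm).le
  exact h2.trans h1

/-- The four relative positions of consecutive entries. -/
theorem RSYT.adjacent_cases (S : RSYT n μ) (i : Fin n) :
    (S.row i.castSucc = S.row i.succ ∧ S.col i.castSucc = S.col i.succ + 1) ∨
    (S.col i.castSucc = S.col i.succ ∧ S.row i.castSucc = S.row i.succ + 1) ∨
    (S.row i.castSucc < S.row i.succ ∧ S.col i.succ < S.col i.castSucc) ∨
    (S.row i.succ < S.row i.castSucc ∧ S.col i.castSucc < S.col i.succ) := by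
  have hlt : i.castSucc < i.succ := Fin.castSucc_lt_succ
  have hne : ¬ (S.row i.castSucc ≤ S.row i.succ ∧ S.col i.castSucc ≤ S.col i.succ) :=
    fun h => absurd (S.le_of_le h.1 h.2) (not_le.2 hlt)
  -- A box in the rectangle spanned by the two boxes holds an entry between `i` and `i + 1`, so it
  -- is one of the two. A corner and two neighbours of the box of `i + 1` then force adjacency.
  have key : ∀ r c, r ≤ S.row i.castSucc → c ≤ S.col i.castSucc → S.row i.succ ≤ r →
      S.col i.succ ≤ c → (r = S.row i.castSucc ∧ c = S.col i.castSucc) ∨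
      (r = S.row i.succ ∧ c = S.col i.succ) := by
    intro r c h1 h2 h3 h4
    obtain ⟨k, rfl, rfl⟩ := S.exists_entry (μ.up_left_mem h1 h2 (S.mem_cells i.castSucc))
    have h5 := S.le_of_le h1 h2
    have h6 := S.le_of_le h3 h4
    have : k = i.castSucc ∨ k = i.succ := by
      rw [Fin.le_def] at h5 h6
      simp only [Fin.ext_iff, Fin.val_castSucc, Fin.val_succ] at h5 h6 ⊢
      omega
    rcases this with rfl | rfl <;> simp
  by_cases h : S.row i.succ ≤ S.row i.castSucc ∧ S.col i.succ ≤ S.col i.castSucc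
  · obtain ⟨h1, h2⟩ := h
    have a1 := key (S.row i.castSucc) (S.col i.succ) le_rfl h2 h1 le_rfl
    have a2 := key (S.row i.succ + 1) (S.col i.succ)
    have a3 := key (S.row i.succ) (S.col i.succ + 1)
    omega
  · omega

theorem RSYT.content_diff_cases (S : RSYT n μ) (i : Fin n) :
    (S.row i.castSucc = S.row i.succ ∧ S.col i.castSucc ≠ S.col i.succ ∧
      S.content i.castSucc - S.content i.succ = 1) ∨
    (S.row i.castSucc ≠ S.row i.succ ∧ S.col i.castSucc = S.col i.succ ∧
      S.content i.castSucc - S.content i.succ = -1) ∨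
    (S.row i.castSucc < S.row i.succ ∧ S.col i.succ < S.col i.castSucc ∧
      2 ≤ S.content i.castSucc - S.content i.succ) ∨
    (S.row i.succ < S.row i.castSucc ∧ S.col i.castSucc < S.col i.succ ∧
      S.content i.castSucc - S.content i.succ ≤ -2) := by
  have := S.adjacent_cases i
  simp only [RSYT.content]
  omega

theorem RSYT.content_diff_ne_zero (S : RSYT n μ) (i : Fin n) :
    S.content i.castSucc - S.content i.succ ≠ 0 := by
  have := S.content_diff_cases i
  omega

/-- Contents of entries `i` and `i + 2` differ. -/
theorem RSYT.content_diff_ne_zero_of_two (S : RSYT n μ) {i j : Fin n}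
    (h : j.castSucc = i.succ) : S.content i.castSucc - S.content j.succ ≠ 0 := by
  intro h0
  have hij : (j : ℕ) = i + 1 := by simpa [Fin.ext_iff] using h
  have hlt : i.castSucc < j.succ := by simp [Fin.lt_def]; omega
  have hle : S.row i.castSucc ≤ S.row j.succ → S.col i.castSucc ≤ S.col j.succ → False :=
    fun h1 h2 => absurd (S.le_of_le h1 h2) (not_le.2 hlt)
  simp only [RSYT.content] at h0
  have h1 : S.row j.succ < S.row i.castSucc := by
    by_contra hc
    exact hle (by omega) (by omega)
  -- On a common diagonal, the other two corners of the square would hold distinct entries strictly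
  -- between `i` and `i + 2`, where there is only one integer.
  have e1 : ∃ k, S.row k = S.row j.succ ∧ S.col k = S.col i.castSucc :=
    S.exists_entry (μ.up_left_mem h1.le le_rfl (S.mem_cells _))
  have e2 : ∃ k, S.row k = S.row i.castSucc ∧ S.col k = S.col j.succ :=
    S.exists_entry (μ.up_left_mem le_rfl (by omega) (S.mem_cells _))
  obtain ⟨k, k1, k2⟩ := e1
  obtain ⟨m, m1, m2⟩ := e2
  have a1 := S.lt_of_col_eq k2 (k1 ▸ h1)
  have a2 := S.lt_of_row_eq k1.symm (by omega)
  have a3 := S.lt_of_row_eq m1 (by omega)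
  have a4 := S.lt_of_col_eq m2.symm (by omega)
  have : k = m := by
    simp only [Fin.lt_def, Fin.ext_iff, Fin.val_castSucc, Fin.val_succ] at *
    omega
  subst this
  omega

theorem RSYT.content_last (S : RSYT n μ) : S.content (Fin.last n) = 0 := by
  obtain ⟨k, k1, k2⟩ := S.exists_entry (μ.up_left_mem (Nat.zero_le _) (Nat.zero_le _)
    (S.mem_cells (Fin.last n)))
  have h := S.le_of_le (a := k) (b := Fin.last n) (by omega) (by omega)
  have : k = Fin.last n := le_antisymm (Fin.le_last _) h
  subst this
  simp [RSYT.content, k1, k2]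

theorem RSYT.row_lt (S : RSYT n μ) (a : Fin (n + 1)) : S.row a < μ.colLen 0 :=
  YoungDiagram.mem_iff_lt_colLen.1 (μ.up_left_mem le_rfl (Nat.zero_le _) (S.mem_cells a))

theorem RSYT.col_lt (S : RSYT n μ) (a : Fin (n + 1)) : S.col a < μ.rowLen 0 :=
  YoungDiagram.mem_iff_lt_rowLen.1 (μ.up_left_mem (Nat.zero_le _) le_rfl (S.mem_cells a))

theorem RSYT.content_lt (S : RSYT n μ) (a : Fin (n + 1)) : S.content a < μ.rowLen 0 := by
  have := S.col_lt a
  simp only [RSYT.content]; omega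

theorem RSYT.lt_content (S : RSYT n μ) (a : Fin (n + 1)) : -(μ.colLen 0 : ℤ) < S.content a := by
  have := S.row_lt a
  simp only [RSYT.content]; omega

theorem RSYT.maxHook_add_content (S : RSYT n μ) (a b : Fin (n + 1)) :
    (μ.rowLen 0 : ℤ) ≤ maxHook μ + S.content a ∧ S.content b < μ.rowLen 0 := by
  have h1 := S.lt_content a
  have h2 := S.content_lt b
  have h3 := S.row_lt a
  simp only [maxHook]; omega

/-- If `S` and `S'` agree above `p` and the boxes of `p` are comparable, these boxes coincide. -/
theorem RSYT.eq_of_agree_of_le {S S' : RSYT n μ} {p : Fin (n + 1)}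
    (h : ∀ k, p < k → S.row k = S'.row k ∧ S.col k = S'.col k)
    (hr : S.row p ≤ S'.row p) (hc : S.col p ≤ S'.col p) :
    S.row p = S'.row p ∧ S.col p = S'.col p := by
  -- The box of `p` in `S` carries in `S'` an entry at least `p`; a larger entry would sit in this
  -- box in `S` too.
  obtain ⟨k, k1, k2⟩ := S'.exists_entry (S.mem_cells p)
  have hk : p ≤ k := S'.le_of_le (by omega) (by omega)
  rcases hk.lt_or_eq with hk | rfl
  · obtain ⟨h1, h2⟩ := h k hk
    exact absurd (S.eq_of_row_col (h1.trans k1) (h2.trans k2)) hk.ne'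
  · omega

/-- If `S` and `S'` agree above `p`, then the boxes of `p` coincide or have contents which differ
by at least two. -/
theorem RSYT.eq_of_agree_of_content {S S' : RSYT n μ} {p : Fin (n + 1)}
    (h : ∀ k, p < k → S.row k = S'.row k ∧ S.col k = S'.col k)
    (h1 : S.content p ≤ S'.content p + 1) (h2 : S'.content p ≤ S.content p + 1) :
    S.row p = S'.row p ∧ S.col p = S'.col p := by
  have h' : ∀ k, p < k → S'.row k = S.row k ∧ S'.col k = S.col k :=
    fun k hk => ⟨(h k hk).1.symm, (h k hk).2.symm⟩
  simp only [RSYT.content] at h1 h2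
  -- Boxes whose contents differ by at most one are comparable componentwise, in one direction or
  -- the other.
  by_cases hc : S.row p ≤ S'.row p ∧ S.col p ≤ S'.col p
  · exact RSYT.eq_of_agree_of_le h hc.1 hc.2
  · have := RSYT.eq_of_agree_of_le h' (by omega) (by omega)
    omega

theorem RSYT.agree_of_content_eq {S S' : RSYT n μ} (p : Fin (n + 1))
    (h : ∀ k, p ≤ k → S.content k = S'.content k) (k : Fin (n + 1)) (hk : p ≤ k) :
    S.row k = S'.row k ∧ S.col k = S'.col k := by
  induction k using WellFoundedGT.induction with
  | ind k ih =>
    exact eq_of_agree_of_content (fun j hj => ih j hj (hk.trans hj.le)) (by rw [h _ hk]; omega)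
      (by rw [h _ hk]; omega)

theorem RSYT.ext_row_col {S S' : RSYT n μ} (h : ∀ k, S.row k = S'.row k ∧ S.col k = S'.col k) :
    S = S' :=
  Subtype.ext (Equiv.ext fun k => Subtype.ext (Prod.ext (h k).1 (h k).2))

theorem RSYT.ext_content {S S' : RSYT n μ} (h : ∀ k, S.content k = S'.content k) : S = S' :=
  RSYT.ext_row_col fun k => RSYT.agree_of_content_eq k (fun j _ => h j) k le_rfl

/-- If the contents of `S'` are those of `S` with positions `i`, `i + 1` exchanged, then `i` and
`i + 1` are not adjacent in `S`. -/
theorem RSYT.two_le_abs_of_content_swap {S S' : RSYT n μ} (i : Fin n)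
    (h : ∀ k, S'.content k = S.content (Equiv.swap i.castSucc i.succ k)) :
    2 ≤ |S.content i.castSucc - S.content i.succ| := by
  by_contra hlt
  have h0 := S.content_diff_ne_zero i
  have h1 := h i.succ
  rw [Equiv.swap_apply_right] at h1
  have hag : ∀ k, i.succ < k → S.row k = S'.row k ∧ S.col k = S'.col k := by
    intro k hk
    refine RSYT.agree_of_content_eq k (fun j hj => ?_) k le_rfl
    have hj' := hk.trans_le hj
    rw [h, Equiv.swap_apply_of_ne_of_ne _ hj'.ne']
    exact (Fin.castSucc_lt_succ.trans hj').ne'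
  have h2 := abs_lt.1 (not_le.1 hlt)
  -- The tableaux agree above `i + 1`, so `i + 1` would occupy the same box in both, making the
  -- contents of `i` and `i + 1` equal.
  have h3 := RSYT.eq_of_agree_of_content hag (by omega) (by omega)
  simp only [RSYT.content] at *
  omega

theorem exists_isExchange {i : Fin n} {S : RSYT n μ}
    (h : 2 ≤ |S.content i.castSucc - S.content i.succ|) : ∃ S', IsExchange i S S' := by
  have hc := S.content_diff_cases i
  have hr : S.row i.castSucc ≠ S.row i.succ ∧ S.col i.castSucc ≠ S.col i.succ := by
    rw [le_abs] at h
    omega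
  -- The transposition reverses the order of no pair except `i, i + 1`, and these two entries share
  -- neither a row nor a column.
  have key : ∀ a b : Fin (n + 1), Equiv.swap i.castSucc i.succ b <
      Equiv.swap i.castSucc i.succ a →
      ¬ (Equiv.swap i.castSucc i.succ b = i.castSucc ∧
        Equiv.swap i.castSucc i.succ a = i.succ) → b < a := by
    intro a b
    simp only [Equiv.swap_apply_def, Fin.ext_iff, Fin.lt_def]
    clear h hc hr
    split_ifs <;> simp only [Fin.val_castSucc, Fin.val_succ, and_self, not_true_eq_false,
      false_imp_iff, imp_true_iff] at * <;> omega
  refine ⟨⟨(Equiv.swap i.castSucc i.succ).trans S.1, ?_, ?_⟩, rfl⟩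
  · intro a b h1 h2
    refine key a b (S.lt_of_row_eq h1 h2) fun ⟨hb, ha⟩ => ?_
    simp only [Equiv.trans_apply, ha, hb] at h1
    exact hr.1 h1.symm
  · intro a b h1 h2
    refine key a b (S.lt_of_col_eq h1 h2) fun ⟨hb, ha⟩ => ?_
    simp only [Equiv.trans_apply, ha, hb] at h1
    exact hr.2 h1.symm

open Classical in
/-- `S^{(i)}` if `i` and `i + 1` are not adjacent, and `S` otherwise. -/
def exch (i : Fin n) (S : RSYT n μ) : RSYT n μ :=
  if h : 2 ≤ |S.content i.castSucc - S.content i.succ| then (exists_isExchange h).choose else S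

variable {i : Fin n} {S S' : RSYT n μ}

theorem isExchange_exch (h : 2 ≤ |S.content i.castSucc - S.content i.succ|) :
    IsExchange i S (exch i S) := by
  rw [exch, dif_pos h]
  exact (exists_isExchange h).choose_spec

theorem IsExchange.row (h : IsExchange i S S') (k : Fin (n + 1)) :
    S'.row k = S.row (Equiv.swap i.castSucc i.succ k) := by
  have : S'.1 = _ := h
  simp [RSYT.row, this]

theorem IsExchange.col (h : IsExchange i S S') (k : Fin (n + 1)) :
    S'.col k = S.col (Equiv.swap i.castSucc i.succ k) := by
  have : S'.1 = _ := h
  simp [RSYT.col, this]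

theorem IsExchange.content (h : IsExchange i S S') (k : Fin (n + 1)) :
    S'.content k = S.content (Equiv.swap i.castSucc i.succ k) := by
  simp [RSYT.content, h.row, h.col]

theorem IsExchange.two_le (h : IsExchange i S S') :
    2 ≤ |S.content i.castSucc - S.content i.succ| :=
  RSYT.two_le_abs_of_content_swap i h.content

theorem IsExchange.eq_exch (h : IsExchange i S S') : S' = exch i S :=
  Subtype.ext (Eq.trans h (isExchange_exch h.two_le).symm)

theorem IsExchange.symm (h : IsExchange i S S') : IsExchange i S' S := by
  have h1 : S'.1 = _ := h
  simp only [IsExchange, h1, ← Equiv.trans_assoc]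
  rw [← Equiv.Perm.mul_def, Equiv.swap_mul_self, Equiv.Perm.one_def, Equiv.refl_trans]

theorem isExchange_iff : IsExchange i S S' ↔
    2 ≤ |S.content i.castSucc - S.content i.succ| ∧ S' = exch i S :=
  ⟨fun h => ⟨h.two_le, h.eq_exch⟩, fun h => h.2 ▸ isExchange_exch h.1⟩

theorem content_exch (h : 2 ≤ |S.content i.castSucc - S.content i.succ|) (k : Fin (n + 1)) :
    (exch i S).content k = S.content (Equiv.swap i.castSucc i.succ k) :=
  (isExchange_exch h).content k

theorem exch_exch (h : 2 ≤ |S.content i.castSucc - S.content i.succ|) :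
    exch i (exch i S) = S :=
  (isExchange_exch h).symm.eq_exch.symm

end TableauCombinatorics

/-! ### The tableaux filled by columns and by rows -/

section Fillings

variable {n : ℕ} {μ : YoungDiagram}

/-- Both tableaux list the same set of keys in strictly decreasing order, and a strictly monotone
sequence is determined by its range. -/
theorem RSYT.eq_of_key {S S' : RSYT n μ} (key : ℕ × ℕ ↪ ℕ ×ₗ ℕ)
    (h : ∀ i : Fin n, key (S.1 i.succ).1 < key (S.1 i.castSucc).1)
    (h' : ∀ i : Fin n, key (S'.1 i.succ).1 < key (S'.1 i.castSucc).1) : S = S' := by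
  have anti : ∀ T : RSYT n μ, (∀ i : Fin n, key (T.1 i.succ).1 < key (T.1 i.castSucc).1) →
      StrictAnti fun k => key (T.1 k).1 := fun T hT => Fin.strictAnti_iff_succ_lt.2 hT
  have rng : ∀ T : RSYT n μ, Set.range (fun k => key (T.1 k).1) = key '' (μ.cells : Set (ℕ × ℕ)) := by
    intro T
    ext y
    constructor
    · rintro ⟨k, rfl⟩
      exact ⟨_, (T.1 k).2, rfl⟩
    · rintro ⟨c, hc, rfl⟩
      exact ⟨T.1.symm ⟨c, hc⟩, by simp⟩
  have h1 := (anti S h).dual_right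
  have h2 := (anti S' h').dual_right
  have := (StrictMono.range_inj h1 h2).1 ((rng S).trans (rng S').symm)
  refine Subtype.ext (Equiv.ext fun k => Subtype.ext (key.injective ?_))
  exact congrFun this k

theorem key_fillEquiv_lt (h : μ.card = n + 1) (key : ℕ × ℕ ↪ ℕ ×ₗ ℕ) (a b : Fin (n + 1))
    (hab : b < a) : key (fillEquiv h key a).1 < key (fillEquiv h key b).1 := by
  rcases lt_trichotomy (key (fillEquiv h key a).1) (key (fillEquiv h key b).1) with h1 | h1 | h1
  · exact h1
  · exact absurd ((fillEquiv h key).injective (Subtype.ext (key.injective h1))) hab.ne'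
  · exact absurd (fillEquiv_lt h key b a h1) hab.not_gt

/-- A tableau whose columns weakly increase as the entries decrease is `S₀`. -/
theorem RSYT.eq_colFilled (h : μ.card = n + 1) {S : RSYT n μ}
    (hS : ∀ i : Fin n, S.col i.succ ≤ S.col i.castSucc) : S = colFilled h := by
  refine RSYT.eq_of_key colKey (fun i => ?_)
    fun i => key_fillEquiv_lt h colKey _ _ Fin.castSucc_lt_succ
  rw [Prod.Lex.lt_iff]
  have h1 := S.adjacent_cases i
  have h2 := hS i
  change S.col _ < S.col _ ∨ S.col _ = S.col _ ∧ S.row _ < S.row _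
  omega

theorem rowFilled_lt (h : μ.card = n + 1) {a b : Fin (n + 1)} (hab : b < a) :
    (rowFilled h).row a < (rowFilled h).row b ∨
      ((rowFilled h).row a = (rowFilled h).row b ∧ (rowFilled h).col a < (rowFilled h).col b) := by
  have := key_fillEquiv_lt h rowKey a b hab
  rw [Prod.Lex.lt_iff] at this
  exact this

/-- In `S₁` the last row holds the smallest entries. -/
theorem rowFilled_last_row (h : μ.card = n + 1) (hl : 0 < μ.colLen 0) (i : Fin (n + 1))
    (hi : (i : ℕ) < μ.rowLen (μ.colLen 0 - 1)) :
    (rowFilled h).row i = μ.colLen 0 - 1 ∧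
      (rowFilled h).col i = μ.rowLen (μ.colLen 0 - 1) - 1 - i := by
  induction i using WellFoundedLT.induction with
  | ind i ih =>
  obtain ⟨k, k1, k2⟩ := (rowFilled h).exists_entry (μ.mem_iff_lt_rowLen.2
    (show μ.rowLen (μ.colLen 0 - 1) - 1 - i < μ.rowLen (μ.colLen 0 - 1) by omega))
  rcases lt_trichotomy k i with hk | rfl | hk
  · have := ih k hk (by simp only [Fin.lt_def] at hk; omega)
    simp only [Fin.lt_def] at hk
    omega
  · exact ⟨k1, k2⟩
  · have h1 := rowFilled_lt h hk
    have h2 := (rowFilled h).row_lt i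
    have h3 : (rowFilled h).row i = μ.colLen 0 - 1 := by omega
    have h4 : (rowFilled h).col i < μ.rowLen (μ.colLen 0 - 1) := by
      rw [← h3]
      exact YoungDiagram.mem_iff_lt_rowLen.1 ((rowFilled h).mem_cells i)
    -- If the target box holds a larger entry, `i` lies further right in the last row, in a box that
    -- the induction has already given to this smaller `j`.
    let j : Fin (n + 1) := ⟨μ.rowLen (μ.colLen 0 - 1) - 1 - (rowFilled h).col i, by omega⟩
    have hj : j < i := by simp only [Fin.lt_def, j]; omega
    obtain ⟨h5, h6⟩ := ih j hj (by simp only [j]; omega)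
    exact absurd ((rowFilled h).eq_of_row_col (h5.trans h3.symm)
      (h6.trans (by simp only [j]; omega))) hj.ne

end Fillings

/-! ### Coefficients of the Hecke action on tableaux -/

section Coefficients

variable {F : Type*} [Field F]

/-- `t` is nonzero and not a root of unity. -/
structure NotRootOfUnity (t : F) : Prop where
  ne_zero : t ≠ 0
  zpow_ne_one : ∀ b : ℤ, b ≠ 0 → t ^ b ≠ 1

theorem notRootOfUnity_of_pow {t : F} (h0 : t ≠ 0) (h : ∀ k : ℕ, 0 < k → t ^ k ≠ 1) :
    NotRootOfUnity t := by
  refine ⟨h0, fun b hb hb1 => ?_⟩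
  rcases lt_or_gt_of_ne hb with hb | hb
  · obtain ⟨k, rfl⟩ := Int.eq_negSucc_of_lt_zero hb
    rw [zpow_negSucc, inv_eq_one] at hb1
    exact h _ (Nat.succ_pos _) hb1
  · lift b to ℕ using hb.le
    rw [zpow_natCast] at hb1
    exact h _ (by exact_mod_cast hb) hb1

theorem NotRootOfUnity.zpow_inj {t : F} (ht : NotRootOfUnity t) {a b : ℤ}
    (h : t ^ a = t ^ b) : a = b := by
  by_contra hab
  refine ht.zpow_ne_one (a - b) (sub_ne_zero.2 hab) ?_
  rw [zpow_sub₀ ht.ne_zero, h, div_self (zpow_ne_zero _ ht.ne_zero)]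

/-- Diagonal coefficient of `τ(T_i)`. -/
def diagCoeff (t : F) (b : ℤ) : F := (t - 1) / (1 - t ^ (-b))

/-- Off-diagonal coefficient of `τ(T_i)`. -/
def offCoeff (t : F) (b : ℤ) : F :=
  if 2 ≤ b then 1 else if b ≤ -2 then
    t * (t ^ (b + 1) - 1) * (t ^ (b - 1) - 1) / (t ^ b - 1) ^ 2 else 0

variable {t : F} (ht : NotRootOfUnity t)
include ht

theorem diagCoeff_eq {b : ℤ} (hb : b ≠ 0) : diagCoeff t b = t ^ b * (t - 1) / (t ^ b - 1) := by
  have h0 := ht.ne_zero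
  have h1 : t ^ b - 1 ≠ 0 := sub_ne_zero.2 (ht.zpow_ne_one b hb)
  have h3 : t ^ b ≠ 0 := zpow_ne_zero b h0
  have h2 : 1 - (t ^ b)⁻¹ ≠ 0 := by
    rw [sub_ne_zero, ← zpow_neg]; exact (ht.zpow_ne_one (-b) (by omega)).symm
  rw [diagCoeff, zpow_neg, div_eq_div_iff h2 h1]
  field_simp

theorem diagCoeff_neg {b : ℤ} (hb : b ≠ 0) : diagCoeff t (-b) = t - 1 - diagCoeff t b := by
  have h1 : t ^ b - 1 ≠ 0 := sub_ne_zero.2 (ht.zpow_ne_one b hb)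
  have h2 : 1 - t ^ b ≠ 0 := sub_ne_zero.2 (ht.zpow_ne_one b hb).symm
  rw [diagCoeff_eq ht hb, diagCoeff, neg_neg, eq_sub_iff_add_eq, div_add_div _ _ h2 h1,
    div_eq_iff (mul_ne_zero h2 h1)]
  ring

/-- This rational identity, with `offCoeff_mul`, is what the braid relation for `τ(T_i)` reduces to;
`a` and `b` are consecutive content differences. -/
theorem diagCoeff_mul {a b : ℤ} (ha : a ≠ 0) (hb : b ≠ 0) (hab : a + b ≠ 0) :
    diagCoeff t a * diagCoeff t b =
      diagCoeff t (a + b) * (diagCoeff t a + diagCoeff t b - (t - 1)) := by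
  have h1 : t ^ a - 1 ≠ 0 := sub_ne_zero.2 (ht.zpow_ne_one a ha)
  have h2 : t ^ b - 1 ≠ 0 := sub_ne_zero.2 (ht.zpow_ne_one b hb)
  have h3 : t ^ a * t ^ b - 1 ≠ 0 := by
    rw [← zpow_add₀ ht.ne_zero]; exact sub_ne_zero.2 (ht.zpow_ne_one _ hab)
  rw [diagCoeff_eq ht ha, diagCoeff_eq ht hb, diagCoeff_eq ht hab, zpow_add₀ ht.ne_zero]
  field_simp
  ring

theorem diagCoeff_one : diagCoeff t 1 = t := by
  have h1 : t - 1 ≠ 0 := by simpa [sub_eq_zero] using ht.zpow_ne_one 1 one_ne_zero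
  rw [diagCoeff_eq ht one_ne_zero, zpow_one]
  field_simp

theorem diagCoeff_neg_one : diagCoeff t (-1) = -1 := by
  rw [diagCoeff_neg ht one_ne_zero, diagCoeff_one ht]; ring

/-- The off-diagonal coefficient factors through the roots `-1` and `t` of the quadratic relation,
so it vanishes at `b = ±1`. -/
theorem offFormula {b : ℤ} (hb : b ≠ 0) :
    t * (t ^ (b + 1) - 1) * (t ^ (b - 1) - 1) / (t ^ b - 1) ^ 2 =
      (diagCoeff t b + 1) * (t - diagCoeff t b) := by
  have h1 : t ^ b - 1 ≠ 0 := sub_ne_zero.2 (ht.zpow_ne_one b hb)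
  have h0 := ht.ne_zero
  rw [diagCoeff_eq ht hb, zpow_add₀ h0, zpow_sub₀ h0, zpow_one]
  field_simp
  ring

theorem offCoeff_mul {b : ℤ} (hb : b ≠ 0) :
    offCoeff t b * offCoeff t (-b) = (diagCoeff t b + 1) * (t - diagCoeff t b) := by
  rcases (by omega : b = 1 ∨ b = -1 ∨ 2 ≤ b ∨ b ≤ -2) with rfl | rfl | h | h
  · simp [offCoeff, diagCoeff_one ht]
  · simp [offCoeff, diagCoeff_neg_one ht]
  · rw [offCoeff, if_pos h, offCoeff, if_neg (by omega), if_pos (by omega),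
      offFormula ht (by omega), diagCoeff_neg ht hb]
    ring
  · rw [offCoeff, if_neg (by omega), if_pos h, offCoeff, if_pos (by omega), offFormula ht hb]
    ring

/-- Needed to cancel the off-diagonal entry of `T_i ξ_{i+1} T_i` on constants; `diagCoeff_sq_zpow`
evaluates the diagonal entry. -/
theorem diagCoeff_mul_zpow {b : ℤ} (hb : b ≠ 0) :
    diagCoeff t b + t ^ b * diagCoeff t (-b) = 0 := by
  have h1 : t ^ b - 1 ≠ 0 := sub_ne_zero.2 (ht.zpow_ne_one b hb)
  have h2 : 1 - t ^ b ≠ 0 := sub_ne_zero.2 (ht.zpow_ne_one b hb).symm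
  rw [diagCoeff_eq ht hb, diagCoeff, neg_neg]
  field_simp
  ring

theorem diagCoeff_sq_zpow {b : ℤ} (hb : b ≠ 0) :
    diagCoeff t b ^ 2 + offCoeff t b * offCoeff t (-b) * t ^ b = t * t ^ b := by
  have h := diagCoeff_mul_zpow ht hb
  rw [diagCoeff_neg ht hb] at h
  rw [offCoeff_mul ht hb]
  linear_combination diagCoeff t b * h

end Coefficients

/-! ### Hecke relations for the matrices `τ(T_i)` -/

section TauMatrices

variable {n : ℕ} {μ : YoungDiagram} {F : Type*} [Field F]

/-- `c(i, S) - c(i + 1, S)`. -/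
def RSYT.diff (S : RSYT n μ) (i : Fin n) : ℤ := S.content i.castSucc - S.content i.succ

theorem diff_ne_zero (S : RSYT n μ) (i : Fin n) : S.diff i ≠ 0 := S.content_diff_ne_zero i

theorem offCoeff_eq_zero (t : F) {S : RSYT n μ} {i : Fin n} (h : ¬ 2 ≤ |S.diff i|) :
    offCoeff t (S.diff i) = 0 := by
  have := abs_lt.1 (not_le.1 h)
  rw [offCoeff, if_neg (by omega), if_neg (by omega)]

/-- At `b = 1` and `b = -1` the coefficient `offCoeff` is zero and `diagCoeff` is `t` and `-1`, so
one two-term formula covers all four cases. -/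
theorem tauT_row {t : F} (ht : NotRootOfUnity t) (i : Fin n) (S : RSYT n μ) :
    (tauT t i S : RSYT n μ → F) = diagCoeff t (S.diff i) • Pi.single S 1 +
      offCoeff t (S.diff i) • Pi.single (exch i S) 1 := by
  ext S'
  have hd : S.content i.castSucc - S.content i.succ = S.diff i := rfl
  have h := S.content_diff_cases i
  simp only [tauT, isExchange_iff, Pi.add_apply, Pi.smul_apply, Pi.single_apply, smul_eq_mul, hd]
    at h ⊢
  rcases h with ⟨h1, h2, h3⟩ | ⟨h1, h2, h3⟩ | ⟨h1, h2, h3⟩ | ⟨h1, h2, h3⟩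
  · rw [if_pos h1, h3, diagCoeff_one ht]
    simp [offCoeff]
  · rw [if_neg h1, if_pos h2, h3, diagCoeff_neg_one ht]
    simp [offCoeff, neg_ite]
  · have ho : offCoeff t (S.diff i) = 1 := if_pos h3
    have : 2 ≤ |S.diff i| := le_abs.2 (Or.inl h3)
    rw [if_neg h1.ne, if_neg h2.ne', if_pos h1, ho, diagCoeff]
    simp only [this, true_and]
    ring
  · have ho : offCoeff t (S.diff i) = t * (t ^ (S.diff i + 1) - 1) * (t ^ (S.diff i - 1) - 1) /
        (t ^ S.diff i - 1) ^ 2 := by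
      rw [offCoeff, if_neg (by omega), if_pos h3]
    have : 2 ≤ |S.diff i| := le_abs.2 (Or.inr (by omega))
    rw [if_neg h1.ne', if_neg h2.ne, if_neg h1.not_gt, ho, diagCoeff_eq ht (diff_ne_zero S i)]
    simp only [this, true_and]
    ring

theorem single_vecMul_tauT {t : F} (ht : NotRootOfUnity t) (i : Fin n) (S : RSYT n μ) :
    Matrix.vecMul (Pi.single S 1) (tauT t i) = diagCoeff t (S.diff i) • Pi.single S 1 +
      offCoeff t (S.diff i) • Pi.single (exch i S) (1 : F) := by
  rw [Matrix.single_one_vecMul]; exact tauT_row ht i S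

theorem matrix_ext_vecMul {A B : Matrix (RSYT n μ) (RSYT n μ) F}
    (h : ∀ S, Matrix.vecMul (Pi.single S 1) A = Matrix.vecMul (Pi.single S 1) B) : A = B := by
  ext S S'
  have := congrFun (h S) S'
  simpa [Matrix.single_one_vecMul] using this

section Diff

variable {S : RSYT n μ} {i j : Fin n}

theorem diff_exch_self (h : 2 ≤ |S.diff i|) : (exch i S).diff i = - S.diff i := by
  simp [RSYT.diff, content_exch h]

theorem diff_exch_next (hij : j.castSucc = i.succ) (h : 2 ≤ |S.diff i|) :
    (exch i S).diff j = S.diff i + S.diff j := by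
  have h1 : j.succ ≠ i.castSucc := by
    simp only [ne_eq, Fin.ext_iff, Fin.val_castSucc, Fin.val_succ] at *; omega
  have h2 : j.succ ≠ i.succ := by
    simp only [ne_eq, Fin.ext_iff, Fin.val_castSucc, Fin.val_succ] at *; omega
  simp only [RSYT.diff, content_exch h, hij, Equiv.swap_apply_right,
    Equiv.swap_apply_of_ne_of_ne h1 h2]
  ring

theorem diff_exch_prev (hij : j.castSucc = i.succ) (h : 2 ≤ |S.diff j|) :
    (exch j S).diff i = S.diff i + S.diff j := by
  have h1 : i.castSucc ≠ j.castSucc := by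
    simp only [ne_eq, Fin.ext_iff, Fin.val_castSucc, Fin.val_succ] at *; omega
  have h2 : i.castSucc ≠ j.succ := by
    simp only [ne_eq, Fin.ext_iff, Fin.val_castSucc, Fin.val_succ] at *; omega
  simp only [RSYT.diff, content_exch h, ← hij, Equiv.swap_apply_left,
    Equiv.swap_apply_of_ne_of_ne h1 h2]
  ring

theorem diff_exch_far (hij : (i : ℕ) + 1 < j ∨ (j : ℕ) + 1 < i) (h : 2 ≤ |S.diff i|) :
    (exch i S).diff j = S.diff j := by
  simp only [RSYT.diff, content_exch h]
  rw [Equiv.swap_apply_of_ne_of_ne, Equiv.swap_apply_of_ne_of_ne] <;>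
    simp only [ne_eq, Fin.ext_iff, Fin.val_castSucc, Fin.val_succ] <;> omega

theorem exch_comm (hij : (i : ℕ) + 1 < j) (hi : 2 ≤ |S.diff i|) (hj : 2 ≤ |S.diff j|) :
    exch i (exch j S) = exch j (exch i S) := by
  refine RSYT.ext_content fun k => ?_
  have h1 : 2 ≤ |(exch j S).diff i| := by rwa [diff_exch_far (Or.inr hij) hj]
  have h2 : 2 ≤ |(exch i S).diff j| := by rwa [diff_exch_far (Or.inl hij) hi]
  rw [content_exch h1, content_exch hj, content_exch h2, content_exch hi]
  congr 1
  simp only [Equiv.swap_apply_def, Fin.ext_iff]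
  split_ifs <;> simp only [Fin.val_castSucc, Fin.val_succ] at * <;> omega

theorem exch_braid (hij : j.castSucc = i.succ) (hi : 2 ≤ |S.diff i|) (hj : 2 ≤ |S.diff j|)
    (hs : 2 ≤ |S.diff i + S.diff j|) :
    exch i (exch j (exch i S)) = exch j (exch i (exch j S)) := by
  have h1 : 2 ≤ |(exch i S).diff j| := by rwa [diff_exch_next hij hi]
  have h2 : 2 ≤ |(exch j S).diff i| := by rwa [diff_exch_prev hij hj]
  have h3 : 2 ≤ |(exch j (exch i S)).diff i| := by
    rw [diff_exch_prev hij h1, diff_exch_next hij hi, diff_exch_self hi]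
    simpa using hj
  have h4 : 2 ≤ |(exch i (exch j S)).diff j| := by
    rw [diff_exch_next hij h2, diff_exch_prev hij hj, diff_exch_self hj]
    simpa using hi
  refine RSYT.ext_content fun k => ?_
  rw [content_exch h3, content_exch h1, content_exch hi, content_exch h4, content_exch h2,
    content_exch hj]
  have h5 : i.castSucc ≠ i.succ := Fin.castSucc_lt_succ.ne
  have h6 : i.succ ≠ j.succ := hij ▸ Fin.castSucc_lt_succ.ne
  have h7 : i.castSucc ≠ j.succ := by
    simp only [ne_eq, Fin.ext_iff, Fin.val_castSucc, Fin.val_succ] at *; omega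
  have h8 := Equiv.swap_mul_swap_mul_swap h5 h7
  have h9 := Equiv.swap_mul_swap_mul_swap h6.symm h7.symm
  rw [Equiv.swap_comm j.succ, Equiv.swap_comm i.succ, Equiv.swap_comm i.castSucc j.succ, ← h8] at h9
  rw [hij]
  exact congrArg S.content (Equiv.congr_fun h9 k)

end Diff

variable {t : F}

theorem diff_add_ne_zero (S : RSYT n μ) {i j : Fin n} (h : j.castSucc = i.succ) :
    S.diff i + S.diff j ≠ 0 := by
  have := S.content_diff_ne_zero_of_two h
  simp only [RSYT.diff, h]
  simpa using this

theorem tauT_sq (ht : NotRootOfUnity t) (i : Fin n) :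
    (tauT t i * tauT t i : Matrix (RSYT n μ) (RSYT n μ) F) = (t - 1) • tauT t i + t • 1 := by
  refine matrix_ext_vecMul fun S => ?_
  simp only [← Matrix.vecMul_vecMul, single_vecMul_tauT ht, Matrix.add_vecMul,
    Matrix.smul_vecMul, Matrix.vecMul_add, Matrix.vecMul_smul, Matrix.vecMul_one]
  by_cases h : 2 ≤ |S.diff i|
  · rw [exch_exch h, diff_exch_self h, diagCoeff_neg ht (diff_ne_zero S i)]
    have := offCoeff_mul ht (diff_ne_zero S i)
    match_scalars
    · linear_combination this
    · ring
  · rw [offCoeff_eq_zero t h]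
    have := offCoeff_mul ht (diff_ne_zero S i)
    rw [offCoeff_eq_zero t h] at this
    match_scalars
    · linear_combination this
    · ring
    · ring

theorem tauT_comm (ht : NotRootOfUnity t) {i j : Fin n} (hij : (i : ℕ) + 1 < j) :
    (tauT t i * tauT t j : Matrix (RSYT n μ) (RSYT n μ) F) = tauT t j * tauT t i := by
  refine matrix_ext_vecMul fun S => ?_
  simp only [← Matrix.vecMul_vecMul, single_vecMul_tauT ht, Matrix.add_vecMul,
    Matrix.smul_vecMul]
  by_cases hi : 2 ≤ |S.diff i| <;> by_cases hj : 2 ≤ |S.diff j|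
  · rw [exch_comm hij hi hj, diff_exch_far (Or.inl hij) hi, diff_exch_far (Or.inr hij) hj]
    module
  · rw [diff_exch_far (Or.inl hij) hi, offCoeff_eq_zero t hj]
    module
  · rw [diff_exch_far (Or.inr hij) hj, offCoeff_eq_zero t hi]
    module
  · rw [offCoeff_eq_zero t hi, offCoeff_eq_zero t hj]
    module

/-- Both sides expand over the at most six tableaux obtained by permuting `i`, `i + 1`, `i + 2`. The
cases record which exchanges exist; a missing one has coefficient zero, and the remaining
coefficients agree by `diagCoeff_mul` and the quadratic relation. -/
theorem tauT_braid (ht : NotRootOfUnity t) {i j : Fin n} (hij : j.castSucc = i.succ) :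
    (tauT t i * tauT t j * tauT t i : Matrix (RSYT n μ) (RSYT n μ) F) =
      tauT t j * tauT t i * tauT t j := by
  refine matrix_ext_vecMul fun S => ?_
  simp only [← Matrix.vecMul_vecMul, single_vecMul_tauT ht, Matrix.add_vecMul,
    Matrix.smul_vecMul]
  have a0 := diff_ne_zero S i
  have b0 := diff_ne_zero S j
  have c0 := diff_add_ne_zero S hij
  have ha := offCoeff_mul ht a0
  have hb := offCoeff_mul ht b0
  have hc := offCoeff_mul ht c0
  have hr := diagCoeff_mul ht a0 b0 c0
  have hij' : ∀ a b : ℤ, -a + (a + b) = b := fun a b => by ring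
  have hij'' : ∀ a b : ℤ, a + b + -b = a := fun a b => by ring
  by_cases hi : 2 ≤ |S.diff i| <;> by_cases hj : 2 ≤ |S.diff j|
  · have e1 := diff_exch_next hij hi
    have e2 := diff_exch_prev hij hj
    rw [exch_exch hi, exch_exch hj]
    by_cases hs : 2 ≤ |S.diff i + S.diff j|
    · have h1 : 2 ≤ |(exch i S).diff j| := by rwa [e1]
      have h2 : 2 ≤ |(exch j S).diff i| := by rwa [e2]
      rw [exch_braid hij hi hj hs]
      simp only [diff_exch_self hi, diff_exch_self hj, e1, e2, diff_exch_next hij h2,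
        diff_exch_prev hij h1, hij', hij'', diagCoeff_neg ht a0, diagCoeff_neg ht b0]
      match_scalars <;> first
      | ring1
      | linear_combination offCoeff t (S.diff i) * hr
      | linear_combination -offCoeff t (S.diff j) * hr
      | linear_combination (diagCoeff t (S.diff i) - diagCoeff t (S.diff j)) * hr +
          diagCoeff t (S.diff i + S.diff j) * (ha - hb)
    · have h1 : offCoeff t ((exch i S).diff j) = 0 := offCoeff_eq_zero t (by rwa [e1])
      have h2 : offCoeff t ((exch j S).diff i) = 0 := offCoeff_eq_zero t (by rwa [e2])
      simp only [h1, h2, zero_smul, add_zero]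
      simp only [diff_exch_self hi, diff_exch_self hj, e1, e2, diagCoeff_neg ht a0,
        diagCoeff_neg ht b0]
      match_scalars <;> first
      | ring1
      | linear_combination offCoeff t (S.diff i) * hr
      | linear_combination -offCoeff t (S.diff j) * hr
      | linear_combination (diagCoeff t (S.diff i) - diagCoeff t (S.diff j)) * hr +
          diagCoeff t (S.diff i + S.diff j) * (ha - hb)
  · have e1 := diff_exch_next hij hi
    have oj := offCoeff_eq_zero t hj
    rw [oj, zero_mul] at hb
    rw [exch_exch hi]
    by_cases hs : 2 ≤ |S.diff i + S.diff j|
    · have h1 : 2 ≤ |(exch i S).diff j| := by rwa [e1]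
      simp only [diff_exch_prev hij h1, diff_exch_self hi, e1, hij', oj, zero_smul,
        add_zero, diagCoeff_neg ht a0]
      match_scalars <;> first
      | ring1
      | linear_combination offCoeff t (S.diff i) * hr
      | linear_combination (diagCoeff t (S.diff i) - diagCoeff t (S.diff j)) * hr +
          diagCoeff t (S.diff i + S.diff j) * (ha - hb)
    · have h1 : offCoeff t ((exch i S).diff j) = 0 := offCoeff_eq_zero t (by rwa [e1])
      simp only [h1, oj, zero_smul, add_zero]
      simp only [diff_exch_self hi, e1, diagCoeff_neg ht a0]
      match_scalars <;> first
      | ring1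
      | linear_combination offCoeff t (S.diff i) * hr
      | linear_combination (diagCoeff t (S.diff i) - diagCoeff t (S.diff j)) * hr +
          diagCoeff t (S.diff i + S.diff j) * (ha - hb)
  · have e1 := diff_exch_prev hij hj
    have oi := offCoeff_eq_zero t hi
    rw [oi, zero_mul] at ha
    rw [exch_exch hj]
    by_cases hs : 2 ≤ |S.diff i + S.diff j|
    · have h1 : 2 ≤ |(exch j S).diff i| := by rwa [e1]
      simp only [diff_exch_next hij h1, diff_exch_self hj, e1, hij'', oi, zero_smul,
        add_zero, diagCoeff_neg ht b0]
      match_scalars <;> first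
      | ring1
      | linear_combination -offCoeff t (S.diff j) * hr
      | linear_combination (diagCoeff t (S.diff i) - diagCoeff t (S.diff j)) * hr +
          diagCoeff t (S.diff i + S.diff j) * (ha - hb)
    · have h1 : offCoeff t ((exch j S).diff i) = 0 := offCoeff_eq_zero t (by rwa [e1])
      simp only [h1, oi, zero_smul, add_zero]
      simp only [diff_exch_self hj, e1, diagCoeff_neg ht b0]
      match_scalars <;> first
      | ring1
      | linear_combination -offCoeff t (S.diff j) * hr
      | linear_combination (diagCoeff t (S.diff i) - diagCoeff t (S.diff j)) * hr +
          diagCoeff t (S.diff i + S.diff j) * (ha - hb)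
  · have oi := offCoeff_eq_zero t hi
    have oj := offCoeff_eq_zero t hj
    rw [oj, zero_mul] at hb
    rw [oi, zero_mul] at ha
    simp only [oi, oj, zero_smul, add_zero]
    match_scalars <;> first
      | ring1
      | linear_combination offCoeff t (S.diff i) * hr
      | linear_combination -offCoeff t (S.diff j) * hr
      | linear_combination (diagCoeff t (S.diff i) - diagCoeff t (S.diff j)) * hr +
          diagCoeff t (S.diff i + S.diff j) * (ha - hb)

end TauMatrices

/-! ### Braid identities in a monoid -/

section BraidProducts

variable {M : Type*} [Monoid M] {g : ℕ → M} {n : ℕ}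

theorem mul_prod_range_of_comm (comm : ∀ i j, i + 1 < j → j < n → g i * g j = g j * g i) {j k : ℕ}
    (hj : j < n) (hk : k < j) :
    g j * ((List.range k).map g).prod = ((List.range k).map g).prod * g j := by
  induction k with
  | zero => simp
  | succ k ih =>
    rw [List.prod_range_succ, ← mul_assoc, ih (by omega), mul_assoc, ← comm k j hk hj, mul_assoc]

/-- Only the factors `g i` and `g (i + 1)` interact with the moving generator: the braid relation
raises its index, and commutation carries it past the others. -/
theorem prod_range_mul (comm : ∀ i j, i + 1 < j → j < n → g i * g j = g j * g i)
    (braid : ∀ i, i + 1 < n → g i * g (i + 1) * g i = g (i + 1) * g i * g (i + 1)) {i k : ℕ}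
    (hi : i + 2 ≤ k) (hk : k ≤ n) :
    ((List.range k).map g).prod * g i = g (i + 1) * ((List.range k).map g).prod := by
  induction k, hi using Nat.le_induction with
  | base =>
    rw [List.prod_range_succ, List.prod_range_succ]
    simp only [mul_assoc]
    rw [← mul_assoc (g i), braid i hk, ← mul_assoc (g (i + 1)) (List.prod _),
      mul_prod_range_of_comm comm hk (Nat.lt_succ_self i)]
    simp only [mul_assoc]
  | succ k hik ih =>
    rw [List.prod_range_succ, mul_assoc, ← comm i k hik hk, ← mul_assoc, ih (by omega), mul_assoc]

theorem prod_range_sq_mul (comm : ∀ i j, i + 1 < j → j < n + 1 → g i * g j = g j * g i)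
    (braid : ∀ i, i + 1 < n + 1 → g i * g (i + 1) * g i = g (i + 1) * g i * g (i + 1)) :
    ((List.range (n + 1)).map g).prod * ((List.range (n + 1)).map g).prod * g n =
      g 0 * ((List.range (n + 1)).map g).prod * ((List.range (n + 1)).map g).prod := by
  -- Moving the factors one at a time through the full product raises each index by one; only the
  -- last factor `g n` is left behind.
  have h1 : ∀ k ≤ n, ((List.range (n + 1)).map g).prod * ((List.range k).map g).prod =
      ((List.range k).map fun i => g (i + 1)).prod * ((List.range (n + 1)).map g).prod := by
    intro k hk
    induction k with
    | zero => simp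
    | succ k ih =>
      rw [List.prod_range_succ g k, ← mul_assoc, ih (by omega), mul_assoc,
        prod_range_mul comm braid (by omega) le_rfl, List.prod_range_succ _ k, mul_assoc]
  have h2 : ((List.range (n + 1)).map g).prod =
      g 0 * ((List.range n).map fun i => g (i + 1)).prod := List.prod_range_succ' _ _
  have h3 : ((List.range (n + 1)).map g).prod * ((List.range (n + 1)).map g).prod =
      ((List.range n).map fun i => g (i + 1)).prod * ((List.range (n + 1)).map g).prod * g n := by
    rw [← h1 n le_rfl, mul_assoc, ← List.prod_range_succ g n]
  conv_rhs => rw [mul_assoc (g 0), h3, ← mul_assoc, ← mul_assoc, ← h2]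

end BraidProducts

/-! ### Commutation of `τ(ω)` with the generators -/

section TauOmega

variable {n : ℕ} {μ : YoungDiagram} {F : Type*} [Field F] {t : F}

/-- Reindexing by natural numbers makes the monoid identities applicable; the value `1` beyond the
range never enters the product. -/
theorem prod_map_finRange {M : Type*} [Monoid M] (f : Fin n → M) :
    ((List.finRange n).map f).prod =
      ((List.range n).map fun k => if h : k < n then f ⟨k, h⟩ else 1).prod := by
  rw [← List.map_coe_finRange_eq_range, List.map_map]
  congr 1
  refine List.map_congr_left fun k _ => ?_
  simp

theorem tauOmega_mul_tauT (ht : NotRootOfUnity t) {i j : Fin n} (hij : (j : ℕ) = i + 1) :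
    (tauOmega t * tauT t i : Matrix (RSYT n μ) (RSYT n μ) F) = tauT t j * tauOmega t := by
  rw [tauOmega, prod_map_finRange]
  have := prod_range_mul (n := n) (i := i) (k := n)
    (g := fun k => if h : k < n then (tauT t ⟨k, h⟩ : Matrix (RSYT n μ) (RSYT n μ) F) else 1)
    (fun a b hab hb => by
      simp only [dif_pos hb, dif_pos (show a < n by omega)]
      exact tauT_comm ht hab)
    (fun a ha => by
      simp only [dif_pos ha, dif_pos (show a < n by omega)]
      exact tauT_braid ht (by simp)) (by omega) le_rfl
  simp only [i.2, ← hij, j.2, dif_pos] at this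
  exact this

theorem tauOmega_sq_mul_tauT {p : ℕ} {μ : YoungDiagram} (ht : NotRootOfUnity t) :
    (tauOmega t * tauOmega t * tauT t (Fin.last p) :
      Matrix (RSYT (p + 1) μ) (RSYT (p + 1) μ) F) = tauT t 0 * tauOmega t * tauOmega t := by
  rw [tauOmega, prod_map_finRange]
  have := prod_range_sq_mul (n := p)
    (g := fun k => if h : k < p + 1 then
      (tauT t ⟨k, h⟩ : Matrix (RSYT (p + 1) μ) (RSYT (p + 1) μ) F) else 1)
    (fun a b hab hb => by
      simp only [dif_pos hb, dif_pos (show a < p + 1 by omega)]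
      exact tauT_comm ht hab)
    (fun a ha => by
      simp only [dif_pos ha, dif_pos (show a < p + 1 by omega)]
      exact tauT_braid ht (by simp))
  simp only [Nat.lt_succ_self, Nat.succ_pos, dif_pos] at this
  exact this

end TauOmega

/-! ### Hecke relations on `P_τ` -/

section Operators

variable {n : ℕ} {μ : YoungDiagram} {F : Type*} [Field F]

/-- The element `1 ⊗ v` of `P ⊗ V_τ`. -/
def cst (v : RSYT n μ → F) : VPoly n μ F := fun S => C (v S)

theorem cst_add (v w : RSYT n μ → F) : cst (v + w) = cst v + cst w := by
  ext1 S; simp [cst]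

theorem cst_smul (a : F) (v : RSYT n μ → F) : cst (a • v) = a • cst v := by
  ext1 S; simp [cst, smul_eq_C_mul]

theorem cst_single (S : RSYT n μ) : cst (Pi.single S (1 : F)) = Pi.single S 1 := by
  ext1 S'; by_cases h : S' = S
  · subst h; simp [cst]
  · simp [cst, h]

/-- Constants generate `P_τ` under sums and multiplication by variables. Operator identities
therefore reduce to matrix identities on `V_τ` and to commutation with a single `x_j`. -/
theorem VPoly.induction {P : VPoly n μ F → Prop} (hc : ∀ v, P (cst v))
    (ha : ∀ f g, P f → P g → P (f + g))
    (hX : ∀ j f, P f → P ((X j : MvPolynomial (Fin (n + 1)) F) • f)) (f : VPoly n μ F) : P f := by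
  have h0 : P 0 := by
    have := hc 0
    rwa [show cst (0 : RSYT n μ → F) = 0 by ext1 S; simp [cst]] at this
  have h1 : ∀ S p, P (Pi.single S p) := by
    intro S p
    induction p using MvPolynomial.induction_on with
    | C a =>
      have := hc (Pi.single S a)
      rwa [show cst (Pi.single S a) = Pi.single S (C a) by
        ext1 S'; by_cases h : S' = S
        · subst h; simp [cst]
        · simp [cst, h]] at this
    | add p r hp hr => rw [Pi.single_add]; exact ha _ _ hp hr
    | mul_X p j hp =>
      rw [mul_comm, ← smul_eq_mul, Pi.single_smul]
      exact hX _ _ hp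
  rw [← Finset.univ_sum_single f]
  exact Finset.sum_induction _ P ha h0 fun S _ => h1 S _

theorem actV_add (A : Matrix (RSYT n μ) (RSYT n μ) F) (f g : VPoly n μ F) :
    actV A (f + g) = actV A f + actV A g := by
  ext1 S; simp [actV, Finset.sum_add_distrib]

theorem actV_smul (A : Matrix (RSYT n μ) (RSYT n μ) F) (p : MvPolynomial (Fin (n + 1)) F)
    (f : VPoly n μ F) : actV A (p • f) = p • actV A f := by
  ext1 S
  simp only [actV, Pi.smul_apply, Finset.smul_sum]
  exact Finset.sum_congr rfl fun S' _ => smul_comm _ _ _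

theorem actV_cst (A : Matrix (RSYT n μ) (RSYT n μ) F) (v : RSYT n μ → F) :
    actV A (cst v) = cst (Matrix.vecMul v A) := by
  ext1 S
  simp [actV, cst, Matrix.vecMul, dotProduct, map_sum, smul_eq_C_mul, mul_comm]

theorem C_smul_vpoly (a : F) (f : VPoly n μ F) :
    (C a : MvPolynomial (Fin (n + 1)) F) • f = a • f := by
  ext1 S; simp [smul_eq_C_mul]

/-- The quotient in `divDiff` is merely chosen; cancelling the nonzero `X i - X j` identifies it
with any explicit quotient. -/
theorem divDiff_eq {σ : Type*} [DecidableEq σ] {i j : σ} (hij : i ≠ j) {p d : MvPolynomial σ F}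
    (h : p - swapVars i j p = (X i - X j) * d) : divDiff i j p = d := by
  have h0 : (X i - X j : MvPolynomial σ F) ≠ 0 := sub_ne_zero.2 fun h => hij (X_injective h)
  exact mul_left_cancel₀ h0 ((divDiff_spec i j p).symm.trans h)

section DivDiff

variable {σ : Type*} [DecidableEq σ] {i j : σ} (hij : i ≠ j)
include hij

theorem divDiff_add (p r : MvPolynomial σ F) :
    divDiff i j (p + r) = divDiff i j p + divDiff i j r := by
  refine divDiff_eq hij ?_
  rw [mul_add, ← divDiff_spec, ← divDiff_spec]
  simp only [swapVars, map_add]; ring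

theorem divDiff_C (a : F) : divDiff i j (C a : MvPolynomial σ F) = 0 :=
  divDiff_eq hij (by simp [swapVars])

theorem divDiff_C_mul (a : F) (p : MvPolynomial σ F) :
    divDiff i j (C a * p) = C a * divDiff i j p := by
  refine divDiff_eq hij ?_
  rw [mul_left_comm, ← divDiff_spec]
  simp only [swapVars, map_mul, rename_C]; ring

theorem divDiff_X_left_mul (p : MvPolynomial σ F) :
    divDiff i j (X i * p) = p + X j * divDiff i j p := by
  refine divDiff_eq hij ?_
  have := divDiff_spec i j p
  simp only [swapVars, map_mul, rename_X, Equiv.swap_apply_left] at *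
  linear_combination X j * this

theorem divDiff_X_right_mul (p : MvPolynomial σ F) :
    divDiff i j (X j * p) = -p + X i * divDiff i j p := by
  refine divDiff_eq hij ?_
  have := divDiff_spec i j p
  simp only [swapVars, map_mul, rename_X, Equiv.swap_apply_right] at *
  linear_combination X i * this

theorem divDiff_X_mul {k : σ} (hi : k ≠ i) (hj : k ≠ j) (p : MvPolynomial σ F) :
    divDiff i j (X k * p) = X k * divDiff i j p := by
  refine divDiff_eq hij ?_
  have := divDiff_spec i j p
  simp only [swapVars, map_mul, rename_X, Equiv.swap_apply_of_ne_of_ne hi hj] at *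
  linear_combination X k * this

end DivDiff

variable (t : F) (i : Fin n)

theorem opT_add (f g : VPoly n μ F) : opT t i (f + g) = opT t i f + opT t i g := by
  have h : (fun S => swapVars i.castSucc i.succ ((f + g) S)) =
    (fun S => swapVars i.castSucc i.succ (f S)) + fun S => swapVars i.castSucc i.succ (g S) := by
    ext1 S; simp [swapVars]
  simp only [opT, h, actV_add]
  ext1 S
  simp only [Pi.add_apply, divDiff_add Fin.castSucc_lt_succ.ne]
  ring

theorem opT_smul (a : F) (f : VPoly n μ F) : opT t i (a • f) = a • opT t i f := by
  have h : (fun S => swapVars i.castSucc i.succ ((a • f) S)) =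
    (C a : MvPolynomial (Fin (n + 1)) F) • fun S => swapVars i.castSucc i.succ (f S) := by
    ext1 S; simp [swapVars, smul_eq_C_mul]
  simp only [opT, h, actV_smul]
  ext1 S
  simp only [Pi.add_apply, Pi.smul_apply, smul_eq_C_mul, divDiff_C_mul Fin.castSucc_lt_succ.ne,
    smul_eq_mul]
  ring

/-- `T_i` as a linear map. -/
def opTₗ : VPoly n μ F →ₗ[F] VPoly n μ F where
  toFun := opT t i
  map_add' := opT_add t i
  map_smul' := opT_smul t i

theorem opT_zero : opT t i (0 : VPoly n μ F) = 0 := (opTₗ t i).map_zero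

theorem opT_sub (f g : VPoly n μ F) : opT t i (f - g) = opT t i f - opT t i g :=
  (opTₗ t i).map_sub f g

theorem opT_cst (v : RSYT n μ → F) : opT t i (cst v) = cst (Matrix.vecMul v (tauT t i)) := by
  have h : (fun S => swapVars i.castSucc i.succ (cst v S)) = cst v := by
    ext1 S; simp [swapVars, cst]
  rw [opT, h, actV_cst]
  ext1 S
  simp [cst, divDiff_C Fin.castSucc_lt_succ.ne]

/-- With `opT_X_succ` and `opT_X_of_ne`, this cross relation replaces divided differences in the
inductions over `VPoly.induction`. -/
theorem opT_X_castSucc (f : VPoly n μ F) :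
    opT t i ((X i.castSucc : MvPolynomial (Fin (n + 1)) F) • f) =
      (X i.succ : MvPolynomial (Fin (n + 1)) F) • opT t i f +
        (1 - t) • (X i.succ : MvPolynomial (Fin (n + 1)) F) • f := by
  have h : (fun S => swapVars i.castSucc i.succ
      (((X i.castSucc : MvPolynomial (Fin (n + 1)) F) • f) S)) =
      (X i.succ : MvPolynomial (Fin (n + 1)) F) • fun S => swapVars i.castSucc i.succ (f S) := by
    ext1 S; simp [swapVars]
  simp only [opT, h, actV_smul]
  ext1 S
  simp only [Pi.add_apply, Pi.smul_apply, smul_eq_C_mul, smul_eq_mul,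
    divDiff_X_left_mul (Fin.castSucc_lt_succ (i := i)).ne]
  ring

theorem opT_X_succ (f : VPoly n μ F) :
    opT t i ((X i.succ : MvPolynomial (Fin (n + 1)) F) • f) =
      (X i.castSucc : MvPolynomial (Fin (n + 1)) F) • opT t i f -
        (1 - t) • (X i.succ : MvPolynomial (Fin (n + 1)) F) • f := by
  have h : (fun S => swapVars i.castSucc i.succ
      (((X i.succ : MvPolynomial (Fin (n + 1)) F) • f) S)) =
      (X i.castSucc : MvPolynomial (Fin (n + 1)) F) •
        fun S => swapVars i.castSucc i.succ (f S) := by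
    ext1 S; simp [swapVars]
  simp only [opT, h, actV_smul]
  ext1 S
  simp only [Pi.add_apply, Pi.sub_apply, Pi.smul_apply, smul_eq_C_mul, smul_eq_mul,
    divDiff_X_right_mul (Fin.castSucc_lt_succ (i := i)).ne]
  ring

variable {i} in
theorem opT_X_of_ne {k : Fin (n + 1)} (h1 : k ≠ i.castSucc) (h2 : k ≠ i.succ) (f : VPoly n μ F) :
    opT t i ((X k : MvPolynomial (Fin (n + 1)) F) • f) =
      (X k : MvPolynomial (Fin (n + 1)) F) • opT t i f := by
  have h : (fun S => swapVars i.castSucc i.succ (((X k : MvPolynomial (Fin (n + 1)) F) • f) S)) =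
      (X k : MvPolynomial (Fin (n + 1)) F) • fun S => swapVars i.castSucc i.succ (f S) := by
    ext1 S; simp [swapVars, Equiv.swap_apply_of_ne_of_ne h1 h2]
  simp only [opT, h, actV_smul]
  ext1 S
  simp only [Pi.add_apply, Pi.smul_apply, smul_eq_mul,
    divDiff_X_mul (Fin.castSucc_lt_succ (i := i)).ne h1 h2]
  ring

variable {t} (ht : NotRootOfUnity t)
include ht

theorem opT_opT (f : VPoly n μ F) : opT t i (opT t i f) = (t - 1) • opT t i f + t • f := by
  induction f using VPoly.induction with
  | hc v =>
    simp only [opT_cst, Matrix.vecMul_vecMul, tauT_sq ht, Matrix.vecMul_add, Matrix.vecMul_smul,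
      Matrix.vecMul_one, cst_add, cst_smul]
  | ha f g hf hg => simp only [opT_add, hf, hg]; module
  | hX j f hf =>
    by_cases h1 : j = i.castSucc
    · subst h1
      simp only [opT_X_castSucc, opT_X_succ, opT_add, opT_smul, hf]
      module
    by_cases h2 : j = i.succ
    · subst h2
      simp only [opT_X_castSucc, opT_X_succ, opT_sub, opT_smul, hf]
      module
    simp only [opT_X_of_ne t h1 h2, hf]
    module

variable {i}

theorem opT_comm {j : Fin n} (hij : (i : ℕ) + 1 < j ∨ (j : ℕ) + 1 < i) (f : VPoly n μ F) :
    opT t i (opT t j f) = opT t j (opT t i f) := by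
  wlog h : (i : ℕ) + 1 < j generalizing i j
  · exact (this hij.symm (hij.resolve_left h)).symm
  have n1 : i.castSucc ≠ j.castSucc := by simp [Fin.ext_iff]; omega
  have n2 : i.castSucc ≠ j.succ := by simp [Fin.ext_iff]; omega
  have n3 : i.succ ≠ j.castSucc := by simp [Fin.ext_iff]; omega
  have n4 : i.succ ≠ j.succ := by simp [Fin.ext_iff]; omega
  induction f using VPoly.induction with
  | hc v => simp only [opT_cst, Matrix.vecMul_vecMul, tauT_comm ht h]
  | ha f g hf hg => simp only [opT_add, hf, hg]
  | hX k f hf =>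
    by_cases h1 : k = i.castSucc
    · subst h1
      simp only [opT_X_castSucc, opT_X_of_ne t n1 n2, opT_X_of_ne t n3 n4, opT_add, opT_smul, hf]
    by_cases h2 : k = i.succ
    · subst h2
      simp only [opT_X_succ, opT_X_of_ne t n1 n2, opT_X_of_ne t n3 n4, opT_sub, opT_smul, hf]
    by_cases h3 : k = j.castSucc
    · subst h3
      simp only [opT_X_castSucc, opT_X_of_ne t n1.symm n3.symm, opT_X_of_ne t n2.symm n4.symm,
        opT_add, opT_smul, hf]
    by_cases h4 : k = j.succ
    · subst h4
      simp only [opT_X_succ, opT_X_of_ne t n1.symm n3.symm, opT_X_of_ne t n2.symm n4.symm,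
        opT_sub, opT_smul, hf]
    simp only [opT_X_of_ne t h1 h2, opT_X_of_ne t h3 h4, hf]

theorem opT_braid {j : Fin n} (hij : j.castSucc = i.succ) (f : VPoly n μ F) :
    opT t i (opT t j (opT t i f)) = opT t j (opT t i (opT t j f)) := by
  have n1 : i.castSucc ≠ j.castSucc := by simp [Fin.ext_iff] at *; omega
  have n2 : i.castSucc ≠ j.succ := by simp [Fin.ext_iff] at *; omega
  have n4 : i.succ ≠ j.succ := by simp [Fin.ext_iff] at *; omega
  have hj := opT_X_castSucc (μ := μ) t j
  have hj' := opT_X_succ (μ := μ) t j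
  rw [hij] at hj hj' n1
  have qi := opT_opT (μ := μ) i ht
  have qj := opT_opT (μ := μ) j ht
  induction f using VPoly.induction with
  | hc v => simp only [opT_cst, Matrix.vecMul_vecMul, tauT_braid ht hij]
  | ha f g hf hg => simp only [opT_add, hf, hg]
  | hX k f hf =>
    have m1 := opT_X_of_ne (μ := μ) t (hij ▸ n1) n2
    have m2 := opT_X_of_ne (μ := μ) t n2.symm n4.symm
    by_cases h1 : k = i.castSucc
    · subst h1
      simp only [opT_X_castSucc, hj, m1, m2, opT_add, opT_smul, hf, qi, qj]
      module
    by_cases h2 : k = i.succ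
    · subst h2
      simp only [opT_X_castSucc, opT_X_succ, hj, hj', m1, m2, opT_add, opT_sub, opT_smul, hf]
      module
    by_cases h4 : k = j.succ
    · subst h4
      simp only [opT_X_succ, hj, hj', m1, m2, opT_sub, opT_smul, hf, qi, qj]
      module
    simp only [opT_X_of_ne t h1 h2, opT_X_of_ne t (hij ▸ h2) h4, hf]

end Operators

section Operators

variable {n : ℕ} {μ : YoungDiagram} {F : Type*} [Field F]

/-! ### Inverses of the generators -/

section Inverse

variable {t : F} (ht : NotRootOfUnity t) (i : Fin n)

theorem opTinv_add (t : F) (f g : VPoly n μ F) :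
    opTinv t i (f + g) = opTinv t i f + opTinv t i g := by
  simp only [opTinv, opT_add]; module

theorem opTinv_smul (t : F) (a : F) (f : VPoly n μ F) :
    opTinv t i (a • f) = a • opTinv t i f := by
  simp only [opTinv, opT_smul]; module

include ht in
theorem opT_opTinv (f : VPoly n μ F) : opT t i (opTinv t i f) = f := by
  have h0 := ht.ne_zero
  simp only [opTinv, opT_add, opT_smul, opT_opT i ht]
  match_scalars
  all_goals field_simp
  all_goals ring

include ht in
theorem opTinv_opT (f : VPoly n μ F) : opTinv t i (opT t i f) = f := by
  have h0 := ht.ne_zero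
  simp only [opTinv, opT_opT i ht]
  match_scalars
  all_goals field_simp
  all_goals ring

/-- A linear map which intertwines `T_i` and `T_j` intertwines their inverses. -/
theorem map_opTinv {Φ : VPoly n μ F → VPoly n μ F} {j : Fin n} (t : F)
    (ha : ∀ f g, Φ (f + g) = Φ f + Φ g) (hs : ∀ (a : F) f, Φ (a • f) = a • Φ f)
    (h : ∀ f, Φ (opT t i f) = opT t j (Φ f)) (f : VPoly n μ F) :
    Φ (opTinv t i f) = opTinv t j (Φ f) := by
  simp only [opTinv, ha, hs, h]

include ht in
theorem opT_opTinv_comm {j : Fin n} (hij : (i : ℕ) + 1 < j ∨ (j : ℕ) + 1 < i) (f : VPoly n μ F) :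
    opT t i (opTinv t j f) = opTinv t j (opT t i f) :=
  map_opTinv j t (opT_add t i) (opT_smul t i) (opT_comm ht hij) f

include ht in
theorem opTinv_X_succ (f : VPoly n μ F) :
    opTinv t i ((X i.succ : MvPolynomial (Fin (n + 1)) F) • f) =
      t⁻¹ • (X i.castSucc : MvPolynomial (Fin (n + 1)) F) • opT t i f := by
  have h0 := ht.ne_zero
  simp only [opTinv, opT_X_succ]
  module

include ht in
theorem opT_X_castSucc_opT (f : VPoly n μ F) :
    opT t i ((X i.castSucc : MvPolynomial (Fin (n + 1)) F) • opT t i f) =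
      t • (X i.succ : MvPolynomial (Fin (n + 1)) F) • f := by
  simp only [opT_X_castSucc, opT_opT i ht]
  module

end Inverse

/-! ### The shift operator `w` -/

section Shift

variable (q t : F)

theorem opW_add (f g : VPoly n μ F) : opW q t (f + g) = opW q t f + opW q t g := by
  rw [opW, opW, opW, ← actV_add]
  congr 1
  ext1 S; simp [shiftVars]

theorem opW_smul (a : F) (f : VPoly n μ F) : opW q t (a • f) = a • opW q t f := by
  rw [opW, opW, ← C_smul_vpoly, ← C_smul_vpoly, ← actV_smul]
  congr 1
  ext1 S; simp [shiftVars]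

theorem opW_sub (f g : VPoly n μ F) : opW q t (f - g) = opW q t f - opW q t g := by
  have := opW_add q t f ((-1 : F) • g)
  rw [opW_smul] at this
  simpa [sub_eq_add_neg] using this

theorem opW_cst (v : RSYT n μ → F) : opW q t (cst v) = cst (Matrix.vecMul v (tauOmega t)) := by
  rw [opW, ← actV_cst]
  congr 1
  ext1 S; simp [shiftVars, cst]

theorem opW_X_zero (f : VPoly n μ F) :
    opW q t ((X 0 : MvPolynomial (Fin (n + 1)) F) • f) =
      q • (X (Fin.last n) : MvPolynomial (Fin (n + 1)) F) • opW q t f := by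
  rw [opW, opW, ← actV_smul, ← C_smul_vpoly, ← actV_smul]
  congr 1
  ext1 S; simp [shiftVars, mul_assoc]

theorem opW_X_succ (k : Fin n) (f : VPoly n μ F) :
    opW q t ((X k.succ : MvPolynomial (Fin (n + 1)) F) • f) =
      (X k.castSucc : MvPolynomial (Fin (n + 1)) F) • opW q t f := by
  rw [opW, opW, ← actV_smul]
  congr 1
  ext1 S; simp [shiftVars]

variable {t} (ht : NotRootOfUnity t)
include ht

theorem opW_opT {i j : Fin n} (hij : (j : ℕ) = i + 1) (f : VPoly n μ F) :
    opW q t (opT t j f) = opT t i (opW q t f) := by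
  have e : j.castSucc = i.succ := by simp [Fin.ext_iff, hij]
  induction f using VPoly.induction with
  | hc v =>
    simp only [opT_cst, opW_cst, Matrix.vecMul_vecMul, tauOmega_mul_tauT ht hij]
  | ha f g hf hg => simp only [opT_add, opW_add, hf, hg]
  | hX k f hf =>
    have a1 := opT_X_castSucc (μ := μ) t j
    have a2 := opT_X_succ (μ := μ) t j
    have a3 := opW_X_succ (μ := μ) q t j
    have a4 := opW_X_succ (μ := μ) q t i
    rw [e] at a1 a2 a3
    by_cases h1 : k = j.castSucc
    · subst h1
      rw [e]
      simp only [a1, a3, a4, opW_add, opW_smul, opT_X_castSucc, hf]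
    by_cases h2 : k = j.succ
    · subst h2
      simp only [a2, a3, a4, opW_sub, opW_smul, opT_X_succ, hf]
    rw [opT_X_of_ne t h1 h2]
    induction k using Fin.cases with
    | zero =>
      have h3 : Fin.last n ≠ i.castSucc := Fin.castSucc_lt_last i |>.ne'
      have h4 : Fin.last n ≠ i.succ := by
        rw [ne_eq, Fin.ext_iff]; simp; omega
      simp only [opW_X_zero, opT_smul, opT_X_of_ne t h3 h4, hf]
    | succ k =>
      have h3 : k.castSucc ≠ i.castSucc := by
        intro h; apply h1; rw [e]; simpa using h
      have h4 : k.castSucc ≠ i.succ := by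
        rw [← e]; intro h; apply h2; simpa using h
      simp only [opW_X_succ, opT_X_of_ne t h3 h4, hf]

/-- One shift lowers the index of a generator, which leaves out `T_1`; two shifts carry it round to
`T_{N-1}`, matching the relation for `τ(ω)²`. -/
theorem opT_opW_opW {p : ℕ} {μ : YoungDiagram} (f : VPoly (p + 1) μ F) :
    opT t (Fin.last p) (opW q t (opW q t f)) = opW q t (opW q t (opT t 0 f)) := by
  have a1 := opT_X_castSucc (μ := μ) t (0 : Fin (p + 1))
  have a2 := opT_X_succ (μ := μ) t (0 : Fin (p + 1))
  have a3 := opT_X_castSucc (μ := μ) t (Fin.last p)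
  have a4 := opT_X_succ (μ := μ) t (Fin.last p)
  have w1 := opW_X_zero (n := p + 1) (μ := μ) q t
  have w2 := opW_X_succ (μ := μ) q t (0 : Fin (p + 1))
  have w3 := opW_X_succ (μ := μ) q t (Fin.last p)
  rw [Fin.succ_last] at a3 a4 w3
  rw [Fin.castSucc_zero] at a1 a2 w2
  induction f using VPoly.induction with
  | hc v =>
    simp only [opT_cst, opW_cst, Matrix.vecMul_vecMul, tauOmega_sq_mul_tauT ht]
  | ha f g hf hg => simp only [opT_add, opW_add, hf, hg]
  | hX k f hf =>
    by_cases h1 : k = 0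
    · subst h1
      simp only [a1, a3, w1, w2, w3, opW_add, opW_smul, opT_smul, hf]
      module
    by_cases h2 : k = (0 : Fin (p + 1)).succ
    · subst h2
      simp only [a2, a4, w1, w2, w3, opW_sub, opW_smul, opT_smul, hf]
      module
    rw [opT_X_of_ne t (by simpa using h1) h2]
    obtain ⟨k, rfl⟩ := Fin.exists_succ_eq.2 h1
    obtain ⟨k, rfl⟩ := Fin.exists_succ_eq.2 (show k ≠ 0 from fun h => h2 (congrArg Fin.succ h))
    have h3 : k.castSucc.castSucc ≠ (Fin.last p).castSucc := by simp [Fin.castSucc_ne_last]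
    have h4 : k.castSucc.castSucc ≠ (Fin.last p).succ := by
      rw [Fin.succ_last]; exact (Fin.castSucc_lt_last _).ne
    rw [opW_X_succ, opW_X_succ, ← Fin.succ_castSucc, opW_X_succ, opW_X_succ, opT_X_of_ne t h3 h4,
      hf]

end Shift

/-! ### Descending products of generators -/

section Chains

/-- A strictly decreasing list is determined by its members, which allows the top index to be peeled
off. -/
theorem filter_lt_succ (i : Fin n) :
    (List.finRange n).reverse.filter (fun j : Fin n => (j : ℕ) < (i : ℕ) + 1) =
      i :: (List.finRange n).reverse.filter (fun j : Fin n => (j : ℕ) < i) := by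
  have hs := (List.sortedLT_finRange n).reverse
  refine List.SortedGT.eq_of_mem_iff (hs.pairwise.filter _).sortedGT ?_ ?_
  · refine (List.pairwise_cons.2 ⟨fun a ha => ?_, hs.pairwise.filter _⟩).sortedGT
    simpa using (List.mem_filter.1 ha).2
  · intro a
    simp [Fin.ext_iff]
    omega

theorem filter_le (i : Fin n) :
    (List.finRange n).reverse.filter (fun j : Fin n => (i : ℕ) ≤ (j : ℕ)) =
      (List.finRange n).reverse.filter (fun j : Fin n => (i : ℕ) + 1 ≤ (j : ℕ)) ++ [i] := by
  have hs := (List.sortedLT_finRange n).reverse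
  refine List.SortedGT.eq_of_mem_iff (hs.pairwise.filter _).sortedGT ?_ ?_
  · refine (List.pairwise_append.2 ⟨hs.pairwise.filter _, List.pairwise_singleton _ _,
      fun a ha b hb => ?_⟩).sortedGT
    obtain rfl := List.mem_singleton.1 hb
    have := (List.mem_filter.1 ha).2
    simp only [decide_eq_true_eq] at this
    exact this
  · intro a
    simp [Fin.ext_iff]
    omega

variable (t : F)

theorem opTinvDown_zero (f : VPoly n μ F) : opTinvDown t 0 f = f := by
  simp [opTinvDown]

theorem opTinvDown_succ (i : Fin n) (f : VPoly n μ F) :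
    opTinvDown t ((i : ℕ) + 1) f = opTinvDown t i (opTinv t i f) := by
  rw [opTinvDown, filter_lt_succ, List.foldl_cons, opTinvDown]

theorem opTDown_self (f : VPoly n μ F) : opTDown t n f = f := by
  have : (List.finRange n).reverse.filter (fun j : Fin n => n ≤ (j : ℕ)) = [] := by
    simp
  rw [opTDown, this, List.foldl_nil]

theorem opTDown_castSucc (i : Fin n) (f : VPoly n μ F) :
    opTDown t i f = opT t i (opTDown t ((i : ℕ) + 1) f) := by
  rw [opTDown, filter_le, List.foldl_append, List.foldl_cons, List.foldl_nil, opTDown]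

theorem foldl_op_add (op : Fin n → VPoly n μ F → VPoly n μ F)
    (h : ∀ i f g, op i (f + g) = op i f + op i g) (l : List (Fin n)) (f g : VPoly n μ F) :
    l.foldl (fun x j => op j x) (f + g) =
      l.foldl (fun x j => op j x) f + l.foldl (fun x j => op j x) g := by
  induction l generalizing f g with
  | nil => rfl
  | cons a l ih => simp only [List.foldl_cons, h, ih]

theorem foldl_op_smul (op : Fin n → VPoly n μ F → VPoly n μ F)
    (h : ∀ i (a : F) f, op i (a • f) = a • op i f) (l : List (Fin n)) (a : F) (f : VPoly n μ F) :
    l.foldl (fun x j => op j x) (a • f) = a • l.foldl (fun x j => op j x) f := by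
  induction l generalizing f with
  | nil => rfl
  | cons b l ih => simp only [List.foldl_cons, h, ih]

theorem opTinvDown_add (k : ℕ) (f g : VPoly n μ F) :
    opTinvDown t k (f + g) = opTinvDown t k f + opTinvDown t k g :=
  foldl_op_add _ (fun i => opTinv_add i t) _ f g

theorem opTinvDown_smul (k : ℕ) (a : F) (f : VPoly n μ F) :
    opTinvDown t k (a • f) = a • opTinvDown t k f :=
  foldl_op_smul _ (fun i => opTinv_smul i t) _ a f

theorem opTDown_add (k : ℕ) (f g : VPoly n μ F) :
    opTDown t k (f + g) = opTDown t k f + opTDown t k g :=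
  foldl_op_add _ (opT_add t) _ f g

theorem opTDown_smul (k : ℕ) (a : F) (f : VPoly n μ F) :
    opTDown t k (a • f) = a • opTDown t k f :=
  foldl_op_smul _ (opT_smul t) _ a f

variable {t} (ht : NotRootOfUnity t)
include ht

theorem opTinvDown_opT_of_lt {k : ℕ} {j : Fin n} (hk : k < j) (f : VPoly n μ F) :
    opTinvDown t k (opT t j f) = opT t j (opTinvDown t k f) := by
  induction k generalizing f with
  | zero => simp only [opTinvDown_zero]
  | succ k ih =>
    have := opTinvDown_succ (μ := μ) t (⟨k, by omega⟩ : Fin n)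
    simp only at this
    rw [this, this, ← opT_opTinv_comm ht _ (Or.inr hk), ih (by omega)]

/-- The braid relation gives `T_i T_{i+1}⁻¹ T_i⁻¹ = T_{i+1}⁻¹ T_i⁻¹ T_{i+1}`, and all other factors
commute with the moving generator. Inside `ξ_N` the shift `w` then lowers the raised index again. -/
theorem opTinvDown_opT {k : ℕ} {i j : Fin n} (hij : (j : ℕ) = i + 1) (hk : (i : ℕ) + 2 ≤ k)
    (hn : k ≤ n) (f : VPoly n μ F) :
    opTinvDown t k (opT t i f) = opT t j (opTinvDown t k f) := by
  induction k, hk using Nat.le_induction generalizing f with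
  | base =>
    have h1 := opTinvDown_succ (μ := μ) t j
    have h2 := opTinvDown_succ (μ := μ) t i
    rw [hij] at h1
    have h3 : ∀ f : VPoly n μ F, opTinv t i (opTinv t j (opT t i f)) =
        opT t j (opTinv t i (opTinv t j f)) := by
      intro f
      have e : j.castSucc = i.succ := by simp [Fin.ext_iff, hij]
      have := opT_braid (μ := μ) ht e (opTinv t i (opTinv t j f))
      rw [opT_opTinv ht, opT_opTinv ht] at this
      rw [this, opTinv_opT ht, opTinv_opT ht]
    rw [h1, h2, h1, h2, h3, opTinvDown_opT_of_lt ht (by omega)]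
  | succ k hk ih =>
    have := opTinvDown_succ (μ := μ) t (⟨k, by omega⟩ : Fin n)
    simp only at this
    rw [this, this, ← opT_opTinv_comm ht _ (Or.inl (by simp; omega)), ih (by omega)]

end Chains

/-! ### Cherednik operators and the generators -/

section Cherednik

variable (q : F) (t : F)

theorem opXi_last (f : VPoly n μ F) :
    opXi q t (Fin.last n) f = opW q t (opTinvDown t n f) := by
  simp [opXi, opTDown_self]

theorem opXi_add (i : Fin (n + 1)) (f g : VPoly n μ F) :
    opXi q t i (f + g) = opXi q t i f + opXi q t i g := by
  simp only [opXi, opTinvDown_add, opW_add, opTDown_add, smul_add]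

theorem opXi_smul (i : Fin (n + 1)) (a : F) (f : VPoly n μ F) :
    opXi q t i (a • f) = a • opXi q t i f := by
  simp only [opXi, opTinvDown_smul, opW_smul, opTDown_smul]
  rw [smul_comm]

/-- `ξ_i` as a linear map. -/
def opXiₗ (i : Fin (n + 1)) : VPoly n μ F →ₗ[F] VPoly n μ F where
  toFun := opXi q t i
  map_add' := opXi_add q t i
  map_smul' := opXi_smul q t i

variable {t} (ht : NotRootOfUnity t)
include ht

theorem opXi_castSucc (i : Fin n) (f : VPoly n μ F) :
    opXi q t i.castSucc f = t⁻¹ • opT t i (opXi q t i.succ (opT t i f)) := by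
  simp only [opXi, Fin.val_castSucc, Fin.val_succ, opTinvDown_succ, opTinv_opT ht,
    opTDown_castSucc t i, opT_smul, smul_smul]
  congr 1
  rw [← zpow_neg_one, ← zpow_add₀ ht.ne_zero]
  congr 1
  push_cast; ring

theorem opXi_last_opT {j : Fin n} (hj : (j : ℕ) + 1 < n) (f : VPoly n μ F) :
    opXi q t (Fin.last n) (opT t j f) = opT t j (opXi q t (Fin.last n) f) := by
  rw [opXi_last, opXi_last, opTinvDown_opT ht (j := ⟨j + 1, hj⟩) rfl (by omega) le_rfl,
    opW_opT q ht rfl]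

/-- Downward induction from `ξ_N`. The recursion meets a neighbouring generator only for `j = i +
1`; there two recursion steps and two braid moves turn `T_{i+1}` into `T_i`, which commutes with
`ξ_{i+2}`. -/
theorem opXi_opT (i : Fin (n + 1)) (j : Fin n) (h1 : (i : ℕ) ≠ j) (h2 : (i : ℕ) ≠ j + 1)
    (f : VPoly n μ F) : opXi q t i (opT t j f) = opT t j (opXi q t i f) := by
  induction i using WellFoundedGT.induction generalizing j f with
  | ind i ih =>
  obtain ⟨i, rfl⟩ | rfl := i.eq_castSucc_or_eq_last
  · rw [Fin.val_castSucc] at h1 h2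
    rw [opXi_castSucc q ht, opXi_castSucc q ht, opT_smul]
    refine congrArg (t⁻¹ • ·) ?_
    have hlt : i.castSucc < i.succ := Fin.castSucc_lt_succ
    by_cases h : (j : ℕ) = i + 1
    · have e : j.castSucc = i.succ := by rw [Fin.ext_iff]; simpa using h
      have hx : ∀ g : VPoly n μ F,
          opXi q t j.succ (opT t i g) = opT t i (opXi q t j.succ g) := by
        refine ih _ (hlt.trans ?_) i ?_ ?_
        · rw [← e]; exact Fin.castSucc_lt_succ
        · rw [Fin.val_succ]; omega
        · rw [Fin.val_succ]; omega
      rw [← e, opXi_castSucc q ht, opXi_castSucc q ht, opT_smul, opT_smul, opT_smul]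
      refine congrArg (t⁻¹ • ·) ?_
      rw [← opT_braid ht e f, hx, opT_braid ht e]
    · have hij : (i : ℕ) + 1 < j ∨ (j : ℕ) + 1 < i := by omega
      rw [opT_comm ht hij, ih _ hlt j, opT_comm ht hij]
      · rw [Fin.val_succ]; omega
      · rw [Fin.val_succ]; omega
  · rw [Fin.val_last] at h1 h2
    exact opXi_last_opT q ht (by omega) f

end Cherednik

end Operators

/-! ### The affine step as an intertwiner -/

section Affine

variable {n : ℕ} {μ : YoungDiagram} {F : Type*} [Field F]

/-- The affine step `f ↦ x_N (f w)`. -/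
def opPhi (q t : F) (f : VPoly n μ F) : VPoly n μ F :=
  (X (Fin.last n) : MvPolynomial (Fin (n + 1)) F) • opW q t f

variable (q : F)

theorem opPhi_smul (t a : F) (f : VPoly n μ F) : opPhi q t (a • f) = a • opPhi q t f := by
  rw [opPhi, opW_smul, smul_comm, opPhi]

theorem opPhi_add (t : F) (f g : VPoly n μ F) :
    opPhi q t (f + g) = opPhi q t f + opPhi q t g := by
  rw [opPhi, opW_add, smul_add, opPhi, opPhi]

variable {t : F} (ht : NotRootOfUnity t)
include ht

theorem opPhi_opT {i j : Fin n} (hij : (j : ℕ) = i + 1) (f : VPoly n μ F) :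
    opPhi q t (opT t j f) = opT t i (opPhi q t f) := by
  rw [opPhi, opPhi, opW_opT q ht hij, opT_X_of_ne]
  · rw [ne_eq, Fin.ext_iff, Fin.val_last, Fin.val_castSucc]; omega
  · rw [ne_eq, Fin.ext_iff, Fin.val_last, Fin.val_succ]; omega

/-- The affine step lowers generator indices, so the inverse chain reappears one index higher; the
outer `T_1` cancels the surplus factor `T_1⁻¹`. -/
theorem opTinvDown_opPhi {p : ℕ} {μ : YoungDiagram} {k : ℕ} (hk : k ≤ p)
    (f : VPoly (p + 1) μ F) :
    opTinvDown t k (opPhi q t f) = opPhi q t (opT t 0 (opTinvDown t (k + 1) f)) := by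
  induction k generalizing f with
  | zero =>
    have h := opTinvDown_succ t (0 : Fin (p + 1)) f
    rw [Fin.val_zero, zero_add, opTinvDown_zero] at h
    rw [opTinvDown_zero, zero_add, h, opT_opTinv ht]
  | succ k ih =>
    have h1 := opTinvDown_succ t (⟨k, by omega⟩ : Fin (p + 1)) (opPhi q t f)
    have h2 := opTinvDown_succ t (⟨k + 1, by omega⟩ : Fin (p + 1)) f
    have h3 := map_opTinv (⟨k + 1, by omega⟩ : Fin (p + 1)) (j := ⟨k, by omega⟩) t
      (opPhi_add (μ := μ) q t) (opPhi_smul q t) (opPhi_opT q ht rfl) f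
    rw [h1, h2, ← h3, ih (by omega)]

/-- The relation between `T_1`, `w²` and `T_{N-1}` settles `ξ_{N-1}`; the recursion for `ξ_i`
carries the result down, since the affine step turns `T_{i+1}` into `T_i`. -/
theorem opXi_castSucc_opPhi (i : Fin n) (f : VPoly n μ F) :
    opXi q t i.castSucc (opPhi q t f) = opPhi q t (opXi q t i.succ f) := by
  have h0 := ht.ne_zero
  obtain _ | p := n
  · exact i.elim0
  induction i using Fin.reverseInduction generalizing f with
  | last =>
    have h1 := opTinvDown_succ t (Fin.last p) (opT t (Fin.last p) (opPhi q t f))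
    rw [opTinv_opT ht, Fin.val_last, opTinvDown_opPhi q ht le_rfl] at h1
    have w3 := opW_X_succ (μ := μ) q t (Fin.last p)
    rw [Fin.succ_last] at w3
    rw [opXi_castSucc q ht, Fin.succ_last, opXi_last, opXi_last, h1, opPhi, opPhi, w3,
      ← opT_opW_opW q ht, opT_X_castSucc_opT ht, Fin.succ_last, smul_smul, inv_mul_cancel₀ h0,
      one_smul]
  | cast i ih =>
    have e : ((i.succ : Fin (p + 1)) : ℕ) = (i.castSucc : Fin (p + 1)) + 1 := by simp
    rw [opXi_castSucc q ht, Fin.succ_castSucc, ← opPhi_opT q ht e, ih, ← opPhi_opT q ht e,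
      opXi_castSucc q ht, opPhi_smul]

theorem opXi_last_opPhi (f : VPoly n μ F) :
    opXi q t (Fin.last n) (opPhi q t f) = q • opPhi q t (opXi q t 0 f) := by
  -- Each `T_k⁻¹` turns `x_{k+1}` into `t⁻¹ x_k` followed by `T_k`. So `x_N` leaves the inverse
  -- chain as `t^{1-N} x_1`, with the chain replaced by `T_{N-1} ⋯ T_1`; then `w` makes `q x_N` of
  -- `x_1`.
  have h : ∀ k : Fin (n + 1), ∀ g : VPoly n μ F,
      opTinvDown t k ((X k : MvPolynomial (Fin (n + 1)) F) • opTDown t k g) =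
        (t⁻¹) ^ (k : ℕ) • (X 0 : MvPolynomial (Fin (n + 1)) F) • opTDown t 0 g := by
    intro k g
    induction k using Fin.induction with
    | zero => rw [Fin.val_zero, opTinvDown_zero, pow_zero, one_smul]
    | succ k ih =>
      rw [Fin.val_succ, opTinvDown_succ, opTinv_X_succ ht, ← opTDown_castSucc, opTinvDown_smul]
      rw [Fin.val_castSucc] at ih
      rw [ih, smul_smul, pow_succ']
  have h1 := h (Fin.last n) (opW q t f)
  rw [Fin.val_last, opTDown_self] at h1
  rw [opXi_last, opPhi, h1, opW_smul, opW_X_zero, opXi, opPhi, opW_smul, Fin.val_zero,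
    opTinvDown_zero]
  simp only [smul_comm _ q]
  congr 1
  rw [smul_comm]
  congr 2
  simp

end Affine

/-! ### Constants as eigenvectors -/

section Constants

variable {n : ℕ} {μ : YoungDiagram} {F : Type*} [Field F] {t : F} (ht : NotRootOfUnity t)
include ht

theorem isUnit_tauT (i : Fin n) : IsUnit (tauT t i : Matrix (RSYT n μ) (RSYT n μ) F) := by
  have h0 := ht.ne_zero
  have h := tauT_sq (n := n) (μ := μ) ht i
  refine IsUnit.of_mul_eq_one (t⁻¹ • (tauT t i + (1 - t) • 1)) ?_
  rw [Matrix.mul_smul, mul_add, h, Matrix.mul_smul, mul_one]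
  match_scalars
  · ring
  · field_simp

theorem isUnit_tauOmega : IsUnit (tauOmega t : Matrix (RSYT n μ) (RSYT n μ) F) := by
  rw [tauOmega]
  refine List.prod_isUnit fun A hA => ?_
  obtain ⟨i, _, rfl⟩ := List.mem_map.1 hA
  exact isUnit_tauT ht i

omit ht in
theorem exists_vecMul_eq {A : Matrix (RSYT n μ) (RSYT n μ) F} (hA : IsUnit A) (v : RSYT n μ → F) :
    ∃ u, Matrix.vecMul u A = v := by
  obtain ⟨B, hB⟩ := hA.exists_left_inv
  exact ⟨Matrix.vecMul v B, by rw [Matrix.vecMul_vecMul, hB, Matrix.vecMul_one]⟩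

omit ht in
theorem vecMul_ne_zero {A : Matrix (RSYT n μ) (RSYT n μ) F} (hA : IsUnit A) {v : RSYT n μ → F}
    (hv : v ≠ 0) : Matrix.vecMul v A ≠ 0 := by
  obtain ⟨B, hB⟩ := hA.exists_right_inv
  intro h
  apply hv
  rw [← Matrix.vecMul_one v, ← hB, ← Matrix.vecMul_vecMul, h, Matrix.zero_vecMul]

theorem opXi_last_cst (q : F) (v : RSYT n μ → F) :
    opXi q t (Fin.last n) (cst v) = cst v := by
  -- Writing the constant as `u τ(ω)` lets the inverse chain strip off the factors one by one; `w`
  -- restores them.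
  obtain ⟨u, rfl⟩ := exists_vecMul_eq (isUnit_tauOmega ht) v
  let g : ℕ → Matrix (RSYT n μ) (RSYT n μ) F := fun k => if h : k < n then tauT t ⟨k, h⟩ else 1
  have h : ∀ k ≤ n, opTinvDown t k (cst (Matrix.vecMul u ((List.range k).map g).prod)) = cst u := by
    intro k hk
    induction k with
    | zero => simp [opTinvDown_zero]
    | succ k ih =>
      have h1 := opTinvDown_succ (μ := μ) t (⟨k, hk⟩ : Fin n)
      have h2 : g k = tauT t ⟨k, hk⟩ := dif_pos hk
      simp only at h1
      rw [h1, List.prod_range_succ, ← Matrix.vecMul_vecMul, h2, ← opT_cst, opTinv_opT ht,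
        ih (by omega)]
  have h1 := h n le_rfl
  rw [← prod_map_finRange (fun i => (tauT t i : Matrix (RSYT n μ) (RSYT n μ) F)), ← tauOmega] at h1
  rw [opXi_last, h1, opW_cst]

/-- Downward induction from the entry `N`, whose content is zero: `T_i ξ_{i+1} T_i` is computed on
the span of `S` and `S^{(i)}`, and a missing exchange enters with coefficient zero. -/
theorem opXi_cst_single (q : F) (i : Fin (n + 1)) (S : RSYT n μ) :
    opXi q t i (cst (Pi.single S 1)) = t ^ S.content i • cst (Pi.single S 1) := by
  have h0 := ht.ne_zero
  induction i using Fin.reverseInduction generalizing S with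
  | last => rw [opXi_last_cst ht, RSYT.content_last, zpow_zero, one_smul]
  | cast i ih =>
    have hb := diff_ne_zero S i
    have e1 := diagCoeff_sq_zpow ht hb
    have e2 := diagCoeff_mul_zpow ht hb
    have e3 : t ^ S.content i.castSucc = t ^ S.diff i * t ^ S.content i.succ := by
      rw [← zpow_add₀ h0, RSYT.diff, sub_add_cancel]
    have hx : offCoeff t (S.diff i) • opXi q t i.succ (cst (Pi.single (exch i S) 1)) =
        offCoeff t (S.diff i) • t ^ S.content i.castSucc • cst (Pi.single (exch i S) 1) := by
      by_cases h : 2 ≤ |S.diff i|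
      · rw [ih, content_exch h, Equiv.swap_apply_right]
      · rw [offCoeff_eq_zero t h, zero_smul, zero_smul]
    have hy : offCoeff t (S.diff i) • opT t i (cst (Pi.single (exch i S) 1)) =
        offCoeff t (S.diff i) • (diagCoeff t (-S.diff i) • cst (Pi.single (exch i S) 1) +
          offCoeff t (-S.diff i) • cst (Pi.single S 1)) := by
      by_cases h : 2 ≤ |S.diff i|
      · rw [opT_cst, single_vecMul_tauT ht, cst_add, cst_smul, cst_smul, diff_exch_self h,
          exch_exch h]
      · rw [offCoeff_eq_zero t h, zero_smul, zero_smul]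
    have hz : opT t i (cst (Pi.single S 1)) = diagCoeff t (S.diff i) • cst (Pi.single S 1) +
        offCoeff t (S.diff i) • cst (Pi.single (exch i S) 1) := by
      rw [opT_cst, single_vecMul_tauT ht, cst_add, cst_smul, cst_smul]
    rw [opXi_castSucc q ht, hz, opXi_add, opXi_smul, opXi_smul, ih, hx, opT_add, opT_smul,
      opT_smul, smul_comm, opT_smul, opT_smul, hz, smul_comm (offCoeff t _), hy, e3]
    match_scalars
    · field_simp
      linear_combination e1
    · field_simp
      linear_combination t ^ S.content i.succ * offCoeff t (S.diff i) * e2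

end Constants

/-! ### The rank function under the moves of the graph -/

section Rank

variable {n : ℕ}

theorem val_rank (α : Fin (n + 1) → ℕ) (i : Fin (n + 1)) : (rank α i : ℕ) =
    (Finset.univ.filter fun j => α i < α j ∨ (α j = α i ∧ j < i)).card := rfl

theorem rank_lt_rank {α : Fin (n + 1) → ℕ} {i j : Fin (n + 1)}
    (h : α i < α j ∨ (α j = α i ∧ j < i)) : rank α j < rank α i := by
  rw [Fin.lt_def, val_rank, val_rank]
  refine Finset.card_lt_card ((Finset.ssubset_iff_of_subset fun k => ?_).2 ⟨j, ?_, ?_⟩)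
  · simp only [Finset.mem_filter, Finset.mem_univ, true_and, Fin.lt_def] at h ⊢
    omega
  · simpa using h
  · simp

theorem rank_injective (α : Fin (n + 1) → ℕ) : Function.Injective (rank α) := by
  intro i j hij
  by_contra hne
  have : (α i < α j ∨ (α j = α i ∧ j < i)) ∨ (α j < α i ∨ (α i = α j ∧ i < j)) := by
    simp only [Fin.ext_iff, Fin.lt_def] at *
    omega
  rcases this with h | h
  · exact (rank_lt_rank h).ne hij.symm
  · exact (rank_lt_rank h).ne hij

theorem rank_bijective (α : Fin (n + 1) → ℕ) : Function.Bijective (rank α) :=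
  Finite.injective_iff_bijective.1 (rank_injective α)

/-- Ranks count predecessors in a total order of the positions, so an order isomorphism transports
them. -/
theorem rank_eq_of_equiv {α β : Fin (n + 1) → ℕ} (e : Equiv.Perm (Fin (n + 1)))
    (h : ∀ i j, (β i < β j ∨ (β j = β i ∧ j < i)) ↔
      (α (e i) < α (e j) ∨ (α (e j) = α (e i) ∧ e j < e i))) (i : Fin (n + 1)) :
    rank β i = rank α (e i) := by
  rw [Fin.ext_iff, val_rank, val_rank]
  exact Finset.card_equiv e fun j => by simpa using h i j

theorem swap_lt_swap_iff (i : Fin n) {j k : Fin (n + 1)} (h1 : ¬ (j = i.castSucc ∧ k = i.succ))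
    (h2 : ¬ (j = i.succ ∧ k = i.castSucc)) :
    Equiv.swap i.castSucc i.succ j < Equiv.swap i.castSucc i.succ k ↔ j < k := by
  simp only [Equiv.swap_apply_def, Fin.ext_iff, Fin.lt_def] at *
  split_ifs <;> simp only [Fin.val_castSucc, Fin.val_succ] at * <;> omega

theorem rank_comp_swap {α : Fin (n + 1) → ℕ} (i : Fin n) (h : α i.castSucc ≠ α i.succ)
    (k : Fin (n + 1)) :
    rank (α ∘ Equiv.swap i.castSucc i.succ) k = rank α (Equiv.swap i.castSucc i.succ k) := by
  refine rank_eq_of_equiv _ (fun a b => ?_) k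
  simp only [Function.comp_apply]
  refine or_congr_right (and_congr_right fun hab => (swap_lt_swap_iff i ?_ ?_).symm)
  · rintro ⟨rfl, rfl⟩
    simp only [Equiv.swap_apply_left, Equiv.swap_apply_right] at hab
    exact h hab.symm
  · rintro ⟨rfl, rfl⟩
    simp only [Equiv.swap_apply_left, Equiv.swap_apply_right] at hab
    exact h hab

theorem rank_succ_of_eq {α : Fin (n + 1) → ℕ} {i : Fin n} (h : α i.castSucc = α i.succ) :
    (rank α i.succ : ℕ) = rank α i.castSucc + 1 := by
  have : (Finset.univ.filter fun j => α i.succ < α j ∨ (α j = α i.succ ∧ j < i.succ)) =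
      insert i.castSucc
        (Finset.univ.filter fun j => α i.castSucc < α j ∨ (α j = α i.castSucc ∧ j < i.castSucc)) := by
    ext j
    have hj : j = i.castSucc → α j = α i.castSucc := fun h => h ▸ rfl
    simp only [Finset.mem_filter, Finset.mem_univ, true_and, Finset.mem_insert, Fin.ext_iff,
      Fin.lt_def, Fin.val_castSucc, Fin.val_succ] at *
    omega
  rw [val_rank, val_rank, this, Finset.card_insert_of_notMem (by simp)]

/-- The composition `αΦ`. -/
def affineComp (α : Fin (n + 1) → ℕ) : Fin (n + 1) → ℕ := Fin.snoc (Fin.tail α) (α 0 + 1)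

theorem affineComp_castSucc (α : Fin (n + 1) → ℕ) (k : Fin n) :
    affineComp α k.castSucc = α k.succ := Fin.snoc_castSucc ..

theorem affineComp_last (α : Fin (n + 1) → ℕ) : affineComp α (Fin.last n) = α 0 + 1 :=
  Fin.snoc_last ..

theorem finRotate_castSucc (k : Fin n) : finRotate (n + 1) k.castSucc = k.succ := by
  rw [finRotate_apply, Fin.coeSucc_eq_succ]

/-- The first position wins all ties; once moved to the end it loses them, and the increment by one
compensates. -/
theorem rank_affineComp (α : Fin (n + 1) → ℕ) (k : Fin (n + 1)) :
    rank (affineComp α) k = rank α (finRotate (n + 1) k) := by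
  refine rank_eq_of_equiv _ (fun a b => ?_) k
  induction a using Fin.lastCases with
  | last =>
    induction b using Fin.lastCases with
    | last => simp
    | cast b =>
      have := Fin.le_last b.castSucc
      simp only [affineComp_castSucc, affineComp_last, finRotate_last, finRotate_castSucc,
        Fin.castSucc_lt_last, Fin.not_lt_zero, and_true, and_false, or_false]
      omega
  | cast a =>
    induction b using Fin.lastCases with
    | last =>
      simp only [affineComp_castSucc, affineComp_last, finRotate_last, finRotate_castSucc,
        Fin.succ_pos, and_true, not_lt.2 (Fin.le_last _), and_false, or_false]
      omega
    | cast b =>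
      simp only [affineComp_castSucc, finRotate_castSucc,
        Fin.castSucc_lt_castSucc_iff, Fin.succ_lt_succ_iff]

end Rank

/-! ### Spectral vectors and intertwining steps -/

section Spectral

variable {n : ℕ} {μ : YoungDiagram} {F : Type*} [Field F] (q t : F)

theorem spectral_comp_swap {α : Fin (n + 1) → ℕ} (S : RSYT n μ) (i : Fin n)
    (h : α i.castSucc ≠ α i.succ) :
    spectral q t (α ∘ Equiv.swap i.castSucc i.succ) S =
      spectral q t α S ∘ Equiv.swap i.castSucc i.succ := by
  ext k
  simp [spectral, rank_comp_swap i h]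

theorem content_rank_exchange {α : Fin (n + 1) → ℕ} {S S' : RSYT n μ} {i j : Fin n}
    (h : α i.castSucc = α i.succ) (hj : j.castSucc = rank α i.castSucc) (hS : IsExchange j S S')
    (k : Fin (n + 1)) :
    S'.content (rank α k) = S.content (rank α (Equiv.swap i.castSucc i.succ k)) := by
  have h2 : j.succ = rank α i.succ := by
    rw [Fin.ext_iff, rank_succ_of_eq h, ← hj, Fin.val_castSucc, Fin.val_succ]
  rw [hS.content, hj, h2, (rank_injective α).swap_apply]

theorem spectral_exchange {α : Fin (n + 1) → ℕ} {S S' : RSYT n μ} {i j : Fin n}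
    (h : α i.castSucc = α i.succ) (hj : j.castSucc = rank α i.castSucc) (hS : IsExchange j S S') :
    spectral q t α S' = spectral q t α S ∘ Equiv.swap i.castSucc i.succ := by
  ext k
  have : α (Equiv.swap i.castSucc i.succ k) = α k := by
    rw [Equiv.swap_apply_def]; split_ifs with h1 h2 <;> simp_all
  simp only [Function.comp_apply, spectral, content_rank_exchange h hj hS, this]

theorem spectral_affineComp_castSucc (α : Fin (n + 1) → ℕ) (S : RSYT n μ) (k : Fin n) :
    spectral q t (affineComp α) S k.castSucc = spectral q t α S k.succ := by
  rw [spectral, spectral, rank_affineComp, affineComp_castSucc, finRotate_castSucc]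

theorem spectral_affineComp_last (α : Fin (n + 1) → ℕ) (S : RSYT n μ) :
    spectral q t (affineComp α) S (Fin.last n) = q * spectral q t α S 0 := by
  rw [spectral, spectral, rank_affineComp, affineComp_last, finRotate_last, pow_succ]
  ring

/-- `f` is a joint eigenvector of the Cherednik operators. -/
def IsEigen (f : VPoly n μ F) (ζ : Fin (n + 1) → F) : Prop := ∀ i, opXi q t i f = ζ i • f

variable {t} (ht : NotRootOfUnity t)
include ht

variable {q} in
-- The recursion `ξ_i = t⁻¹ T_i ξ_{i+1} T_i` gives the action of both operators on `f T_i`, with an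
-- error along `f`; the added scalar is the one that cancels this error.
theorem IsEigen.step {f : VPoly n μ F} {ζ : Fin (n + 1) → F} (h : IsEigen q t f ζ) (i : Fin n)
    (h0 : ζ i.castSucc ≠ 0) (hne : ζ i.castSucc ≠ ζ i.succ) :
    IsEigen q t (opT t i f + ((t - 1) / (ζ i.succ / ζ i.castSucc - 1)) • f)
      (ζ ∘ Equiv.swap i.castSucc i.succ) := by
  have ht0 := ht.ne_zero
  set c := (t - 1) / (ζ i.succ / ζ i.castSucc - 1) with hc
  have hc' : c * (ζ i.succ - ζ i.castSucc) = (t - 1) * ζ i.castSucc := by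
    have h1 : ζ i.succ - ζ i.castSucc ≠ 0 := sub_ne_zero.2 hne.symm
    have h2 : ζ i.succ / ζ i.castSucc - 1 = (ζ i.succ - ζ i.castSucc) / ζ i.castSucc := by
      field_simp
    rw [hc, h2]
    field_simp
  have hs : opXi q t i.succ (opT t i f) = ζ i.castSucc • (opT t i f + (1 - t) • f) := by
    have h1 := opXi_castSucc q ht i f
    rw [h] at h1
    have h2 := congrArg (opTinv t i) (congrArg (t • ·) h1)
    simp only [smul_inv_smul₀ ht0, opTinv_opT ht] at h2
    rw [← h2]
    simp only [opTinv, opT_smul]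
    match_scalars <;> field_simp
  intro k
  by_cases h1 : k = i.castSucc
  · subst h1
    rw [opXi_add, opXi_smul, h, opXi_castSucc q ht, opT_opT i ht, opXi_add, opXi_smul, opXi_smul,
      h, hs, Function.comp_apply, Equiv.swap_apply_left]
    simp only [opT_add, opT_smul, opT_opT i ht]
    match_scalars
    · field_simp; ring
    · field_simp
      linear_combination -hc'
  by_cases h2 : k = i.succ
  · subst h2
    rw [opXi_add, opXi_smul, h, hs, Function.comp_apply, Equiv.swap_apply_right]
    match_scalars
    · ring
    · linear_combination hc'
  · have h3 : (k : ℕ) ≠ i := fun e => h1 (Fin.ext e)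
    have h4 : (k : ℕ) ≠ i + 1 := fun e => h2 (Fin.ext e)
    rw [opXi_add, opXi_smul, h, opXi_opT q ht k i h3 h4, h, opT_smul, Function.comp_apply,
      Equiv.swap_apply_of_ne_of_ne h1 h2, smul_add, smul_comm c]

variable {q} in
theorem IsEigen.affine {f : VPoly n μ F} {α : Fin (n + 1) → ℕ} {S : RSYT n μ}
    (h : IsEigen q t f (spectral q t α S)) :
    IsEigen q t (opPhi q t f) (spectral q t (affineComp α) S) := by
  intro k
  induction k using Fin.lastCases with
  | last =>
    rw [opXi_last_opPhi q ht, h, opPhi_smul, smul_smul, spectral_affineComp_last]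
  | cast k =>
    rw [opXi_castSucc_opPhi q ht, h, opPhi_smul, spectral_affineComp_castSucc]

end Spectral

/-! ### Dominance of 0/1 compositions -/

section PartialSums

variable {n : ℕ}

/-- The sum of the first `k` entries of `d`. -/
def psum (d : Fin (n + 1) → ℕ) (k : ℕ) : ℕ :=
  ∑ j ∈ Finset.univ.filter (fun j : Fin (n + 1) => (j : ℕ) < k), d j

theorem psum_zero (d : Fin (n + 1) → ℕ) : psum d 0 = 0 := by simp [psum]

theorem psum_last (d : Fin (n + 1) → ℕ) : psum d (n + 1) = ∑ j, d j := by
  rw [psum, Finset.filter_true_of_mem fun j _ => j.2]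

theorem psum_succ (d : Fin (n + 1) → ℕ) (k : Fin (n + 1)) :
    psum d ((k : ℕ) + 1) = psum d k + d k := by
  have : (Finset.univ.filter fun j : Fin (n + 1) => (j : ℕ) < (k : ℕ) + 1) =
      insert k (Finset.univ.filter fun j : Fin (n + 1) => (j : ℕ) < (k : ℕ)) := by
    ext j
    simp only [Finset.mem_filter, Finset.mem_univ, true_and, Finset.mem_insert, Fin.ext_iff]
    omega
  rw [psum, this, Finset.sum_insert (by simp), add_comm, psum]

theorem psum_comp_swap (d : Fin (n + 1) → ℕ) (i : Fin n) {k : ℕ} (hk : k ≠ i + 1) :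
    psum (d ∘ Equiv.swap i.castSucc i.succ) k = psum d k := by
  refine Finset.sum_equiv (Equiv.swap i.castSucc i.succ) (fun j => ?_) fun j _ => rfl
  simp only [Finset.mem_filter, Finset.mem_univ, true_and, Equiv.swap_apply_def, Fin.ext_iff]
  split_ifs <;> simp only [Fin.val_castSucc, Fin.val_succ] at * <;> omega

theorem psum_comp_swap_self (d : Fin (n + 1) → ℕ) (i : Fin n) :
    psum (d ∘ Equiv.swap i.castSucc i.succ) (i + 1) = psum d i + d i.succ := by
  have := psum_succ (d ∘ Equiv.swap i.castSucc i.succ) i.castSucc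
  rw [Fin.val_castSucc] at this
  rw [this, psum_comp_swap d i (by omega), Function.comp_apply, Equiv.swap_apply_left]

theorem psum_affineComp (d : Fin (n + 1) → ℕ) {k : ℕ} (hk : k ≤ n) :
    psum d (k + 1) = d 0 + psum (affineComp d) k := by
  induction k with
  | zero =>
    have := psum_succ d 0
    rw [Fin.val_zero, psum_zero] at this
    rw [psum_zero, this]; omega
  | succ k ih =>
    have h1 := psum_succ d (⟨k, by omega⟩ : Fin n).succ
    have h2 := psum_succ (affineComp d) (⟨k, by omega⟩ : Fin n).castSucc
    rw [affineComp_castSucc] at h2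
    simp only [Fin.val_succ, Fin.val_castSucc] at h1 h2
    rw [h1, h2, ih (by omega)]; omega

theorem psum_affineComp_last (d : Fin (n + 1) → ℕ) :
    psum (affineComp d) (n + 1) = psum d (n + 1) + 1 := by
  have h1 := psum_succ (affineComp d) (Fin.last n)
  rw [Fin.val_last, affineComp_last] at h1
  rw [h1, psum_affineComp d le_rfl]; omega

/-- `d` is a `0/1` composition dominated by `α`. -/
structure Below (d α : Fin (n + 1) → ℕ) : Prop where
  le_one : ∀ i, d i ≤ 1
  total : psum d (n + 1) = psum α (n + 1)
  dom : ∀ k ≤ n, psum d k ≤ psum α k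

theorem Below.refl {α : Fin (n + 1) → ℕ} (h : ∀ i, α i ≤ 1) : Below α α :=
  ⟨h, rfl, fun _ _ => le_rfl⟩

theorem comp_swap_le {d : Fin (n + 1) → ℕ} (i : Fin n) (h : ∀ i, d i ≤ 1) (j : Fin (n + 1)) :
    (d ∘ Equiv.swap i.castSucc i.succ) j ≤ 1 := h _

theorem psum_split (d : Fin (n + 1) → ℕ) (i : Fin n) :
    psum d (i + 1) = psum d i + d i.castSucc ∧
      psum d (i + 2) = psum d i + d i.castSucc + d i.succ := by
  have h1 := psum_succ d i.castSucc
  have h2 : psum d ((i : ℕ) + 2) = _ := psum_succ d i.succ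
  simp only [Fin.val_succ, Fin.val_castSucc] at h1 h2
  omega

/-- Only one partial sum changes under `s_i`. For `α` it grows by one, which leaves room for both
`d` and `d s_i`. -/
theorem Below.step {d α : Fin (n + 1) → ℕ} (h : Below d α) {i : Fin n}
    (h0 : α i.castSucc = 0) (h1 : α i.succ = 1) :
    Below d (α ∘ Equiv.swap i.castSucc i.succ) ∧
      Below (d ∘ Equiv.swap i.castSucc i.succ) (α ∘ Equiv.swap i.castSucc i.succ) := by
  have hi := i.2
  have a1 := psum_split α i
  have a2 := psum_split d i
  have a3 := h.dom i (by omega)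
  have a4 := h.dom (i + 1) (by omega)
  have a5 := h.le_one i.succ
  refine ⟨⟨h.le_one, ?_, fun k hk => ?_⟩, ⟨comp_swap_le i h.le_one, ?_, fun k hk => ?_⟩⟩
  · rw [psum_comp_swap _ _ (by omega), h.total]
  · have := h.dom k hk
    by_cases hk' : k = i + 1
    · subst hk'
      rw [psum_comp_swap_self]; omega
    · rwa [psum_comp_swap _ _ hk']
  · rw [psum_comp_swap _ _ (by omega), psum_comp_swap _ _ (by omega), h.total]
  · have := h.dom k hk
    by_cases hk' : k = i + 1
    · subst hk'
      rw [psum_comp_swap_self, psum_comp_swap_self]; omega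
    · rwa [psum_comp_swap _ _ hk', psum_comp_swap _ _ hk']

/-- The one changed partial sum is bounded through the preceding one if both entries of `α` are `1`,
and through the following one if both are `0`. -/
theorem Below.swap_of_eq {d α : Fin (n + 1) → ℕ} (h : Below d α) (hα : ∀ i, α i ≤ 1) {i : Fin n}
    (h0 : α i.castSucc = α i.succ) : Below (d ∘ Equiv.swap i.castSucc i.succ) α := by
  have hi := i.2
  have a1 := psum_split α i
  have a2 := psum_split d i
  have a3 := h.dom i (by omega)
  have a5 := h.le_one i.succ
  have a6 := hα i.succ
  have a4 : psum d (i + 2) ≤ psum α (i + 2) := by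
    by_cases hn : (i : ℕ) + 2 ≤ n
    · exact h.dom _ hn
    · have : (i : ℕ) + 2 = n + 1 := by omega
      rw [this, h.total]
  refine ⟨comp_swap_le i h.le_one, ?_, fun k hk => ?_⟩
  · rw [psum_comp_swap _ _ (by omega), h.total]
  · have := h.dom k hk
    by_cases hk' : k = i + 1
    · subst hk'
      rw [psum_comp_swap_self]; omega
    · rwa [psum_comp_swap _ _ hk']

theorem Below.apply_zero {d α : Fin (n + 1) → ℕ} (h : Below d α) (h0 : α 0 = 0) : d 0 = 0 := by
  have a1 := psum_succ d 0
  have a2 := psum_succ α 0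
  simp only [Fin.val_zero, psum_zero, zero_add] at a1 a2
  by_cases hn : n = 0
  · have := h.total
    subst hn
    rw [zero_add] at this
    omega
  · have := h.dom 1 (by omega)
    omega

theorem Below.affine {d α : Fin (n + 1) → ℕ} (h : Below d α) (h0 : α 0 = 0) :
    Below (affineComp d) (affineComp α) := by
  have hd := h.apply_zero h0
  refine ⟨fun i => ?_, ?_, fun k hk => ?_⟩
  · induction i using Fin.lastCases with
    | last => rw [affineComp_last, hd]
    | cast i => rw [affineComp_castSucc]; exact h.le_one _
  · rw [psum_affineComp_last, psum_affineComp_last, h.total]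
  · have h1 := psum_affineComp d hk
    have h2 := psum_affineComp α hk
    have h3 : psum d (k + 1) ≤ psum α (k + 1) := by
      by_cases hn : k + 1 ≤ n
      · exact h.dom _ hn
      · have : k + 1 = n + 1 := by omega
        rw [this, h.total]
    omega

theorem not_below_swap {d α : Fin (n + 1) → ℕ} (h : Below d α) {i : Fin n}
    (h0 : α i.castSucc = 0) (h1 : α i.succ = 1) : d ≠ α ∘ Equiv.swap i.castSucc i.succ := by
  have hi := i.2
  rintro rfl
  have a1 := psum_split α i
  have a4 := h.dom (i + 1) (by omega)
  rw [psum_comp_swap_self] at a4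
  omega

end PartialSums

/-! ### Monomials and leading coefficients -/

section Monomials

variable {n : ℕ} {μ : YoungDiagram} {F : Type*} [Field F]

/-- The element `x^d ⊗ v`. -/
def tens (d : Fin (n + 1) → ℕ) : (RSYT n μ → F) →ₗ[F] VPoly n μ F where
  toFun v S := monomial (Finsupp.equivFunOnFinite.symm d) (v S)
  map_add' v w := by ext1 S; simp
  map_smul' a v := by ext1 S; simp [smul_monomial]

theorem tens_apply (d : Fin (n + 1) → ℕ) (v : RSYT n μ → F) (S : RSYT n μ) :
    tens d v S = monomial (Finsupp.equivFunOnFinite.symm d) (v S) := rfl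

theorem tens_zero (v : RSYT n μ → F) : tens 0 v = cst v := by
  ext1 S
  have : Finsupp.equivFunOnFinite.symm (0 : Fin (n + 1) → ℕ) = 0 := by ext k; simp
  rw [tens_apply, cst, C_apply, this]

/-- The vector of coefficients of `x^d`. -/
def lead (d : Fin (n + 1) → ℕ) : VPoly n μ F →ₗ[F] (RSYT n μ → F) where
  toFun g S := coeff (Finsupp.equivFunOnFinite.symm d) (g S)
  map_add' v w := by ext1 S; simp
  map_smul' a v := by ext1 S; simp

theorem lead_tens_self (d : Fin (n + 1) → ℕ) (v : RSYT n μ → F) : lead d (tens d v) = v := by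
  ext1 S
  simp [lead, tens_apply]

theorem lead_tens_of_ne {d d' : Fin (n + 1) → ℕ} (h : d' ≠ d) (v : RSYT n μ → F) :
    lead d (tens d' v) = 0 := by
  ext1 S
  have : Finsupp.equivFunOnFinite.symm d' ≠ Finsupp.equivFunOnFinite.symm d :=
    fun e => h (Finsupp.equivFunOnFinite.symm.injective e)
  simp [lead, tens_apply, coeff_monomial, this]

theorem swapVars_monomial (d : Fin (n + 1) → ℕ) (i j : Fin (n + 1)) (a : F) :
    swapVars i j (monomial (Finsupp.equivFunOnFinite.symm d) a) =
      monomial (Finsupp.equivFunOnFinite.symm (d ∘ Equiv.swap i j)) a := by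
  have : Finsupp.equivMapDomain (Equiv.swap i j) (Finsupp.equivFunOnFinite.symm d) =
      Finsupp.equivFunOnFinite.symm (d ∘ Equiv.swap i j) := by
    ext k; simp
  rw [swapVars, rename_monomial, ← Finsupp.equivMapDomain_eq_mapDomain, this]

theorem X_mul_monomial_swap {d : Fin (n + 1) → ℕ} {i j : Fin (n + 1)} (h : d i = 1)
    (h' : d j = 0) (a : F) :
    (X i : MvPolynomial (Fin (n + 1)) F) *
        monomial (Finsupp.equivFunOnFinite.symm (d ∘ Equiv.swap i j)) a =
      X j * monomial (Finsupp.equivFunOnFinite.symm d) a := by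
  have hij : i ≠ j := by rintro rfl; omega
  have : Finsupp.single i 1 + Finsupp.equivFunOnFinite.symm (d ∘ Equiv.swap i j) =
      Finsupp.single j 1 + Finsupp.equivFunOnFinite.symm d := by
    ext k
    simp only [Finsupp.add_apply, Finsupp.equivFunOnFinite_symm_apply_apply, Function.comp_apply]
    by_cases h1 : k = i
    · subst h1
      simp [h, h', hij.symm]
    by_cases h2 : k = j
    · subst h2
      simp [h, h', hij]
    simp [Ne.symm h1, Ne.symm h2, Equiv.swap_apply_of_ne_of_ne h1 h2]
  rw [X, X, monomial_mul, monomial_mul, this]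

theorem comp_swap_of_eq {d : Fin (n + 1) → ℕ} {i j : Fin (n + 1)} (h : d i = d j) :
    d ∘ Equiv.swap i j = d := by
  ext k
  rw [Function.comp_apply, Equiv.swap_apply_def]
  split_ifs with h1 h2 <;> simp_all

theorem comp_swap_swap (d : Fin (n + 1) → ℕ) (i j : Fin (n + 1)) :
    (d ∘ Equiv.swap i j) ∘ Equiv.swap i j = d := by
  ext k; simp

variable (t : F) (i : Fin n) {d : Fin (n + 1) → ℕ} (v : RSYT n μ → F)

theorem opT_tens : opT t i (tens d v) =
    (fun S => C (1 - t) * X i.succ * divDiff i.castSucc i.succ (tens d v S)) +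
      tens (d ∘ Equiv.swap i.castSucc i.succ) (Matrix.vecMul v (tauT t i)) := by
  rw [opT]
  congr 1
  ext1 S
  simp only [tens_apply, swapVars_monomial, actV, Matrix.vecMul, dotProduct, map_sum,
    smul_monomial, smul_eq_mul, mul_comm]

theorem opT_tens_of_eq (h : d i.castSucc = d i.succ) :
    opT t i (tens d v) = tens d (Matrix.vecMul v (tauT t i)) := by
  rw [opT_tens, comp_swap_of_eq h, add_eq_right]
  ext1 S
  rw [divDiff_eq (d := 0) Fin.castSucc_lt_succ.ne, mul_zero, Pi.zero_apply]
  rw [tens_apply, swapVars_monomial, comp_swap_of_eq h, sub_self, mul_zero]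

theorem opT_tens_of_one_zero (h : d i.castSucc = 1) (h' : d i.succ = 0) :
    opT t i (tens d v) = tens (d ∘ Equiv.swap i.castSucc i.succ)
      (Matrix.vecMul v (tauT t i) + (1 - t) • v) := by
  rw [opT_tens, map_add, add_comm]
  congr 1
  ext1 S
  have h0 : (X i.castSucc - X i.succ : MvPolynomial (Fin (n + 1)) F) ≠ 0 :=
    sub_ne_zero.2 fun h => (Fin.castSucc_lt_succ (i := i)).ne (X_injective h)
  have h1 := divDiff_spec i.castSucc i.succ (tens d v S)
  rw [tens_apply, swapVars_monomial] at h1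
  have h2 := X_mul_monomial_swap h h' (v S)
  rw [map_smul, Pi.smul_apply, smul_eq_C_mul, mul_assoc, tens_apply, tens_apply]
  congr 1
  refine mul_left_cancel₀ h0 ?_
  linear_combination (-X i.succ) * h1 - h2

theorem opT_tens_of_zero_one (h : d i.castSucc = 0) (h' : d i.succ = 1) :
    opT t i (tens d v) = tens (d ∘ Equiv.swap i.castSucc i.succ) (Matrix.vecMul v (tauT t i)) -
      (1 - t) • tens d v := by
  rw [opT_tens, sub_eq_add_neg (tens _ _), add_comm]
  congr 1
  ext1 S
  have h0 : (X i.castSucc - X i.succ : MvPolynomial (Fin (n + 1)) F) ≠ 0 :=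
    sub_ne_zero.2 fun h => (Fin.castSucc_lt_succ (i := i)).ne (X_injective h)
  have h1 := divDiff_spec i.castSucc i.succ (tens d v S)
  rw [tens_apply, swapVars_monomial] at h1
  have h2 := X_mul_monomial_swap h' h (v S)
  rw [Equiv.swap_comm] at h2
  rw [Pi.neg_apply, Pi.smul_apply, smul_eq_C_mul, mul_assoc, tens_apply, ← mul_neg]
  congr 1
  refine mul_left_cancel₀ h0 ?_
  linear_combination (-X i.succ) * h1 - h2

/-- As the monomial does not involve `x_1`, the shift produces no power of `q`. -/
theorem opPhi_tens (q : F) (h : d 0 = 0) :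
    opPhi q t (tens d v) = tens (affineComp d) (Matrix.vecMul v (tauOmega t)) := by
  have key : ∀ a : F, (X (Fin.last n) : MvPolynomial (Fin (n + 1)) F) *
      shiftVars q (monomial (Finsupp.equivFunOnFinite.symm d) a) =
      monomial (Finsupp.equivFunOnFinite.symm (affineComp d)) a := by
    intro a
    rw [shiftVars, aeval_monomial, monomial_eq, Finsupp.prod_fintype _ _ (by simp),
      Finsupp.prod_fintype _ _ (by simp), Fin.prod_univ_succ, Fin.prod_univ_castSucc]
    simp only [Finsupp.equivFunOnFinite_symm_apply_apply, h, affineComp_castSucc, affineComp_last,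
      Fin.cases_zero, Fin.cases_succ, pow_zero, algebraMap_eq]
    ring
  rw [opPhi, opW, ← actV_smul]
  ext1 S
  simp only [actV, Pi.smul_apply, smul_eq_mul, tens_apply, key, smul_monomial, Matrix.vecMul,
    dotProduct, map_sum, mul_comm]

/-- The span of the `x^d ⊗ v`, where `d` is dominated by `α`. -/
def lowerSpan (n : ℕ) (μ : YoungDiagram) (F : Type*) [Field F] (α : Fin (n + 1) → ℕ) :
    Submodule F (VPoly n μ F) :=
  Submodule.span F {g | ∃ d v, Below d α ∧ g = tens d v}

variable {α : Fin (n + 1) → ℕ}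

theorem tens_mem_lowerSpan (h : Below d α) : tens d v ∈ lowerSpan n μ F α :=
  Submodule.subset_span ⟨d, v, h, rfl⟩

theorem lowerSpan_induction (p : VPoly n μ F → Prop) {g : VPoly n μ F}
    (hg : g ∈ lowerSpan n μ F α) (ht : ∀ d v, Below d α → p (tens d v)) (h0 : p 0)
    (ha : ∀ f g, p f → p g → p (f + g)) (hs : ∀ (a : F) f, p f → p (a • f)) : p g :=
  Submodule.span_induction (p := fun x _ => p x) (by rintro _ ⟨d, v, h, rfl⟩; exact ht d v h) h0 (fun _ _ _ _ => ha _ _)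
    (fun a _ _ => hs a _) hg

theorem zero_one_cases {d : Fin (n + 1) → ℕ} (h : ∀ i, d i ≤ 1) (i : Fin n) :
    d i.castSucc = d i.succ ∨ (d i.castSucc = 1 ∧ d i.succ = 0) ∨
      (d i.castSucc = 0 ∧ d i.succ = 1) := by
  have := h i.castSucc
  have := h i.succ
  omega

/-- `T_i` maps `span(x^d ⊗ v, x^{d s_i} ⊗ v)` to itself. -/
theorem opT_tens_mem (hd : ∀ i, d i ≤ 1) {A : Submodule F (VPoly n μ F)}
    (h1 : ∀ w, tens d w ∈ A) (h2 : ∀ w, tens (d ∘ Equiv.swap i.castSucc i.succ) w ∈ A) :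
    opT t i (tens d v) ∈ A := by
  rcases zero_one_cases hd i with h | ⟨h, h'⟩ | ⟨h, h'⟩
  · rw [opT_tens_of_eq t i v h]; exact h1 _
  · rw [opT_tens_of_one_zero t i v h h']; exact h2 _
  · rw [opT_tens_of_zero_one t i v h h']; exact A.sub_mem (h2 _) (A.smul_mem _ (h1 _))

variable {i} {g : VPoly n μ F} (hg : g ∈ lowerSpan n μ F α)
include hg

theorem lowerSpan_step (h0 : α i.castSucc = 0) (h1 : α i.succ = 1) :
    g ∈ lowerSpan n μ F (α ∘ Equiv.swap i.castSucc i.succ) :=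
  lowerSpan_induction (fun x => x ∈ lowerSpan n μ F (α ∘ Equiv.swap i.castSucc i.succ)) hg (fun _ v h => tens_mem_lowerSpan v (h.step h0 h1).1)
    (Submodule.zero_mem _) (fun _ _ => Submodule.add_mem _) fun a _ => Submodule.smul_mem _ a

theorem opT_mem_lowerSpan_step (h0 : α i.castSucc = 0) (h1 : α i.succ = 1) :
    opT t i g ∈ lowerSpan n μ F (α ∘ Equiv.swap i.castSucc i.succ) := by
  refine lowerSpan_induction (fun x => opT t i x ∈ lowerSpan n μ F (α ∘ Equiv.swap i.castSucc i.succ)) hg (fun d v h => ?_) ?_ (fun f g hf hg => ?_) (fun a f hf => ?_)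
  · exact opT_tens_mem t i v h.le_one (fun w => tens_mem_lowerSpan w (h.step h0 h1).1)
      fun w => tens_mem_lowerSpan w (h.step h0 h1).2
  · rw [opT_zero]; exact Submodule.zero_mem _
  · rw [opT_add]; exact Submodule.add_mem _ hf hg
  · rw [opT_smul]; exact Submodule.smul_mem _ _ hf

theorem opT_mem_lowerSpan (hα : ∀ i, α i ≤ 1) (h0 : α i.castSucc = α i.succ) :
    opT t i g ∈ lowerSpan n μ F α := by
  refine lowerSpan_induction (fun x => opT t i x ∈ lowerSpan n μ F α) hg (fun d v h => ?_) ?_ (fun f g hf hg => ?_) (fun a f hf => ?_)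
  · exact opT_tens_mem t i v h.le_one (fun w => tens_mem_lowerSpan w h)
      fun w => tens_mem_lowerSpan w (h.swap_of_eq hα h0)
  · rw [opT_zero]; exact Submodule.zero_mem _
  · rw [opT_add]; exact Submodule.add_mem _ hf hg
  · rw [opT_smul]; exact Submodule.smul_mem _ _ hf

theorem opPhi_mem_lowerSpan (q : F) (h0 : α 0 = 0) :
    opPhi q t g ∈ lowerSpan n μ F (affineComp α) := by
  refine lowerSpan_induction (fun x => opPhi q t x ∈ lowerSpan n μ F (affineComp α)) hg (fun d v h => ?_) ?_ (fun f g hf hg => ?_) (fun a f hf => ?_)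
  · rw [opPhi_tens t v q (h.apply_zero h0)]
    exact tens_mem_lowerSpan _ (h.affine h0)
  · have := opPhi_smul q t (0 : F) (0 : VPoly n μ F)
    rw [zero_smul, zero_smul] at this
    rw [this]; exact Submodule.zero_mem _
  · rw [opPhi_add]; exact Submodule.add_mem _ hf hg
  · rw [opPhi_smul]; exact Submodule.smul_mem _ _ hf

theorem lead_step_eq_zero (h0 : α i.castSucc = 0) (h1 : α i.succ = 1) :
    lead (α ∘ Equiv.swap i.castSucc i.succ) g = 0 := by
  refine lowerSpan_induction (fun x => lead (α ∘ Equiv.swap i.castSucc i.succ) x = 0) hg (fun d v h => ?_) (map_zero _) (fun f g hf hg => ?_)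
    (fun a f hf => ?_)
  · exact lead_tens_of_ne (not_below_swap h h0 h1) v
  · rw [map_add, hf, hg, add_zero]
  · rw [map_smul, hf, smul_zero]

/-- Among the dominated exponents only `α` contributes to `x^{α s_i}` under `T_i`, so the leading
coefficient is transformed by `τ(T_i)`, which is invertible. -/
theorem lead_opT_step (h0 : α i.castSucc = 0) (h1 : α i.succ = 1) :
    lead (α ∘ Equiv.swap i.castSucc i.succ) (opT t i g) =
      Matrix.vecMul (lead α g) (tauT t i) := by
  refine lowerSpan_induction (fun x => lead (α ∘ Equiv.swap i.castSucc i.succ) (opT t i x) =  Matrix.vecMul (lead α x) (tauT t i)) hg (fun d v h => ?_) ?_ (fun f g hf hg => ?_) (fun a f hf => ?_)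
  · have hne := not_below_swap h h0 h1
    have hiff : d ≠ α → d ∘ Equiv.swap i.castSucc i.succ ≠ α ∘ Equiv.swap i.castSucc i.succ :=
      fun hd e => hd (by rw [← comp_swap_swap d i.castSucc i.succ, e, comp_swap_swap])
    rcases zero_one_cases h.le_one i with h2 | ⟨h2, h3⟩ | ⟨h2, h3⟩
    · have hd : d ≠ α := by rintro rfl; omega
      rw [opT_tens_of_eq t i v h2, lead_tens_of_ne hne, lead_tens_of_ne hd, Matrix.zero_vecMul]
    · have hd : d ≠ α := by rintro rfl; omega
      rw [opT_tens_of_one_zero t i v h2 h3, lead_tens_of_ne (hiff hd), lead_tens_of_ne hd,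
        Matrix.zero_vecMul]
    · rw [opT_tens_of_zero_one t i v h2 h3, map_sub, map_smul, lead_tens_of_ne hne, smul_zero,
        sub_zero]
      by_cases hd : d = α
      · rw [hd, lead_tens_self, lead_tens_self]
      · rw [lead_tens_of_ne (hiff hd), lead_tens_of_ne hd, Matrix.zero_vecMul]
  · rw [opT_zero, map_zero, map_zero, Matrix.zero_vecMul]
  · rw [opT_add, map_add, map_add, hf, hg, Matrix.add_vecMul]
  · rw [opT_smul, map_smul, map_smul, hf, Matrix.smul_vecMul]

theorem lead_opT (h0 : α i.castSucc = α i.succ) :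
    lead α (opT t i g) = Matrix.vecMul (lead α g) (tauT t i) := by
  refine lowerSpan_induction (fun x => lead α (opT t i x) = Matrix.vecMul (lead α x) (tauT t i)) hg (fun d v h => ?_) ?_ (fun f g hf hg => ?_) (fun a f hf => ?_)
  · have hiff : d ≠ α → d ∘ Equiv.swap i.castSucc i.succ ≠ α := by
      intro hd e
      apply hd
      rw [← comp_swap_swap d i.castSucc i.succ, e, comp_swap_of_eq h0]
    rcases zero_one_cases h.le_one i with h2 | ⟨h2, h3⟩ | ⟨h2, h3⟩
    · rw [opT_tens_of_eq t i v h2]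
      by_cases hd : d = α
      · rw [hd, lead_tens_self, lead_tens_self]
      · rw [lead_tens_of_ne hd, lead_tens_of_ne hd, Matrix.zero_vecMul]
    · have hd : d ≠ α := by rintro rfl; omega
      rw [opT_tens_of_one_zero t i v h2 h3, lead_tens_of_ne (hiff hd), lead_tens_of_ne hd,
        Matrix.zero_vecMul]
    · have hd : d ≠ α := by rintro rfl; omega
      rw [opT_tens_of_zero_one t i v h2 h3, map_sub, map_smul, lead_tens_of_ne hd, smul_zero,
        sub_zero, lead_tens_of_ne (hiff hd), Matrix.zero_vecMul]
  · simp only [opT_zero, map_zero, Matrix.zero_vecMul]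
  · rw [opT_add, map_add, map_add, hf, hg, Matrix.add_vecMul]
  · rw [opT_smul, map_smul, map_smul, hf, Matrix.smul_vecMul]

theorem lead_opPhi (q : F) (h0 : α 0 = 0) :
    lead (affineComp α) (opPhi q t g) = Matrix.vecMul (lead α g) (tauOmega t) := by
  refine lowerSpan_induction (fun x => lead (affineComp α) (opPhi q t x) = Matrix.vecMul (lead α x) (tauOmega t)) hg (fun d v h => ?_) ?_ (fun f g hf hg => ?_) (fun a f hf => ?_)
  · rw [opPhi_tens t v q (h.apply_zero h0)]
    by_cases hd : d = α
    · rw [hd, lead_tens_self, lead_tens_self]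
    · rw [lead_tens_of_ne hd, lead_tens_of_ne, Matrix.zero_vecMul]
      intro e
      apply hd
      ext k
      induction k using Fin.cases with
      | zero => rw [h0, h.apply_zero h0]
      | succ k => rw [← affineComp_castSucc d, e, affineComp_castSucc]
  · have := opPhi_smul q t (0 : F) (0 : VPoly n μ F)
    rw [zero_smul, zero_smul] at this
    rw [this, map_zero, map_zero, Matrix.zero_vecMul]
  · rw [opPhi_add, map_add, map_add, hf, hg, Matrix.add_vecMul]
  · rw [opPhi_smul, map_smul, map_smul, hf, Matrix.smul_vecMul]

end Monomials

/-! ### Spectral exponents at `q = t ^ h_τ` -/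

section Exponents

variable {n : ℕ} {μ : YoungDiagram}

/-- The exponents of the spectral vector at `q = t ^ h_τ`. -/
def zexp (α : Fin (n + 1) → ℕ) (S : RSYT n μ) (i : Fin (n + 1)) : ℤ :=
  maxHook μ * α i + S.content (rank α i)

theorem spectral_eq_zpow {F : Type*} [Field F] {t : F} (ht : t ≠ 0) (α : Fin (n + 1) → ℕ)
    (S : RSYT n μ) : spectral (t ^ maxHook μ) t α S = fun i => t ^ zexp α S i := by
  ext i
  rw [spectral, zexp, zpow_add₀ ht, ← pow_mul]
  norm_cast

variable {α : Fin (n + 1) → ℕ} (hα : ∀ i, α i ≤ 1)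
include hα

/-- Contents lie between `1 - l` and `τ₁ - 1`; adding `h_τ = τ₁ + l - 1` lifts all of them to at
least `τ₁`. -/
theorem rowLen_le_zexp_iff (S : RSYT n μ) (i : Fin (n + 1)) :
    (μ.rowLen 0 : ℤ) ≤ zexp α S i ↔ α i = 1 := by
  have h1 := S.maxHook_add_content (rank α i) (rank α i)
  have h2 := hα i
  rcases (by omega : α i = 0 ∨ α i = 1) with h | h
  · simp only [zexp, h, Nat.cast_zero, mul_zero, zero_add, zero_ne_one, iff_false, not_le]
    exact h1.2
  · simp only [zexp, h, Nat.cast_one, mul_one, iff_true]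
    exact h1.1

/-- The threshold `τ₁` recovers the composition, and the contents then recover the tableau. Spectral
vectors of 0/1 labels thus stay distinct at this special `q`. -/
theorem eq_of_zexp_eq {α' : Fin (n + 1) → ℕ} (hα' : ∀ i, α' i ≤ 1) {S S' : RSYT n μ}
    (h : zexp α S = zexp α' S') : α = α' ∧ S = S' := by
  have h1 : α = α' := by
    ext i
    have h1 := rowLen_le_zexp_iff hα S i
    have h2 := rowLen_le_zexp_iff hα' S' i
    have h3 := hα i
    have h4 := hα' i
    rw [h, h2] at h1
    omega
  subst h1
  refine ⟨rfl, RSYT.ext_content fun k => ?_⟩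
  obtain ⟨i, rfl⟩ := (rank_bijective α).2 k
  have := congrFun h i
  simpa [zexp] using this

/-- This keeps the denominators of the steps nonzero. Equal entries of `α` have consecutive ranks,
whose contents differ; unequal ones are separated by the threshold `τ₁`. -/
theorem zexp_castSucc_ne (S : RSYT n μ) (i : Fin n) :
    zexp α S i.castSucc ≠ zexp α S i.succ := by
  by_cases h : α i.castSucc = α i.succ
  · have h1 : rank α i.castSucc = (⟨rank α i.castSucc, by
        have := rank_succ_of_eq h
        have := (rank α i.succ).2
        omega⟩ : Fin n).castSucc := by ext; simp
    have h2 : rank α i.succ = (⟨rank α i.castSucc, by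
        have := rank_succ_of_eq h
        have := (rank α i.succ).2
        omega⟩ : Fin n).succ := by ext; simp [rank_succ_of_eq h]
    have h3 := S.content_diff_ne_zero ⟨rank α i.castSucc, by
        have := rank_succ_of_eq h
        have := (rank α i.succ).2
        omega⟩
    rw [← h1, ← h2] at h3
    rw [zexp, zexp, h]
    omega
  · intro e
    have h1 := rowLen_le_zexp_iff hα S i.castSucc
    have h2 := rowLen_le_zexp_iff hα S i.succ
    have h3 := hα i.castSucc
    have h4 := hα i.succ
    rw [e, h2] at h1
    omega

end Exponents

/-! ### Reaching all 0/1 compositions -/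

section ZeroOneInduction

variable {n : ℕ}

theorem psum_mono (d : Fin (n + 1) → ℕ) (k : ℕ) : psum d k ≤ psum d (k + 1) :=
  Finset.sum_le_sum_of_subset fun j hj => by
    simp only [Finset.mem_filter, Finset.mem_univ, true_and] at hj ⊢
    omega

theorem exists_descent {α : Fin (n + 1) → ℕ} (hα : ∀ i, α i ≤ 1) (hl : α (Fin.last n) = 0)
    (h0 : α ≠ 0) : ∃ i : Fin n, α i.castSucc = 1 ∧ α i.succ = 0 := by
  by_contra! h
  apply h0
  ext i
  induction i using Fin.reverseInduction with
  | last => exact hl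
  | cast i ih =>
    have := h i
    have := hα i.castSucc
    simp only [Pi.zero_apply] at ih ⊢
    omega

/-- All `0/1` compositions are reached from `0` by the steps `α ↦ α s_i` with `α_i < α_{i+1}` and
`α ↦ α Φ` with `α_1 = 0`. -/
theorem zero_one_induction {p : (Fin (n + 1) → ℕ) → Prop} (h0 : p 0)
    (hs : ∀ α (i : Fin n), (∀ j, α j ≤ 1) → α i.castSucc = 0 → α i.succ = 1 → p α →
      p (α ∘ Equiv.swap i.castSucc i.succ))
    (ha : ∀ α, (∀ j, α j ≤ 1) → α 0 = 0 → p α → p (affineComp α)) (α : Fin (n + 1) → ℕ)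
    (hα : ∀ j, α j ≤ 1) : p α := by
  -- The sum of the partial sums drops when a descent `1, 0` is reversed, and when a final `1` is
  -- removed and a `0` put in front.
  induction hm : ∑ k ∈ Finset.range (n + 1), psum α (k + 1) using Nat.strong_induction_on
    generalizing α with
  | _ m ih =>
    subst hm
    have hl := hα (Fin.last n)
    rcases (by omega : α (Fin.last n) = 0 ∨ α (Fin.last n) = 1) with h | h
    · by_cases hz : α = 0
      · rwa [hz]
      obtain ⟨i, h1, h2⟩ := exists_descent hα h hz
      have hlt : psum (α ∘ Equiv.swap i.castSucc i.succ) (i + 1) < psum α (i + 1) := by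
        rw [psum_comp_swap_self, (psum_split α i).1]; omega
      have := hs (α ∘ Equiv.swap i.castSucc i.succ) i (comp_swap_le i hα) (by simpa using h2)
        (by simpa using h1) (ih _ (Finset.sum_lt_sum (fun k _ => ?_)
          ⟨i, Finset.mem_range.2 (by omega), hlt⟩) _ (comp_swap_le i hα) rfl)
      · rwa [comp_swap_swap] at this
      · by_cases hk : k = i
        · exact (hk ▸ hlt).le
        · rw [psum_comp_swap _ _ (by omega)]
    · let β : Fin (n + 1) → ℕ := Fin.cons 0 (Fin.init α)
      have hβ0 : β 0 = 0 := rfl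
      have e : affineComp β = α := by
        ext k
        induction k using Fin.lastCases with
        | last => rw [affineComp_last, hβ0, h]
        | cast k => rw [affineComp_castSucc]; rfl
      have hβ : ∀ j, β j ≤ 1 := by
        intro j
        induction j using Fin.cases with
        | zero => exact Nat.zero_le _
        | succ j => exact hα _
      rw [← e]
      refine ha β hβ hβ0 (ih _ (Finset.sum_lt_sum (fun k hk => ?_)
        ⟨n, Finset.mem_range.2 (by omega), ?_⟩) β hβ rfl)
      · have h1 := psum_affineComp β (k := k) (by have := Finset.mem_range.1 hk; omega)
        rw [h1, hβ0, zero_add, e]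
        exact psum_mono α k
      · have h1 := psum_affineComp_last β
        rw [e] at h1
        omega

end ZeroOneInduction

/-! ### Eigenvectors with a leading term -/

section Leading

variable {n : ℕ} {μ : YoungDiagram} {F : Type*} [Field F]

/-- `g` is a joint eigenvector with the spectral vector of `(α, S)`, supported on the monomials
dominated by `x^α`, and with a nonzero coefficient of `x^α`. -/
structure IsLeading (q t : F) (α : Fin (n + 1) → ℕ) (S : RSYT n μ) (g : VPoly n μ F) : Prop where
  mem : g ∈ lowerSpan n μ F α
  lead_ne_zero : lead α g ≠ 0
  eigen : IsEigen q t g (spectral q t α S)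

theorem IsLeading.ne_zero {q t : F} {α : Fin (n + 1) → ℕ} {S : RSYT n μ} {g : VPoly n μ F}
    (h : IsLeading q t α S g) : g ≠ 0 := by
  rintro rfl
  exact h.lead_ne_zero (map_zero _)

variable {t : F} (ht : NotRootOfUnity t)
include ht

/-- Otherwise `-c` would be an eigenvalue of `τ(T_i)`, and the quadratic relation allows only `t`
and `-1`. -/
theorem vecMul_tauT_add_smul_ne_zero (i : Fin n) {v : RSYT n μ → F} (hv : v ≠ 0) {c : F}
    (h1 : c ≠ 1) (h2 : c ≠ -t) : Matrix.vecMul v (tauT t i) + c • v ≠ 0 := by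
  intro h
  have h3 : Matrix.vecMul v (tauT t i) = -c • v := by
    rw [neg_smul]; exact eq_neg_of_add_eq_zero_left h
  have h4 := congrArg (Matrix.vecMul v) (tauT_sq (n := n) (μ := μ) ht i)
  rw [← Matrix.vecMul_vecMul, h3, Matrix.smul_vecMul, h3, Matrix.vecMul_add, Matrix.vecMul_smul,
    Matrix.vecMul_smul, h3, Matrix.vecMul_one, smul_smul, smul_smul, ← add_smul] at h4
  have h5 := smul_left_injective F hv h4
  have h6 : (c - 1) * (c + t) = 0 := by linear_combination h5
  rcases mul_eq_zero.1 h6 with h | h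
  · exact h1 (by linear_combination h)
  · exact h2 (by linear_combination h)

/-- The forbidden values occur only at `e = 1` and `e = -1`, and the graph exchanges only entries
whose contents differ by at least two. -/
theorem stepCoeff_ne {e : ℤ} (he : e ≠ 0) (h1 : e ≠ 1) (h2 : e ≠ -1) :
    (t - 1) / (t ^ e - 1) ≠ 1 ∧ (t - 1) / (t ^ e - 1) ≠ -t := by
  have h0 : t ^ e - 1 ≠ 0 := sub_ne_zero.2 (ht.zpow_ne_one e he)
  refine ⟨fun h => h1 ?_, fun h => h2 ?_⟩
  · rw [div_eq_one_iff_eq h0] at h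
    refine (ht.zpow_inj (?_ : t ^ (1 : ℤ) = t ^ e)).symm
    rw [zpow_one]
    linear_combination h
  · rw [div_eq_iff h0] at h
    refine ht.zpow_inj ?_
    rw [zpow_neg, zpow_one]
    have := ht.ne_zero
    field_simp
    linear_combination h

variable {α : Fin (n + 1) → ℕ} {S : RSYT n μ} {g : VPoly n μ F}

theorem spectral_ne_zero (i : Fin (n + 1)) : spectral (t ^ maxHook μ) t α S i ≠ 0 := by
  rw [spectral_eq_zpow ht.ne_zero]
  exact zpow_ne_zero _ ht.ne_zero

theorem spectral_castSucc_ne (hα : ∀ i, α i ≤ 1) (i : Fin n) :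
    spectral (t ^ maxHook μ) t α S i.castSucc ≠ spectral (t ^ maxHook μ) t α S i.succ := by
  rw [spectral_eq_zpow ht.ne_zero]
  exact fun h => zexp_castSucc_ne hα S i (ht.zpow_inj h)

theorem IsLeading.step (h : IsLeading (t ^ maxHook μ) t α S g) (hα : ∀ i, α i ≤ 1) {i : Fin n}
    (h0 : α i.castSucc = 0) (h1 : α i.succ = 1) :
    IsLeading (t ^ maxHook μ) t (α ∘ Equiv.swap i.castSucc i.succ) S
      (ybStep (t ^ maxHook μ) t α S i g) where
  mem := Submodule.add_mem _ (opT_mem_lowerSpan_step t h.mem h0 h1)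
    (Submodule.smul_mem _ _ (lowerSpan_step h.mem h0 h1))
  lead_ne_zero := by
    rw [ybStep, map_add, map_smul, lead_opT_step t h.mem h0 h1, lead_step_eq_zero h.mem h0 h1,
      smul_zero, add_zero]
    exact vecMul_ne_zero (isUnit_tauT ht i) h.lead_ne_zero
  eigen := by
    rw [spectral_comp_swap _ _ _ _ (by omega)]
    exact h.eigen.step ht i (spectral_ne_zero ht _) (spectral_castSucc_ne ht hα i)

theorem IsLeading.tableau (h : IsLeading (t ^ maxHook μ) t α S g) (hα : ∀ i, α i ≤ 1)
    {i j : Fin n} {S' : RSYT n μ} (h0 : α i.castSucc = α i.succ)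
    (hj : j.castSucc = rank α i.castSucc) (h2 : 2 ≤ S.content j.castSucc - S.content j.succ)
    (hS : IsExchange j S S') :
    IsLeading (t ^ maxHook μ) t α S' (ybStep (t ^ maxHook μ) t α S i g) where
  mem := Submodule.add_mem _ (opT_mem_lowerSpan t h.mem hα h0) (Submodule.smul_mem _ _ h.mem)
  lead_ne_zero := by
    have hj' : j.succ = rank α i.succ := by
      rw [Fin.ext_iff, rank_succ_of_eq h0, ← hj, Fin.val_castSucc, Fin.val_succ]
    have e : spectral (t ^ maxHook μ) t α S i.succ / spectral (t ^ maxHook μ) t α S i.castSucc =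
        t ^ (S.content j.succ - S.content j.castSucc) := by
      rw [spectral_eq_zpow ht.ne_zero, ← zpow_sub₀ ht.ne_zero, hj, hj', zexp, zexp, h0]
      congr 1
      ring
    rw [ybStep, map_add, map_smul, lead_opT t h.mem h0, e]
    have := stepCoeff_ne ht (e := S.content j.succ - S.content j.castSucc) (by omega) (by omega)
      (by omega)
    exact vecMul_tauT_add_smul_ne_zero ht i h.lead_ne_zero this.1 this.2
  eigen := by
    rw [spectral_exchange _ _ h0 hj hS]
    exact h.eigen.step ht i (spectral_ne_zero ht _) (spectral_castSucc_ne ht hα i)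

theorem IsLeading.affine {q : F} (h : IsLeading q t α S g) (h0 : α 0 = 0) :
    IsLeading q t (affineComp α) S (opPhi q t g) where
  mem := opPhi_mem_lowerSpan t h.mem q h0
  lead_ne_zero := by
    rw [lead_opPhi t h.mem q h0]
    exact vecMul_ne_zero (isUnit_tauOmega ht) h.lead_ne_zero
  eigen := h.eigen.affine ht

theorem isLeading_cst_single (q : F) (S : RSYT n μ) :
    IsLeading q t 0 S (cst (Pi.single S 1)) where
  mem := by
    rw [← tens_zero]
    exact tens_mem_lowerSpan _ (Below.refl fun _ => Nat.zero_le _)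
  lead_ne_zero := by
    rw [← tens_zero, lead_tens_self]
    exact fun h => by simpa using congrFun h S
  eigen := by
    intro i
    rw [opXi_cst_single ht]
    congr 1
    have : rank (0 : Fin (n + 1) → ℕ) i = i := by
      rw [Fin.ext_iff, val_rank]
      simp [← Finset.mem_Iio]
    rw [spectral, this, Pi.zero_apply, pow_zero, one_mul]

theorem exists_isLeading (hα : ∀ i, α i ≤ 1) (S : RSYT n μ) :
    ∃ g, IsLeading (t ^ maxHook μ) t α S g := by
  refine zero_one_induction (p := fun α => ∃ g, IsLeading (t ^ maxHook μ) t α S g)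
    ⟨_, isLeading_cst_single ht _ S⟩ (fun α i h h0 h1 ⟨g, hg⟩ => ⟨_, hg.step ht h h0 h1⟩)
    (fun α _ h0 ⟨g, hg⟩ => ⟨_, hg.affine ht h0⟩) α hα

end Leading

/-! ### Separation of joint eigenvectors -/

section Eigenvectors

variable {n : ℕ} {μ : YoungDiagram} {F : Type*} [Field F] {q t : F}

/-- A polynomial in the Cherednik operators that separates a spectral vector from finitely many
others. -/
theorem exists_separating (q t : F) (ζ : Fin (n + 1) → F) (s : Finset (Fin (n + 1) → F))
    (hs : ζ ∉ s) : ∃ (P : VPoly n μ F →ₗ[F] VPoly n μ F) (χ : (Fin (n + 1) → F) → F),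
      (∀ g η, IsEigen q t g η → P g = χ η • g) ∧ χ ζ ≠ 0 ∧ ∀ η ∈ s, χ η = 0 := by
  classical
  induction s using Finset.induction_on with
  | empty => exact ⟨LinearMap.id, fun _ => 1, by simp, one_ne_zero, by simp⟩
  | insert η₀ s _ ih =>
    rw [Finset.mem_insert, not_or] at hs
    obtain ⟨P, χ, h1, h2, h3⟩ := ih hs.2
    obtain ⟨i, hi⟩ := Function.ne_iff.1 hs.1
    -- One factor `ξ_i - η₀ i` is added for each excluded vector, at a coordinate where it differs
    -- from `ζ`.
    refine ⟨(opXiₗ q t i - η₀ i • LinearMap.id).comp P, fun η => (η i - η₀ i) * χ η,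
      fun g η hg => ?_, mul_ne_zero (sub_ne_zero.2 hi) h2, fun η hη => ?_⟩
    · have : opXiₗ q t i g = η i • g := hg i
      simp only [LinearMap.comp_apply, LinearMap.sub_apply, LinearMap.smul_apply, LinearMap.id_apply,
        h1 g η hg, map_smul, this]
      module
    · rcases Finset.mem_insert.1 hη with rfl | hη
      · simp
      · simp [h3 η hη]

theorem linearIndependent_of_isEigen {J : Type*} [Fintype J] {M : J → VPoly n μ F}
    {ζ : J → Fin (n + 1) → F} (hM : ∀ p, IsEigen q t (M p) (ζ p)) (h0 : ∀ p, M p ≠ 0)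
    (hζ : Function.Injective ζ) : LinearIndependent F M := by
  classical
  rw [Fintype.linearIndependent_iff]
  intro c hc p
  obtain ⟨P, χ, h1, h2, h3⟩ := exists_separating (μ := μ) q t (ζ p)
    ((Finset.univ.erase p).image ζ) (by simp [hζ.eq_iff])
  have h4 := congrArg P hc
  rw [map_sum, map_zero, Finset.sum_eq_single p] at h4
  · rw [map_smul, h1 _ _ (hM p), smul_smul] at h4
    exact (mul_eq_zero.1 ((smul_eq_zero.1 h4).resolve_right (h0 p))).resolve_right h2
  · intro p' _ hp
    rw [map_smul, h1 _ _ (hM p'), h3 _ (Finset.mem_image_of_mem ζ (by simp [hp])), zero_smul,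
      smul_zero]
  · simp

/-- A separating operator kills all terms of the expansion of `g` but one; it would kill `g` itself
if `η` were none of the `ζ p`. -/
theorem eq_smul_of_isEigen {J : Type*} [Fintype J] {M : J → VPoly n μ F}
    {ζ : J → Fin (n + 1) → F} (hM : ∀ p, IsEigen q t (M p) (ζ p)) (hζ : Function.Injective ζ)
    {g : VPoly n μ F} (hg : g ∈ Submodule.span F (Set.range M)) (hg0 : g ≠ 0)
    {η : Fin (n + 1) → F} (h : IsEigen q t g η) : ∃ p, η = ζ p ∧ ∃ y : F, g = y • M p := by
  classical
  obtain ⟨c, rfl⟩ := (Submodule.mem_span_range_iff_exists_fun F).1 hg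
  have key : ∃ p, η = ζ p := by
    by_contra! hne
    obtain ⟨P, χ, h1, h2, h3⟩ := exists_separating (μ := μ) q t η (Finset.univ.image ζ)
      (by simpa using fun p => (hne p).symm)
    have h4 := h1 _ _ h
    rw [map_sum, Finset.sum_eq_zero] at h4
    · exact (smul_ne_zero h2 hg0) h4.symm
    · intro p _
      rw [map_smul, h1 _ _ (hM p), h3 _ (Finset.mem_image_of_mem ζ (Finset.mem_univ p)), zero_smul,
        smul_zero]
  obtain ⟨p, rfl⟩ := key
  refine ⟨p, rfl, c p, ?_⟩
  obtain ⟨P, χ, h1, h2, h3⟩ := exists_separating (μ := μ) q t (ζ p)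
    ((Finset.univ.erase p).image ζ) (by simp [hζ.eq_iff])
  have h4 := h1 _ _ h
  rw [map_sum, Finset.sum_eq_single p, map_smul, h1 _ _ (hM p), smul_comm] at h4
  · exact (smul_right_injective _ h2 h4).symm
  · intro p' _ hp
    rw [map_smul, h1 _ _ (hM p'), h3 _ (Finset.mem_image_of_mem ζ (by simp [hp])), zero_smul,
      smul_zero]
  · simp

end Eigenvectors

/-! ### The span of the 0/1 monomials -/

section ZeroOnePolynomials

variable {n : ℕ} {μ : YoungDiagram} {F : Type*} [Field F]

/-- The span of the `x^d ⊗ v` with a `0/1` composition `d`. -/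
def zeroOneSpan (n : ℕ) (μ : YoungDiagram) (F : Type*) [Field F] : Submodule F (VPoly n μ F) :=
  Submodule.span F (Set.range fun p : (Fin (n + 1) → Fin 2) × RSYT n μ =>
    tens (fun i => (p.1 i : ℕ)) (Pi.single p.2 (1 : F)))

theorem tens_mem_zeroOneSpan {d : Fin (n + 1) → ℕ} (hd : ∀ i, d i ≤ 1) (v : RSYT n μ → F) :
    tens d v ∈ zeroOneSpan n μ F := by
  rw [pi_eq_sum_univ' v, map_sum]
  refine Submodule.sum_mem _ fun S _ => ?_
  rw [map_smul]
  refine Submodule.smul_mem _ _ (Submodule.subset_span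
    ⟨(fun i => ⟨d i, Nat.lt_succ_of_le (hd i)⟩, S), ?_⟩)
  congr 1

theorem lowerSpan_le_zeroOneSpan (α : Fin (n + 1) → ℕ) :
    lowerSpan n μ F α ≤ zeroOneSpan n μ F :=
  Submodule.span_le.2 fun _ ⟨_, v, h, e⟩ => e ▸ tens_mem_zeroOneSpan h.le_one v

theorem opT_mem_zeroOneSpan (t : F) (i : Fin n) {g : VPoly n μ F} (hg : g ∈ zeroOneSpan n μ F) :
    opT t i g ∈ zeroOneSpan n μ F := by
  have : zeroOneSpan n μ F ≤ (zeroOneSpan n μ F).comap (opTₗ t i) := by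
    refine Submodule.span_le.2 ?_
    rintro _ ⟨p, rfl⟩
    have h : ∀ j, (p.1 j : ℕ) ≤ 1 := fun j => Nat.le_of_lt_succ (p.1 j).2
    exact opT_tens_mem t i _ h (fun w => tens_mem_zeroOneSpan h w)
      fun w => tens_mem_zeroOneSpan (comp_swap_le i h) w
  exact this hg

variable {t : F} (ht : NotRootOfUnity t)
include ht

/-- A nonzero joint eigenvector in the span of the `x^d ⊗ v`, `d` a `0/1` composition, is
proportional to a leading one. -/
theorem exists_isLeading_smul {g : VPoly n μ F} (hg : g ∈ zeroOneSpan n μ F) (hg0 : g ≠ 0)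
    {z : Fin (n + 1) → ℤ} (hz : IsEigen (t ^ maxHook μ) t g fun i => t ^ z i) :
    ∃ (α : Fin (n + 1) → ℕ) (S : RSYT n μ) (M : VPoly n μ F) (y : F), (∀ i, α i ≤ 1) ∧
      IsLeading (t ^ maxHook μ) t α S M ∧ z = zexp α S ∧ g = y • M := by
  have hα : ∀ p : (Fin (n + 1) → Fin 2) × RSYT n μ, ∀ i, (p.1 i : ℕ) ≤ 1 :=
    fun p i => Nat.le_of_lt_succ (p.1 i).2
  choose M hM using fun p : (Fin (n + 1) → Fin 2) × RSYT n μ => exists_isLeading ht (hα p) p.2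
  have hE := fun p => (hM p).eigen
  simp only [spectral_eq_zpow ht.ne_zero] at hE
  have hinj : ∀ {z z' : Fin (n + 1) → ℤ}, (fun i => t ^ z i) = (fun i => t ^ z' i) → z = z' :=
    fun h => funext fun i => ht.zpow_inj (congrFun h i)
  have hζ : Function.Injective fun (p : (Fin (n + 1) → Fin 2) × RSYT n μ) (i : Fin (n + 1)) =>
      t ^ zexp (fun i => (p.1 i : ℕ)) p.2 i := by
    intro p p' h
    obtain ⟨h1, h2⟩ := eq_of_zexp_eq (hα p) (hα p') (hinj h)
    exact Prod.ext (funext fun i => Fin.ext (congrFun h1 i)) h2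
  have hli := linearIndependent_of_isEigen hE (fun p => (hM p).ne_zero) hζ
  -- The independent leading eigenvectors are indexed by the same finite set as the generators of
  -- the space, so they span it.
  have hspan : Submodule.span F (Set.range M) = zeroOneSpan n μ F := by
    have : FiniteDimensional F (zeroOneSpan n μ F) :=
      FiniteDimensional.span_of_finite F (Set.finite_range _)
    refine Submodule.eq_of_le_of_finrank_le (Submodule.span_le.2 ?_) ?_
    · rintro _ ⟨p, rfl⟩
      exact lowerSpan_le_zeroOneSpan _ (hM p).mem
    · rw [finrank_span_eq_card hli]
      exact finrank_range_le_card _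
  obtain ⟨p, h1, y, h2⟩ := eq_smul_of_isEigen hE hζ (hspan ▸ hg) hg0 hz
  exact ⟨_, p.2, M p, y, hα p, hM p, hinj h1, h2⟩

end ZeroOnePolynomials

/-! ### Chained exponents and the Hecke-invariant subspace -/

section Chain

variable {n : ℕ} {μ : YoungDiagram} {F : Type*} [Field F]

/-- Every exponent `z_a ≥ τ₁` is followed by the exponent `z_a - 1` further to the right. -/
def IsChained (μ : YoungDiagram) (z : Fin (n + 1) → ℤ) : Prop :=
  ∀ a, (μ.rowLen 0 : ℤ) ≤ z a → ∃ b, a < b ∧ z b = z a - 1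

/-- The span of the joint eigenvectors with chained exponents among the `0/1` polynomials. -/
def chainSpan (n : ℕ) (μ : YoungDiagram) {F : Type*} [Field F] (t : F) :
    Submodule F (VPoly n μ F) :=
  Submodule.span F {g | g ∈ zeroOneSpan n μ F ∧ ∃ z : Fin (n + 1) → ℤ,
    IsEigen (t ^ maxHook μ) t g (fun i => t ^ z i) ∧ IsChained μ z}

variable {t : F} (ht : NotRootOfUnity t)
include ht

/-- Nothing stands to the right of position `N`, so its exponent is below `τ₁`. Hence `α_N = 0`, the
rank of `N` is `N`, and the entry `N` has content zero. -/
theorem opXi_last_of_mem_chainSpan {g : VPoly n μ F} (hg : g ∈ chainSpan n μ t) :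
    opXi (t ^ maxHook μ) t (Fin.last n) g = g := by
  have : chainSpan n μ t ≤ LinearMap.eqLocus (opXiₗ (t ^ maxHook μ) t (Fin.last n))
      LinearMap.id := by
    refine Submodule.span_le.2 ?_
    rintro g ⟨hU, z, hz, hch⟩
    change opXi _ t _ g = g
    by_cases hg0 : g = 0
    · have := opXi_smul (t ^ maxHook μ) t (Fin.last n) (0 : F) (0 : VPoly n μ F)
      simpa [hg0] using this
    obtain ⟨α, S, M, y, hα, -, rfl, -⟩ := exists_isLeading_smul ht hU hg0 hz
    have h0 : α (Fin.last n) = 0 := by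
      by_contra h
      obtain ⟨b, hb, -⟩ := hch (Fin.last n)
        ((rowLen_le_zexp_iff hα S _).2 (by have := hα (Fin.last n); omega))
      exact (Fin.le_last b).not_gt hb
    have h1 : rank α (Fin.last n) = Fin.last n := by
      obtain ⟨b, hb⟩ := (rank_bijective α).2 (Fin.last n)
      by_cases hbl : b = Fin.last n
      · rwa [hbl] at hb
      have : rank α b < rank α (Fin.last n) := by
        refine rank_lt_rank ?_
        rw [h0]
        rcases Nat.eq_zero_or_pos (α b) with h | h
        · exact Or.inr ⟨h, lt_of_le_of_ne (Fin.le_last b) hbl⟩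
        · exact Or.inl h
      exact absurd (hb ▸ this) (Fin.le_last _).not_gt
    have h2 : zexp α S (Fin.last n) = 0 := by simp [zexp, h0, h1, S.content_last]
    rw [hz]
    simp only [h2, zpow_zero, one_smul]
  exact this hg

/-- The swap can break a chain only where the successor of `z_i ≥ τ₁` sits at `i + 1`; there the
step would annihilate `g`, against `hne`. -/
theorem IsChained.comp_swap {g : VPoly n μ F} (hU : g ∈ zeroOneSpan n μ F)
    {α : Fin (n + 1) → ℕ} (hα : ∀ i, α i ≤ 1) {S : RSYT n μ}
    (hz : IsEigen (t ^ maxHook μ) t g fun i => t ^ zexp α S i) (hch : IsChained μ (zexp α S))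
    (i : Fin n)
    (hne : opT t i g + ((t - 1) / (t ^ zexp α S i.succ / t ^ zexp α S i.castSucc - 1)) • g ≠ 0) :
    IsChained μ (zexp α S ∘ Equiv.swap i.castSucc i.succ) := by
  have h0 := ht.ne_zero
  have hst := hz.step ht i (zpow_ne_zero _ h0)
    (fun h => zexp_castSucc_ne hα S i (ht.zpow_inj h))
  set g' := opT t i g +
    ((t - 1) / (t ^ zexp α S i.succ / t ^ zexp α S i.castSucc - 1)) • g with hg'
  have hU' : g' ∈ zeroOneSpan n μ F :=
    Submodule.add_mem _ (opT_mem_zeroOneSpan t i hU) (Submodule.smul_mem _ _ hU)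
  obtain ⟨α', S', M, y, hα', hM, hz', hy⟩ := exists_isLeading_smul ht hU' hne
    (z := zexp α S ∘ Equiv.swap i.castSucc i.succ) hst
  have e : α' = α ∘ Equiv.swap i.castSucc i.succ := by
    ext k
    have h1 := rowLen_le_zexp_iff hα' S' k
    rw [← hz', Function.comp_apply, rowLen_le_zexp_iff hα] at h1
    have h2 := hα (Equiv.swap i.castSucc i.succ k)
    have h3 := hα' k
    rw [Function.comp_apply]
    omega
  subst e
  intro a ha
  rw [Function.comp_apply] at ha
  obtain ⟨b, hab, hb⟩ := hch _ ha
  refine ⟨Equiv.swap i.castSucc i.succ b, ?_, by simpa using hb⟩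
  by_cases hsp : Equiv.swap i.castSucc i.succ a = i.castSucc ∧ b = i.succ
  swap
  · rw [← Equiv.swap_apply_self i.castSucc i.succ a]
    refine (swap_lt_swap_iff i hsp ?_).2 hab
    rintro ⟨h1, rfl⟩
    rw [h1] at hab
    exact hab.not_gt Fin.castSucc_lt_succ
  exfalso
  rw [hsp.1] at ha hb
  rw [hsp.2] at hb
  have h1 := (rowLen_le_zexp_iff hα S _).1 ha
  have h2 := hα i.succ
  rcases (by omega : α i.succ = 1 ∨ α i.succ = 0) with h3 | h3
  -- Both entries are `1`: the image would belong to a tableau with two adjacent entries exchanged,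
  -- and there is none.
  · have h4 : α i.castSucc = α i.succ := by omega
    rw [comp_swap_of_eq h4] at hz'
    have h5 := rank_succ_of_eq h4
    have h6 := (rank α i.succ).2
    obtain ⟨j, hj⟩ : ∃ j : Fin n, j.castSucc = rank α i.castSucc :=
      ⟨⟨rank α i.castSucc, by omega⟩, Fin.ext (by simp)⟩
    have hj' : j.succ = rank α i.succ := by
      rw [Fin.ext_iff, h5, ← hj, Fin.val_castSucc, Fin.val_succ]
    have h7 : ∀ k, S'.content k = S.content (Equiv.swap j.castSucc j.succ k) := by
      intro k
      obtain ⟨k, rfl⟩ := (rank_bijective α).2 k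
      have h8 := congrFun hz' k
      have h9 := congrFun (comp_swap_of_eq h4) k
      rw [Function.comp_apply] at h8 h9
      rw [hj, hj', (rank_injective α).swap_apply]
      rw [zexp, zexp, h9] at h8
      omega
    have h8 := RSYT.two_le_abs_of_content_swap j h7
    rw [zexp, zexp, h4, ← hj, ← hj'] at hb
    have : S.content j.castSucc - S.content j.succ = 1 := by omega
    rw [this] at h8
    norm_num at h8
  -- The entries are `1, 0`, and the step is `T_i - t`, so its image is a `-1` eigenvector of `T_i`.
  -- But `T_i` sends the leading term in `x^{α s_i}` to a nonzero term in `x^α`, a monomial absent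
  -- from the image.
  · have hc : (t - 1) / (t ^ zexp α S i.succ / t ^ zexp α S i.castSucc - 1) = -t := by
      have h4 : t - 1 ≠ 0 := sub_ne_zero.2 (by simpa using ht.zpow_ne_one 1 one_ne_zero)
      have h5 : t⁻¹ - 1 ≠ 0 := by
        rw [sub_ne_zero, ne_eq, inv_eq_one]
        exact sub_ne_zero.1 h4
      rw [← zpow_sub₀ h0, hb, show zexp α S i.castSucc - 1 - zexp α S i.castSucc = -1 by ring,
        zpow_neg_one, div_eq_iff h5]
      field_simp
      ring
    have hk : opT t i g' + g' = 0 := by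
      rw [hg', hc, opT_add, opT_smul, opT_opT i ht]
      module
    have h4 : lead (α ∘ Equiv.swap i.castSucc i.succ) M ≠ 0 := hM.lead_ne_zero
    have b0 : (α ∘ Equiv.swap i.castSucc i.succ) i.castSucc = 0 := by simpa using h3
    have b1 : (α ∘ Equiv.swap i.castSucc i.succ) i.succ = 1 := by simpa using h1
    have h5 := lead_opT_step t hM.mem b0 b1
    have h6 := lead_step_eq_zero hM.mem b0 b1
    have h7 := congrArg (lead ((α ∘ Equiv.swap i.castSucc i.succ) ∘
      Equiv.swap i.castSucc i.succ)) hk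
    rw [hy, opT_smul, map_add, map_smul, map_smul, h5, h6, smul_zero, add_zero, map_zero] at h7
    rcases smul_eq_zero.1 h7 with h8 | h8
    · exact hne (by rw [hy, h8, zero_smul])
    · exact vecMul_ne_zero (isUnit_tauT ht i) h4 h8

/-- `T_i` is the intertwining step minus a scalar, and the step yields zero or another chained
eigenvector. -/
theorem opT_mem_chainSpan {g : VPoly n μ F} (hg : g ∈ chainSpan n μ t) (i : Fin n) :
    opT t i g ∈ chainSpan n μ t := by
  have : chainSpan n μ t ≤ (chainSpan n μ t).comap (opTₗ t i) := by
    refine Submodule.span_le.2 ?_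
    rintro g ⟨hU, z, hz, hch⟩
    change opT t i g ∈ chainSpan n μ t
    by_cases hg0 : g = 0
    · rw [hg0, opT_zero]; exact Submodule.zero_mem _
    have hmem : g ∈ chainSpan n μ t := Submodule.subset_span ⟨hU, z, hz, hch⟩
    obtain ⟨α, S, M, y, hα, -, rfl, -⟩ := exists_isLeading_smul ht hU hg0 hz
    set c := (t - 1) / (t ^ zexp α S i.succ / t ^ zexp α S i.castSucc - 1) with hc
    suffices h : opT t i g + c • g ∈ chainSpan n μ t by
      have h2 := Submodule.sub_mem _ h (Submodule.smul_mem _ c hmem)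
      rwa [add_sub_cancel_right] at h2
    by_cases hne : opT t i g + c • g = 0
    · rw [hne]; exact Submodule.zero_mem _
    exact Submodule.subset_span
      ⟨Submodule.add_mem _ (opT_mem_zeroOneSpan t i hU) (Submodule.smul_mem _ _ hU), _,
        hz.step ht i (zpow_ne_zero _ ht.ne_zero)
          (fun h => zexp_castSucc_ne hα S i (ht.zpow_inj h)),
        IsChained.comp_swap ht hU hα hz hch i hne⟩
  exact this hg

theorem IsLeading.mem_chainSpan {α : Fin (n + 1) → ℕ} {S : RSYT n μ} {g : VPoly n μ F}
    (h : IsLeading (t ^ maxHook μ) t α S g) (hch : IsChained μ (zexp α S)) :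
    g ∈ chainSpan n μ t := by
  have h1 := h.eigen
  rw [spectral_eq_zpow ht.ne_zero] at h1
  exact Submodule.subset_span ⟨lowerSpan_le_zeroOneSpan α h.mem, _, h1, hch⟩

/-- No exponent of a constant reaches `τ₁`, so the chain condition is vacuous. -/
theorem cst_mem_chainSpan (v : RSYT n μ → F) : cst v ∈ chainSpan n μ t := by
  rw [← tens_zero, pi_eq_sum_univ' v, map_sum]
  refine Submodule.sum_mem _ fun S _ => ?_
  rw [map_smul]
  refine Submodule.smul_mem _ _ ?_
  rw [tens_zero]
  refine (isLeading_cst_single ht _ S).mem_chainSpan ht fun a ha => ?_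
  rw [rowLen_le_zexp_iff (α := 0) fun _ => Nat.zero_le _] at ha
  simp at ha

end Chain

/-! ### The label supported on the last row -/

section LastRow

variable {n : ℕ} {μ : YoungDiagram}

theorem lastRowComp_le_one (i : Fin (n + 1)) : lastRowComp n μ i ≤ 1 := by
  rw [lastRowComp]; split_ifs <;> omega

theorem rank_lastRowComp (i : Fin (n + 1)) : rank (lastRowComp n μ) i = i := by
  have h : ∀ j : Fin (n + 1), (lastRowComp n μ i < lastRowComp n μ j ∨
      (lastRowComp n μ j = lastRowComp n μ i ∧ j < i)) ↔ j < i := by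
    intro j
    simp only [lastRowComp, Fin.lt_def]
    split_ifs <;> omega
  rw [Fin.ext_iff, val_rank]
  simp only [h]
  simp [← Finset.mem_Iio]

/-- Adding `h_τ` to the contents of the last row of `S₁` gives `τ₁ + τ_l - 1, …, τ₁` in the order of
positions. The end of the first row, where `α` vanishes because `l ≥ 2`, has content `τ₁ - 1` and
closes the chain. -/
theorem isChained_lastRowComp (h : μ.card = n + 1) (hl : 2 ≤ μ.colLen 0) :
    IsChained μ (zexp (lastRowComp n μ) (rowFilled h)) := by
  intro a ha
  rw [rowLen_le_zexp_iff lastRowComp_le_one] at ha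
  have ham : (a : ℕ) < μ.rowLen (μ.colLen 0 - 1) := by
    by_contra hlt
    simp [lastRowComp, hlt] at ha
  have h1 := rowFilled_last_row h (by omega) a ham
  have hpos : 0 < μ.rowLen 0 := lt_of_le_of_lt (Nat.zero_le _) ((rowFilled h).col_lt a)
  have hz : zexp (lastRowComp n μ) (rowFilled h) a =
      μ.rowLen 0 - 1 + μ.rowLen (μ.colLen 0 - 1) - a := by
    rw [zexp, ha, rank_lastRowComp, RSYT.content, h1.1, h1.2, maxHook]
    omega
  by_cases hb : (a : ℕ) + 1 < μ.rowLen (μ.colLen 0 - 1)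
  · have hbn : (a : ℕ) + 1 < n + 1 := by
      have h2 : a ≠ Fin.last n := by
        rintro rfl
        -- If `a` were the last position, all entries would lie in the last row, including that of
        -- the corner box `(0, 0)`.
        obtain ⟨k, hk1, hk2⟩ := (rowFilled h).exists_entry (r := 0) (c := 0)
          (μ.up_left_mem (Nat.zero_le _) (Nat.zero_le _) ((rowFilled h).mem_cells 0))
        have hlk := rowFilled_last_row h (by omega) k (by
          have := k.2
          simp only [Fin.val_last] at hb
          omega)
        omega
      have := Fin.val_lt_last h2
      omega
    have h2 := rowFilled_last_row h (by omega) ⟨a + 1, hbn⟩ hb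
    refine ⟨⟨a + 1, hbn⟩, by simp [Fin.lt_def], ?_⟩
    rw [hz, zexp, rank_lastRowComp, RSYT.content, h2.1, h2.2, maxHook]
    have : lastRowComp n μ ⟨a + 1, hbn⟩ = 1 := by simp [lastRowComp, hb]
    rw [this]
    simp only
    omega
  · obtain ⟨k, hk1, hk2⟩ := (rowFilled h).exists_entry (r := 0) (c := μ.rowLen 0 - 1)
      (YoungDiagram.mem_iff_lt_rowLen.2 (by omega))
    have hkm : ¬ (k : ℕ) < μ.rowLen (μ.colLen 0 - 1) := by
      intro hlt
      have := (rowFilled_last_row h (by omega) k hlt).1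
      omega
    refine ⟨k, by rw [Fin.lt_def]; omega, ?_⟩
    have : lastRowComp n μ k = 0 := by simp [lastRowComp, hkm]
    rw [hz, zexp, rank_lastRowComp, RSYT.content, hk1, hk2, this]
    omega

end LastRow

/-! ### Surjectivity of `w` and `w*` -/

section Surjectivity

variable {n : ℕ} {μ : YoungDiagram} {F : Type*} [Field F] {t : F} (ht : NotRootOfUnity t)

theorem foldl_surjective {A : Type*} {op : Fin n → A → A} (h : ∀ i, Function.Surjective (op i))
    (l : List (Fin n)) : Function.Surjective fun f => l.foldl (fun g j => op j g) f := by
  induction l with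
  | nil => exact Function.surjective_id
  | cons i l ih => exact ih.comp (h i)

include ht

theorem opTDown_surjective (k : ℕ) :
    Function.Surjective (opTDown t k : VPoly n μ F → VPoly n μ F) :=
  foldl_surjective (fun i f => ⟨opTinv t i f, opT_opTinv ht i f⟩) _

theorem opTinvDown_surjective (k : ℕ) :
    Function.Surjective (opTinvDown t k : VPoly n μ F → VPoly n μ F) :=
  foldl_surjective (fun i f => ⟨opT t i f, opTinv_opT ht i f⟩) _

theorem opW_surjective {q : F} (hq : q ≠ 0) :
    Function.Surjective (opW q t : VPoly n μ F → VPoly n μ F) := by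
  intro f
  induction f using VPoly.induction with
  | hc v =>
    obtain ⟨u, rfl⟩ := exists_vecMul_eq (isUnit_tauOmega ht) v
    exact ⟨cst u, opW_cst q t u⟩
  | ha f g hf hg =>
    obtain ⟨⟨f, rfl⟩, ⟨g, rfl⟩⟩ := And.intro hf hg
    exact ⟨f + g, opW_add q t f g⟩
  | hX j f hf =>
    obtain ⟨f, rfl⟩ := hf
    induction j using Fin.lastCases with
    | last =>
      refine ⟨q⁻¹ • (X 0 : MvPolynomial (Fin (n + 1)) F) • f, ?_⟩
      rw [opW_smul, opW_X_zero, inv_smul_smul₀ hq]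
    | cast j => exact ⟨(X j.succ : MvPolynomial (Fin (n + 1)) F) • f, opW_X_succ q t j f⟩

theorem opWStar_surjective {q : F} (hq : q ≠ 0) :
    Function.Surjective (opWStar q t : VPoly n μ F → VPoly n μ F) :=
  (opTDown_surjective ht 0).comp ((opW_surjective ht hq).comp (opTinvDown_surjective ht n))

end Surjectivity

/-! ### Dunkl operators and singular elements -/

section Dunkl

variable {n : ℕ} {μ : YoungDiagram} {F : Type*} [Field F] {q t : F}

theorem opD_last_eq_zero {f : VPoly n μ F} (h : opXi q t (Fin.last n) f = f) :
    opD q t (Fin.last n) f = 0 := by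
  rw [opD, Fin.reverseInduction_last, h]
  ext1 S
  simp

theorem opD_castSucc (i : Fin n) (f : VPoly n μ F) :
    opD q t i.castSucc f = t⁻¹ • opT t i (opD q t i.succ (opT t i f)) := by
  rw [opD, Fin.reverseInduction_castSucc, opD]

/-- A Hecke-invariant subspace on which `ξ_N` is the identity consists of singular elements. -/
theorem opD_eq_zero {A : Submodule F (VPoly n μ F)} (hT : ∀ i, ∀ f ∈ A, opT t i f ∈ A)
    (hξ : ∀ f ∈ A, opXi q t (Fin.last n) f = f) (i : Fin (n + 1)) (f : VPoly n μ F) (hf : f ∈ A) :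
    opD q t i f = 0 := by
  induction i using Fin.reverseInduction generalizing f with
  | last => exact opD_last_eq_zero (hξ f hf)
  | cast i ih => rw [opD_castSucc, ih _ (hT i f hf), opT_zero, smul_zero]

end Dunkl

/-! ### The radical of a Macdonald form -/

section Radical

variable {n : ℕ} {μ : YoungDiagram} {F : Type*} [Field F] {q t : F}
  {B : LinearMap.BilinForm F (VPoly n μ F)} {A : Submodule F (VPoly n μ F)}

theorem IsMacdonaldForm.apply_opTinv (hB : IsMacdonaldForm q t B) (i : Fin n)
    (f g : VPoly n μ F) : B (opTinv t i f) g = B f (opTinv t i g) := by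
  simp only [opTinv, map_smul, map_add, LinearMap.smul_apply, LinearMap.add_apply, hB.hecke]

/-- For `x_N` this is the Dunkl postulate, as `D_N` kills `f`, `q ≠ 1`, and every element has the
form `g w* w`. Lower variables follow because `x_i g` is `t` times `x_{i+1} (g T_i⁻¹)` acted on by
`T_i⁻¹`, a self-adjoint operator preserving `A`. -/
theorem IsMacdonaldForm.apply_X_smul_eq_zero (hB : IsMacdonaldForm q t B) (ht : NotRootOfUnity t)
    (hq0 : q ≠ 0) (hq1 : q ≠ 1) (hT : ∀ i, ∀ f ∈ A, opT t i f ∈ A)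
    (hξ : ∀ f ∈ A, opXi q t (Fin.last n) f = f) (j : Fin (n + 1)) (f : VPoly n μ F) (hf : f ∈ A)
    (g : VPoly n μ F) : B f ((X j : MvPolynomial (Fin (n + 1)) F) • g) = 0 := by
  induction j using Fin.reverseInduction generalizing f g with
  | last =>
    obtain ⟨g, rfl⟩ := opW_surjective ht hq0 g
    obtain ⟨g, rfl⟩ := opWStar_surjective ht hq0 g
    have h := hB.dunkl f g
    rw [opD_last_eq_zero (hξ f hf), map_zero, LinearMap.zero_apply] at h
    exact (mul_eq_zero.1 h.symm).resolve_left (sub_ne_zero.2 hq1.symm)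
  | cast i ih =>
    have h := opTinv_X_succ ht i (opTinv t i g)
    rw [opT_opTinv ht i] at h
    have h' : (X i.castSucc : MvPolynomial (Fin (n + 1)) F) • g = t • opTinv t i
        ((X i.succ : MvPolynomial (Fin (n + 1)) F) • opTinv t i g) := by
      rw [h, smul_inv_smul₀ ht.ne_zero]
    rw [h', map_smul, ← hB.apply_opTinv, ih, smul_zero]
    exact A.smul_mem _ (A.add_mem (hT i f hf) (A.smul_mem _ hf))

theorem exists_tens_eq_X_smul {d : Fin (n + 1) → ℕ} (hd : d ≠ 0) (v : RSYT n μ → F) :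
    ∃ j, ∃ g : VPoly n μ F, tens d v = (X j : MvPolynomial (Fin (n + 1)) F) • g := by
  obtain ⟨j, hj⟩ := Function.ne_iff.1 hd
  refine ⟨j, fun S => monomial (Finsupp.equivFunOnFinite.symm d - Finsupp.single j 1) (v S), ?_⟩
  ext1 S
  rw [Pi.smul_apply, smul_eq_mul, X, monomial_mul, one_mul, add_tsub_cancel_of_le, tens_apply]
  rw [Finsupp.single_le_iff]
  exact Nat.one_le_iff_ne_zero.2 hj

/-- An element of positive degree of a Hecke-invariant subspace that contains the constants and on
which `ξ_N` is the identity lies in the radical of every Macdonald form. -/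
theorem IsMacdonaldForm.apply_eq_zero (hB : IsMacdonaldForm q t B) (ht : NotRootOfUnity t)
    (hq0 : q ≠ 0) (hq1 : q ≠ 1) (hT : ∀ i, ∀ f ∈ A, opT t i f ∈ A)
    (hξ : ∀ f ∈ A, opXi q t (Fin.last n) f = f) (hc : ∀ v, cst v ∈ A) {α : Fin (n + 1) → ℕ}
    (hα : α ≠ 0) {f : VPoly n μ F} (hf : f ∈ A) (hfα : f ∈ lowerSpan n μ F α)
    (g : VPoly n μ F) : B f g = 0 := by
  induction g using VPoly.induction with
  | hc v =>
    -- The roles are exchanged: the constant lies in `A`, and every monomial of `f` is divisible by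
    -- a variable.
    rw [hB.symm]
    refine lowerSpan_induction (fun x => B (cst v) x = 0) hfα (fun d w h => ?_) (map_zero _)
      (fun _ _ hf hg => by rw [map_add, hf, hg, add_zero])
      (fun _ _ hf => by rw [map_smul, hf, smul_zero])
    have hd : d ≠ 0 := by
      rintro rfl
      have h1 := h.total
      rw [psum_last, psum_last] at h1
      simp only [Pi.zero_apply, Finset.sum_const_zero] at h1
      exact hα (funext fun i => Finset.sum_eq_zero_iff.1 h1.symm i (Finset.mem_univ i))
    obtain ⟨j, g, hg⟩ := exists_tens_eq_X_smul hd w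
    rw [hg]
    exact hB.apply_X_smul_eq_zero ht hq0 hq1 hT hξ j _ (hc v) g
  | ha f g hf hg => rw [map_add, hf, hg, add_zero]
  | hX j g _ => exact hB.apply_X_smul_eq_zero ht hq0 hq1 hT hξ j f hf g

end Radical

/-! ### Existence of a path in the graph -/

section Path

variable {n : ℕ} {μ : YoungDiagram} {F : Type*} [Field F]

/-- Every tableau is reached from `S₀` by exchanges `S ↦ S^{(j)}` with
`c(j, S) - c(j + 1, S) ≥ 2`. -/
theorem tableau_induction (h : μ.card = n + 1) {p : RSYT n μ → Prop} (h0 : p (colFilled h))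
    (hs : ∀ S S' (j : Fin n), 2 ≤ S.content j.castSucc - S.content j.succ → IsExchange j S S' →
      p S → p S') (S : RSYT n μ) : p S := by
  -- A pair with `col i < col (i + 1)` can be exchanged, which lowers this sum; without such a pair
  -- the tableau is `S₀`.
  induction hm : ∑ k : Fin (n + 1), (k : ℕ) * S.col k using Nat.strong_induction_on
    generalizing S with
  | _ m ih =>
    subst hm
    by_cases hS : ∀ i : Fin n, S.col i.succ ≤ S.col i.castSucc
    · rwa [S.eq_colFilled h hS]
    push Not at hS
    obtain ⟨i, hi⟩ := hS
    have hd : S.content i.castSucc - S.content i.succ ≤ -2 := by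
      have := S.adjacent_cases i
      simp only [RSYT.content]
      omega
    have habs : 2 ≤ |S.content i.castSucc - S.content i.succ| := le_abs.2 (Or.inr (by omega))
    have hE := isExchange_exch habs
    refine hs (exch i S) S i ?_ hE.symm (ih _ ?_ _ rfl)
    · rw [content_exch habs, content_exch habs, Equiv.swap_apply_left, Equiv.swap_apply_right]
      omega
    · have hne : i.castSucc ≠ i.succ := Fin.castSucc_lt_succ.ne
      rw [← Finset.add_sum_erase _ _ (Finset.mem_univ i.castSucc),
        ← Finset.add_sum_erase _ _ (Finset.mem_erase.2 ⟨hne.symm, Finset.mem_univ i.succ⟩),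
        ← Finset.add_sum_erase _ _ (Finset.mem_univ i.castSucc),
        ← Finset.add_sum_erase _ _ (Finset.mem_erase.2 ⟨hne.symm, Finset.mem_univ i.succ⟩)]
      have e : ∀ k ∈ (Finset.univ.erase i.castSucc).erase i.succ,
          (k : ℕ) * (exch i S).col k = (k : ℕ) * S.col k := by
        intro k hk
        simp only [Finset.mem_erase] at hk
        rw [hE.col, Equiv.swap_apply_of_ne_of_ne hk.2.1 hk.1]
      rw [Finset.sum_congr rfl e, hE.col, hE.col, Equiv.swap_apply_left, Equiv.swap_apply_right,
        Fin.val_castSucc, Fin.val_succ]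
      nlinarith

theorem exists_isMacdonald (h : μ.card = n + 1) (q t : F) (α : Fin (n + 1) → ℕ)
    (hα : ∀ i, α i ≤ 1) (S : RSYT n μ) : ∃ M, IsMacdonald h q t α S M := by
  refine zero_one_induction (p := fun α => ∃ M, IsMacdonald h q t α S M) ?_
    (fun α i _ h0 h1 ⟨M, hM⟩ => ⟨_, hM.step _ _ _ i (by omega)⟩)
    (fun α _ _ ⟨M, hM⟩ => ⟨_, hM.affine⟩) α hα
  refine tableau_induction h (p := fun S => ∃ M, IsMacdonald h q t 0 S M) ⟨_, .root⟩
    (fun S S' j h2 hE ⟨M, hM⟩ => ⟨_, hM.tableau _ _ _ _ j j rfl ?_ h2 hE⟩) S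
  have := rank_injective (0 : Fin (n + 1) → ℕ)
  rw [Fin.ext_iff, val_rank]
  simp [← Finset.mem_Iio]

end Path

/-! ### Specialization of rational functions -/

section Scalars

variable {F : Type*} [Field F] [CharZero F] {q₀ t₀ : F} {c d : ParamField} {x y : F}

theorem SpecializesTo.add (h : SpecializesTo q₀ t₀ c x) (h' : SpecializesTo q₀ t₀ d y) :
    SpecializesTo q₀ t₀ (c + d) (x + y) := by
  obtain ⟨a, b, hb, h1, h2⟩ := h
  obtain ⟨a', b', hb', h1', h2'⟩ := h'
  refine ⟨a * b' + a' * b, b * b', by rw [map_mul]; exact mul_ne_zero hb hb', ?_, ?_⟩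
  · simp only [map_mul, map_add]
    linear_combination algebraMap _ ParamField b' * h1 + algebraMap _ ParamField b * h1'
  · simp only [map_mul, map_add]
    linear_combination aeval ![q₀, t₀] b' * h2 + aeval ![q₀, t₀] b * h2'

theorem SpecializesTo.mul (h : SpecializesTo q₀ t₀ c x) (h' : SpecializesTo q₀ t₀ d y) :
    SpecializesTo q₀ t₀ (c * d) (x * y) := by
  obtain ⟨a, b, hb, h1, h2⟩ := h
  obtain ⟨a', b', hb', h1', h2'⟩ := h'
  refine ⟨a * a', b * b', by rw [map_mul]; exact mul_ne_zero hb hb', ?_, ?_⟩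
  · simp only [map_mul, ← h1, ← h1']; ring
  · simp only [map_mul, ← h2, ← h2']; ring

theorem SpecializesTo.inv (h : SpecializesTo q₀ t₀ c x) (hx : x ≠ 0) :
    SpecializesTo q₀ t₀ c⁻¹ x⁻¹ := by
  obtain ⟨a, b, hb, h1, h2⟩ := h
  have ha : aeval ![q₀, t₀] a ≠ 0 := h2 ▸ mul_ne_zero hx hb
  have hc : c ≠ 0 := by
    rintro rfl
    rw [zero_mul, eq_comm, FaithfulSMul.algebraMap_eq_zero_iff] at h1
    exact ha (by rw [h1, map_zero])
  exact ⟨b, a, ha, by rw [← h1, inv_mul_cancel_left₀ hc], by rw [← h2, inv_mul_cancel_left₀ hx]⟩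

theorem specializesTo_algebraMap (a : MvPolynomial (Fin 2) ℚ) :
    SpecializesTo q₀ t₀ (algebraMap _ ParamField a) (aeval ![q₀, t₀] a) :=
  ⟨a, 1, by simp, by simp, by simp⟩

theorem specializesTo_zero : SpecializesTo q₀ t₀ 0 0 := by
  simpa using specializesTo_algebraMap (q₀ := q₀) (t₀ := t₀) 0

theorem specializesTo_one : SpecializesTo q₀ t₀ 1 1 := by
  simpa using specializesTo_algebraMap (q₀ := q₀) (t₀ := t₀) 1

theorem specializesTo_qGen : SpecializesTo q₀ t₀ qGen q₀ := by
  have := specializesTo_algebraMap (q₀ := q₀) (t₀ := t₀) (X 0)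
  rwa [aeval_X] at this

theorem specializesTo_tGen : SpecializesTo q₀ t₀ tGen t₀ := by
  have := specializesTo_algebraMap (q₀ := q₀) (t₀ := t₀) (X 1)
  rwa [aeval_X] at this

theorem SpecializesTo.neg (h : SpecializesTo q₀ t₀ c x) : SpecializesTo q₀ t₀ (-c) (-x) := by
  simpa using (specializesTo_algebraMap (-1)).mul h

theorem SpecializesTo.sub (h : SpecializesTo q₀ t₀ c x) (h' : SpecializesTo q₀ t₀ d y) :
    SpecializesTo q₀ t₀ (c - d) (x - y) := by
  simpa [sub_eq_add_neg] using h.add h'.neg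

theorem SpecializesTo.div (h : SpecializesTo q₀ t₀ c x) (h' : SpecializesTo q₀ t₀ d y)
    (hy : y ≠ 0) : SpecializesTo q₀ t₀ (c / d) (x / y) := by
  simpa [div_eq_mul_inv] using h.mul (h'.inv hy)

theorem SpecializesTo.pow (h : SpecializesTo q₀ t₀ c x) (k : ℕ) :
    SpecializesTo q₀ t₀ (c ^ k) (x ^ k) := by
  induction k with
  | zero => simpa using specializesTo_one
  | succ k ih => rw [pow_succ, pow_succ]; exact ih.mul h

theorem SpecializesTo.zpow (h : SpecializesTo q₀ t₀ c x) (hx : x ≠ 0) (k : ℤ) :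
    SpecializesTo q₀ t₀ (c ^ k) (x ^ k) := by
  obtain ⟨m, rfl | rfl⟩ := k.eq_nat_or_neg
  · simpa using h.pow m
  · simpa using (h.pow m).inv (pow_ne_zero m hx)

theorem SpecializesTo.sum {ι : Type*} (s : Finset ι) {c : ι → ParamField} {x : ι → F}
    (h : ∀ i ∈ s, SpecializesTo q₀ t₀ (c i) (x i)) :
    SpecializesTo q₀ t₀ (∑ i ∈ s, c i) (∑ i ∈ s, x i) := by
  classical
  induction s using Finset.induction_on with
  | empty => simpa using specializesTo_zero
  | insert i s hi ih =>
    rw [Finset.sum_insert hi, Finset.sum_insert hi]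
    exact (h i (Finset.mem_insert_self i s)).add
      (ih fun j hj => h j (Finset.mem_insert_of_mem hj))

end Scalars

/-! ### Specialization of vector-valued polynomials -/

section Polynomials

variable {n : ℕ} {μ : YoungDiagram} {F : Type*} [Field F] [CharZero F] {q₀ t₀ : F}
  {M M' : VPoly n μ ParamField} {f f' : VPoly n μ F}

theorem IsSpecialization.add (h : IsSpecialization q₀ t₀ M f) (h' : IsSpecialization q₀ t₀ M' f') :
    IsSpecialization q₀ t₀ (M + M') (f + f') := fun S β => by
  simpa using (h S β).add (h' S β)

theorem IsSpecialization.smul {c : ParamField} {x : F} (hc : SpecializesTo q₀ t₀ c x)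
    (h : IsSpecialization q₀ t₀ M f) : IsSpecialization q₀ t₀ (c • M) (x • f) := fun S β => by
  simpa using hc.mul (h S β)

theorem IsSpecialization.sub (h : IsSpecialization q₀ t₀ M f) (h' : IsSpecialization q₀ t₀ M' f') :
    IsSpecialization q₀ t₀ (M - M') (f - f') := fun S β => by
  simpa using (h S β).sub (h' S β)

theorem IsSpecialization.X_smul (h : IsSpecialization q₀ t₀ M f) (j : Fin (n + 1)) :
    IsSpecialization q₀ t₀ ((X j : MvPolynomial (Fin (n + 1)) ParamField) • M)
      ((X j : MvPolynomial (Fin (n + 1)) F) • f) := fun S β => by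
  simp only [Pi.smul_apply, smul_eq_mul, coeff_X_mul']
  split_ifs
  · exact h S _
  · exact specializesTo_zero

theorem isSpecialization_cst {v : RSYT n μ → ParamField} {w : RSYT n μ → F}
    (h : ∀ S, SpecializesTo q₀ t₀ (v S) (w S)) : IsSpecialization q₀ t₀ (cst v) (cst w) := by
  intro S β
  simp only [cst, coeff_C]
  split_ifs
  · exact h S
  · exact specializesTo_zero

theorem isSpecialization_zero :
    IsSpecialization q₀ t₀ (0 : VPoly n μ ParamField) (0 : VPoly n μ F) := fun S β => by
  simpa using specializesTo_zero

theorem IsSpecialization.sum {ι : Type*} (s : Finset ι) {M : ι → VPoly n μ ParamField}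
    {f : ι → VPoly n μ F} (h : ∀ i ∈ s, IsSpecialization q₀ t₀ (M i) (f i)) :
    IsSpecialization q₀ t₀ (∑ i ∈ s, M i) (∑ i ∈ s, f i) := by
  classical
  induction s using Finset.induction_on with
  | empty => simpa using isSpecialization_zero
  | insert i s hi ih =>
    rw [Finset.sum_insert hi, Finset.sum_insert hi]
    exact (h i (Finset.mem_insert_self i s)).add
      (ih fun j hj => h j (Finset.mem_insert_of_mem hj))

theorem vpoly_eq_sum {F : Type*} [Field F] (f : VPoly n μ F) {s : Finset (Fin (n + 1) →₀ ℕ)}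
    (hs : ∀ S, (f S).support ⊆ s) :
    f = ∑ S, ∑ β ∈ s, coeff β (f S) • Pi.single S (monomial β (1 : F)) := by
  ext1 S
  rw [Finset.sum_apply, Finset.sum_eq_single S]
  · rw [Finset.sum_apply]
    simp only [Pi.smul_apply, Pi.single_eq_same, smul_monomial, smul_eq_mul, mul_one]
    conv_lhs => rw [(f S).as_sum]
    exact Finset.sum_subset (hs S) fun β _ hβ => by
      rw [notMem_support_iff.1 hβ, monomial_zero]
  · intro S' _ hS
    rw [Finset.sum_apply]
    exact Finset.sum_eq_zero fun β _ => by
      rw [Pi.smul_apply, Pi.single_eq_of_ne hS.symm, smul_zero]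
  · simp

theorem single_monomial_add {F : Type*} [Field F] (S : RSYT n μ) (j : Fin (n + 1))
    (β : Fin (n + 1) →₀ ℕ) :
    (Pi.single S (monomial (Finsupp.single j 1 + β) 1) : VPoly n μ F) =
      (X j : MvPolynomial (Fin (n + 1)) F) • Pi.single S (monomial β 1) := by
  ext1 S'
  by_cases h : S' = S
  · subst h
    rw [Pi.smul_apply, Pi.single_eq_same, Pi.single_eq_same, X, smul_eq_mul, monomial_mul, one_mul]
  · rw [Pi.smul_apply, Pi.single_eq_of_ne h, Pi.single_eq_of_ne h, smul_zero]

/-- A linear operator specializes as soon as it does so on the constants and on the products with a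
variable. -/
theorem IsSpecialization.map (P : VPoly n μ ParamField →ₗ[ParamField] VPoly n μ ParamField)
    (p : VPoly n μ F →ₗ[F] VPoly n μ F)
    (hc : ∀ S, IsSpecialization q₀ t₀ (P (cst (Pi.single S 1))) (p (cst (Pi.single S 1))))
    (hX : ∀ j M f, IsSpecialization q₀ t₀ M f → IsSpecialization q₀ t₀ (P M) (p f) →
      IsSpecialization q₀ t₀
        (P ((X j : MvPolynomial (Fin (n + 1)) ParamField) • M))
        (p ((X j : MvPolynomial (Fin (n + 1)) F) • f)))
    (h : IsSpecialization q₀ t₀ M f) : IsSpecialization q₀ t₀ (P M) (p f) := by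
  classical
  -- Monomials are carried along with their images, since `hX` needs both.
  have key : ∀ S β, IsSpecialization q₀ t₀
      (Pi.single S (monomial β 1) : VPoly n μ ParamField) (Pi.single S (monomial β 1)) ∧
      IsSpecialization q₀ t₀ (P (Pi.single S (monomial β 1))) (p (Pi.single S (monomial β 1))) := by
    intro S β
    induction β using Finsupp.induction with
    | zero =>
      have h1 := hc S
      rw [cst_single, cst_single] at h1
      refine ⟨?_, h1⟩
      have h2 : IsSpecialization q₀ t₀ (cst (Pi.single S 1) : VPoly n μ ParamField)
          (cst (Pi.single S 1)) := isSpecialization_cst fun S' => by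
        by_cases hS : S' = S
        · subst hS; simpa using specializesTo_one
        · simpa [hS] using specializesTo_zero
      rwa [cst_single, cst_single] at h2
    | single_add a b β _ _ ih =>
      clear * - ih hX
      induction b with
      | zero => rwa [Finsupp.single_zero, zero_add]
      | succ b ihb =>
        rw [add_comm b 1, Finsupp.single_add, add_assoc, single_monomial_add, single_monomial_add]
        exact ⟨ihb.1.X_smul a, hX a _ _ ihb.1 ihb.2⟩
  let s : Finset (Fin (n + 1) →₀ ℕ) :=
    (Finset.univ.biUnion fun S => (M S).support) ∪ Finset.univ.biUnion fun S => (f S).support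
  have e1 := vpoly_eq_sum M (s := s) fun S =>
    (Finset.subset_biUnion_of_mem (fun S => (M S).support) (Finset.mem_univ S)).trans
      Finset.subset_union_left
  have e2 := vpoly_eq_sum f (s := s) fun S =>
    (Finset.subset_biUnion_of_mem (fun S => (f S).support) (Finset.mem_univ S)).trans
      Finset.subset_union_right
  rw [e1, e2]
  simp only [map_sum, map_smul]
  exact .sum _ fun S _ => .sum _ fun β _ => (key S β).2.smul (h S β)

end Polynomials

/-! ### Specialization of the operators and of the Macdonald polynomials -/

section Operators

variable {n : ℕ} {μ : YoungDiagram} {F : Type*} [Field F] [CharZero F] {q₀ t₀ : F}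
  {M : VPoly n μ ParamField} {f : VPoly n μ F}

theorem notRootOfUnity_tGen : NotRootOfUnity tGen := by
  refine notRootOfUnity_of_pow ?_ fun k hk h => ?_
  · rw [tGen, ne_eq, FaithfulSMul.algebraMap_eq_zero_iff]
    exact X_ne_zero 1
  · rw [tGen, ← map_pow, FaithfulSMul.algebraMap_eq_one_iff] at h
    -- Evaluation at `2` refutes `t ^ k = 1`.
    have := congrArg (aeval (fun _ => (2 : ℚ))) h
    rw [map_pow, aeval_X, map_one] at this
    exact (one_lt_pow₀ one_lt_two hk.ne').ne' this

/-- `opW` as a linear map. -/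
def opWₗ {F : Type*} [Field F] (q t : F) : VPoly n μ F →ₗ[F] VPoly n μ F where
  toFun := opW q t
  map_add' := opW_add q t
  map_smul' := opW_smul q t

variable (ht : NotRootOfUnity t₀)
include ht

/-- The denominators `1 - t^{-b}` and `(t^b - 1)²` do not vanish at `t₀`, because the content
difference `b` is never zero. -/
theorem specializesTo_tauT (i : Fin n) (S S' : RSYT n μ) :
    SpecializesTo q₀ t₀ (tauT tGen i S S') (tauT t₀ i S S') := by
  have hT : SpecializesTo q₀ t₀ tGen t₀ := specializesTo_tGen
  have hz : ∀ b : ℤ, SpecializesTo q₀ t₀ (tGen ^ b) (t₀ ^ b) := hT.zpow ht.ne_zero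
  have h1 : SpecializesTo q₀ t₀ 1 1 := specializesTo_one
  have hd := diff_ne_zero S i
  have hdiag : SpecializesTo q₀ t₀ (diagCoeff tGen (S.diff i)) (diagCoeff t₀ (S.diff i)) :=
    (hT.sub h1).div (h1.sub (hz _)) (sub_ne_zero.2 (ht.zpow_ne_one _ (neg_ne_zero.2 hd)).symm)
  have hoff : SpecializesTo q₀ t₀ (offCoeff tGen (S.diff i)) (offCoeff t₀ (S.diff i)) := by
    rw [offCoeff, offCoeff]
    split_ifs
    · exact h1
    · exact ((hT.mul ((hz _).sub h1)).mul ((hz _).sub h1)).div (((hz _).sub h1).pow 2)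
        (pow_ne_zero 2 (sub_ne_zero.2 (ht.zpow_ne_one _ hd)))
    · exact specializesTo_zero
  have hs : ∀ T : RSYT n μ, SpecializesTo q₀ t₀ ((Pi.single T 1 : RSYT n μ → ParamField) S')
      ((Pi.single T 1 : RSYT n μ → F) S') := by
    intro T
    rw [Pi.single_apply, Pi.single_apply]
    split_ifs
    · exact h1
    · exact specializesTo_zero
  rw [tauT_row notRootOfUnity_tGen, tauT_row ht]
  exact (hdiag.mul (hs S)).add (hoff.mul (hs _))

theorem specializesTo_tauOmega (S S' : RSYT n μ) :
    SpecializesTo q₀ t₀ (tauOmega tGen S S') (tauOmega t₀ S S') := by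
  rw [tauOmega, tauOmega]
  induction List.finRange n generalizing S with
  | nil =>
    simp only [List.map_nil, List.prod_nil, Matrix.one_apply]
    split_ifs
    · exact specializesTo_one
    · exact specializesTo_zero
  | cons i l ih =>
    simp only [List.map_cons, List.prod_cons, Matrix.mul_apply]
    exact .sum _ fun T _ => (specializesTo_tauT ht i S T).mul (ih T)

theorem IsSpecialization.opT (h : IsSpecialization q₀ t₀ M f) (i : Fin n) :
    IsSpecialization q₀ t₀ (opT tGen i M) (opT t₀ i f) := by
  have h1t : SpecializesTo q₀ t₀ (1 - tGen) (1 - t₀) := specializesTo_one.sub specializesTo_tGen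
  refine IsSpecialization.map (opTₗ tGen i) (opTₗ t₀ i) (fun S => ?_) (fun j M f h h' => ?_) h
  · change IsSpecialization q₀ t₀ (VVMacdonald.opT tGen i _) (VVMacdonald.opT t₀ i _)
    rw [opT_cst, opT_cst, Matrix.single_one_vecMul, Matrix.single_one_vecMul]
    exact isSpecialization_cst fun S' => specializesTo_tauT ht i S S'
  · change IsSpecialization q₀ t₀ (VVMacdonald.opT tGen i M) (VVMacdonald.opT t₀ i f) at h'
    change IsSpecialization q₀ t₀ (VVMacdonald.opT tGen i _) (VVMacdonald.opT t₀ i _)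
    by_cases h1 : j = i.castSucc
    · rw [h1, opT_X_castSucc, opT_X_castSucc]
      exact (h'.X_smul _).add ((h.X_smul _).smul h1t)
    by_cases h2 : j = i.succ
    · rw [h2, opT_X_succ, opT_X_succ]
      exact (h'.X_smul _).sub ((h.X_smul _).smul h1t)
    · rw [opT_X_of_ne _ h1 h2, opT_X_of_ne _ h1 h2]
      exact h'.X_smul _

theorem IsSpecialization.opPhi (h : IsSpecialization q₀ t₀ M f) :
    IsSpecialization q₀ t₀ (opPhi qGen tGen M) (opPhi q₀ t₀ f) := by
  refine IsSpecialization.X_smul (IsSpecialization.map (opWₗ qGen tGen) (opWₗ q₀ t₀) (fun S => ?_)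
    (fun j M f _ h' => ?_) h) _
  · change IsSpecialization q₀ t₀ (opW qGen tGen _) (opW q₀ t₀ _)
    rw [opW_cst, opW_cst, Matrix.single_one_vecMul, Matrix.single_one_vecMul]
    exact isSpecialization_cst fun S' => specializesTo_tauOmega ht S S'
  · change IsSpecialization q₀ t₀ (opW qGen tGen M) (opW q₀ t₀ f) at h'
    change IsSpecialization q₀ t₀ (opW qGen tGen _) (opW q₀ t₀ _)
    induction j using Fin.cases with
    | zero =>
      rw [opW_X_zero, opW_X_zero]
      exact (h'.X_smul _).smul specializesTo_qGen
    | succ j =>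
      rw [opW_X_succ, opW_X_succ]
      exact h'.X_smul _

theorem IsSpecialization.ybStep (h : IsSpecialization q₀ t₀ M f) (hq : q₀ ≠ 0)
    (α : Fin (n + 1) → ℕ) (S : RSYT n μ) (i : Fin n)
    (hne : spectral q₀ t₀ α S i.castSucc ≠ spectral q₀ t₀ α S i.succ) :
    IsSpecialization q₀ t₀ (ybStep qGen tGen α S i M) (ybStep q₀ t₀ α S i f) := by
  have hs : ∀ k, SpecializesTo q₀ t₀ (spectral qGen tGen α S k) (spectral q₀ t₀ α S k) :=
    fun k => (specializesTo_qGen.pow _).mul (specializesTo_tGen.zpow ht.ne_zero _)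
  have h0 : spectral q₀ t₀ α S i.castSucc ≠ 0 :=
    mul_ne_zero (pow_ne_zero _ hq) (zpow_ne_zero _ ht.ne_zero)
  refine (h.opT ht i).add (h.smul ((specializesTo_tGen.sub specializesTo_one).div
    (((hs _).div (hs _) h0).sub specializesTo_one) (sub_ne_zero.2 fun e => hne ?_)))
  rw [div_eq_one_iff_eq h0] at e
  exact e.symm

/-- The Macdonald polynomials with `0/1` labels specialize at `q = t ^ h_τ`. -/
theorem IsMacdonald.exists_isSpecialization (h : μ.card = n + 1) {α : Fin (n + 1) → ℕ}
    {S : RSYT n μ} (hM : IsMacdonald h qGen tGen α S M) (hα : ∀ i, α i ≤ 1) :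
    ∃ f : VPoly n μ F, IsSpecialization (t₀ ^ maxHook μ) t₀ M f ∧
      IsLeading (t₀ ^ maxHook μ) t₀ α S f := by
  have hq := pow_ne_zero (maxHook μ) ht.ne_zero
  -- Every predecessor of a 0/1 label is again a 0/1 label, and an affine step that ends in one
  -- starts with `α_1 = 0`. So any path to the node meets only nonzero denominators.
  induction hM with
  | root =>
    refine ⟨Pi.single (colFilled h) 1, ?_, ?_⟩
    · rw [← cst_single, ← cst_single]
      refine isSpecialization_cst fun S => ?_
      rw [Pi.single_apply, Pi.single_apply]
      split_ifs
      · exact specializesTo_one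
      · exact specializesTo_zero
    · rw [← cst_single]
      exact isLeading_cst_single ht _ _
  | step α S M i _ hlt ih =>
    have hα' : ∀ j, α j ≤ 1 := fun j => by simpa using hα (Equiv.swap i.castSucc i.succ j)
    obtain ⟨f, h1, h2⟩ := ih hα'
    have := hα' i.succ
    exact ⟨_, h1.ybStep ht hq α S i (spectral_castSucc_ne ht hα' i),
      h2.step ht hα' (by omega) (by omega)⟩
  | tableau α S S' M i j _ heq hj h2 hE ih =>
    obtain ⟨f, h3, h4⟩ := ih hα
    exact ⟨_, h3.ybStep ht hq α S i (spectral_castSucc_ne ht hα i), h4.tableau ht hα heq hj h2 hE⟩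
  | affine α S M _ ih =>
    have h0 : α 0 = 0 := by
      have := hα (Fin.last n)
      rw [Fin.snoc_last] at this
      omega
    obtain ⟨f, h1, h2⟩ := ih fun j => by
      induction j using Fin.cases with
      | zero => omega
      | succ j => simpa [Fin.tail] using hα j.castSucc
    exact ⟨_, h1.opPhi ht, h2.affine ht h0⟩

end Operators

theorem lastRowComp_ne_zero {n : ℕ} {μ : YoungDiagram} (hl : 0 < μ.colLen 0) :
    lastRowComp n μ ≠ 0 := by
  have h : 0 < μ.rowLen (μ.colLen 0 - 1) :=
    YoungDiagram.mem_iff_lt_rowLen.1 (YoungDiagram.mem_iff_lt_colLen.2 (by omega))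
  intro h0
  have := congrFun h0 0
  rw [lastRowComp, if_pos (by simpa using h)] at this
  exact one_ne_zero this

end VVMacdonald

end

open VVMacdonald in
theorem mainTheorem7 (n : ℕ) (μ : YoungDiagram) (hμ : μ.card = n + 1) (hl : 2 ≤ μ.colLen 0) :
    (∃ M : VPoly n μ ParamField,
      IsMacdonald hμ qGen tGen (lastRowComp n μ) (rowFilled hμ) M) ∧
    ∀ M : VPoly n μ ParamField,
      IsMacdonald hμ qGen tGen (lastRowComp n μ) (rowFilled hμ) M →
      ∀ (F : Type*) [Field F] [CharZero F] (t : F), t ≠ 0 → (∀ k : ℕ, 0 < k → t ^ k ≠ 1) →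
        ∃ f : VPoly n μ F,
          IsSpecialization (t ^ maxHook μ) t M f ∧ f ≠ 0 ∧
          (∀ i : Fin (n + 1), opD (t ^ maxHook μ) t i f = 0) ∧
          ∀ B : LinearMap.BilinForm F (VPoly n μ F),
            IsMacdonaldForm (t ^ maxHook μ) t B → ∀ g : VPoly n μ F, B f g = 0 := by
  refine ⟨exists_isMacdonald hμ _ _ _ lastRowComp_le_one _, fun M hM F _ _ t ht0 ht1 => ?_⟩
  have ht := notRootOfUnity_of_pow ht0 ht1
  obtain ⟨f, hf, hlead⟩ := hM.exists_isSpecialization ht hμ lastRowComp_le_one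
  have hmem := hlead.mem_chainSpan ht (isChained_lastRowComp hμ hl)
  have hT : ∀ i, ∀ g ∈ chainSpan n μ t, opT t i g ∈ chainSpan n μ t :=
    fun i g hg => opT_mem_chainSpan ht hg i
  have hξ : ∀ g ∈ chainSpan n μ t, opXi (t ^ maxHook μ) t (Fin.last n) g = g :=
    fun g hg => opXi_last_of_mem_chainSpan ht hg
  refine ⟨f, hf, hlead.ne_zero, fun i => opD_eq_zero hT hξ i f hmem, fun B hB g => ?_⟩
  -- Since `l ≥ 2`, the exponent `h_τ` is positive, which gives `q ≠ 1`.
  exact hB.apply_eq_zero ht (pow_ne_zero _ ht0) (ht1 _ (by rw [maxHook]; omega)) hT hξ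
    (cst_mem_chainSpan ht) (lastRowComp_ne_zero (by omega)) hmem hlead.mem g
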